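/- Minkowski space is $\mathbb E^{1,2}=\mathbb R^3$ with $Q=-dt^2+dx^2+dy^2$, origin $O$, and $J^+(O)=\{Q\le 0,\ t>0\}$. Let $\Sigma$ be a compact oriented Euclidean surface with conical singularities, with a finite set $S\subset\Sigma$ of marked points containing the singularities. Let $\widetilde\tau:\Sigma\to\mathbb R_{\ge 0}$ be distance-like: there is a geodesic triangulation $\mathcal T$ of $\Sigma$ whose vertices contain $S$ (triangles may be glued to themselves) such that on each triangle $T\in\mathcal T$, with developing map $\mathcal D:T\to\mathbb E^2$, there are $\omega\in\mathbb E^2$, $\tau_0\in\mathbb R$ with $\widetilde\tau(x)=\tau_0-d(\mathcal D(x),\omega)^2$ for $x\in T$; such a $\mathcal T$ is called adapted to $\widetilde\tau$. For any $\mathcal T$ adapted to $\widetilde\tau$, let, for each $T\in\mathcal T$, $\iota_T:T\to J^+(O)$ be a direct isometric affine embedding with $-Q\circ\iota_T=\widetilde\tau$ at the vertices of $T$ (the image being oriented by a future pointing normal), and let $C_T=\{t\,\iota_T(x): t>0,\ x\in T\}$. Let $M=M(\widetilde\tau)$ be the space obtained by gluing the cones $C_T$: for each edge $e$ of $\mathcal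 T$ bounding $T_1$ and $T_2$, the faces of $C_{T_1}$ and $C_{T_2}$ over $e$ are glued by the isometry in $\mathrm{SO}_0(1,2)$ that sends $\iota_{T_2}(e)$ to $\iota_{T_1}(e)$. Its regular part consists of the points near which $M$ has a chart onto an open subset of $\{Q<0,\ t>0\}$ that is given by elements of $\mathrm{SO}_0(1,2)$ on the cones; the other points lie on singular rays over vertices. Let $\iota:\Sigma\to M$ be the associated polyhedral embedding, equal to $\iota_T$ on each $T$. Let $J^+(\iota(\Sigma))$ be the set of end points of future causal curves of $M$ starting on $\iota(\Sigma)$, a future causal curve being a continuous curve that is locally increasing for the causal order inherited from $\mathbb E^{1,2}$ (extended to the singular rays through the closed cones $C_T$). The embedding $\iota$ is called convex if for every spacelike geodesic $c:[a,b]\to M$ (continuous, and on $]a,b[$ contained in the regular part and locally affine with spacelike velocity), $c(a),c(b)\in J^+(\iota(\Sigma))$ implies $c([a,b])\subset J^+(\iota(\Sigma))$. The function $\widetilde\tau$ is called Q-convex if for every interval $I$ and every geodesic $c:I\to\Sigma\setminus S$, the function $f=\widetilde\tau\circ c$ is continuous, piecewise $\mathscr C^1$ (with locally finitely many pieces), and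 $\lim_{t_0^-}f'\le\lim_{t_0^+}f'$ for all $t_0$ in the interior of $I$. Then $\iota$ is convex if and only if $\widetilde\tau$ is Q-convex. -/

import Mathlib

open Set Filter Topology

noncomputable section

/-! ## The Euclidean plane and Minkowski space -/

/-- The Euclidean plane. -/
abbrev E2 : Type := EuclideanSpace ℝ (Fin 2)

/-- The determinant of two vectors of the plane; it fixes the orientation of the plane. -/
def det2 (u v : E2) : ℝ := u 0 * v 1 - u 1 * v 0

/-- An orientation-preserving isometry of the Euclidean plane. -/
def IsDirect (g : E2 ≃ᵃⁱ[ℝ] E2) : Prop :=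
  0 < LinearMap.det (g.linearIsometryEquiv.toLinearEquiv : E2 →ₗ[ℝ] E2)

/-- Minkowski space of dimension 2+1, with coordinates `(t, (x, y))` and origin `0`. -/
abbrev Mink : Type := ℝ × E2

/-- The bilinear form `-tt' + xx' + yy'`. -/
def minkB (u v : Mink) : ℝ := -(u.1 * v.1) + inner ℝ u.2 v.2

/-- The quadratic form `-t² + x² + y²`. -/
def minkQ (v : Mink) : ℝ := minkB v v

/-- The determinant of three vectors; it fixes the orientation `(t, x, y)` of Minkowski space. -/
def det3 (u v w : Mink) : ℝ :=
  Matrix.det !![u.1, u.2 0, u.2 1; v.1, v.2 0, v.2 1; w.1, w.2 0, w.2 1]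

def IsSpacelike (v : Mink) : Prop := 0 < minkQ v

def IsFutureCausal (v : Mink) : Prop := minkQ v ≤ 0 ∧ 0 < v.1

def IsFutureTimelike (v : Mink) : Prop := minkQ v < 0 ∧ 0 < v.1

/-- The causal order of Minkowski space. -/
def CausalLE (p q : Mink) : Prop := p = q ∨ IsFutureCausal (q - p)

/-- The group `SO₀(1,2)`: linear isometries that preserve orientation and time orientation. -/
def SO0 : Set (Mink ≃ₗ[ℝ] Mink) :=
  {g | (∀ v, minkQ (g v) = minkQ v) ∧ LinearMap.det (g : Mink →ₗ[ℝ] Mink) = 1 ∧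
    ∀ v, IsFutureCausal v → IsFutureCausal (g v)}

/-! ## Euclidean surfaces with conical singularities -/

/-- A point `s` is a conical point of angle `θ`: polar coordinates `(ρ, a) ↦ Φ (ρ, a)`,
with `a` taken modulo `θ`, identify a neighbourhood of the apex of the Euclidean cone
of total angle `θ` with a neighbourhood of `s`, compatibly with the oriented Euclidean charts
away from the apex. -/
def IsConePoint {X : Type*} [TopologicalSpace X] (atlas : Set (OpenPartialHomeomorph X E2))
    (marked : Set X) (s : X) (θ : ℝ) : Prop :=
  ∃ r > 0, ∃ Φ : ℝ × ℝ → X,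
    ContinuousOn Φ (Ico 0 r ×ˢ univ) ∧
    (∀ a, Φ (0, a) = s) ∧
    (∀ ρ ∈ Ico 0 r, ∀ ρ' ∈ Ico 0 r, ∀ a a',
      Φ (ρ, a) = Φ (ρ', a') ↔ ρ = ρ' ∧ (ρ = 0 ∨ ∃ n : ℤ, a' = a + n * θ)) ∧
    Φ '' (Ico 0 r ×ˢ univ) ∈ 𝓝 s ∧
    ∀ ρ ∈ Ioo 0 r, ∀ a, Φ (ρ, a) ∉ marked ∧
      ∀ φ ∈ atlas, Φ (ρ, a) ∈ φ.source → ∃ g : E2 ≃ᵃⁱ[ℝ] E2, IsDirect g ∧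
        ∀ᶠ z in 𝓝 (ρ, a), φ (Φ z) = g !₂[z.1 * Real.cos z.2, z.1 * Real.sin z.2]

/-- The structure of an (oriented) Euclidean surface with conical singularities on `X`, with a
finite set of marked points that contains the singularities: an oriented Euclidean atlas of the
complement of the marked points, each marked point being conical (an angle `2π` is allowed). -/
structure EuclideanConeSurface (X : Type*) [TopologicalSpace X] where
  marked : Set X
  marked_finite : marked.Finite
  atlas : Set (OpenPartialHomeomorph X E2)
  source_disjoint : ∀ φ ∈ atlas, Disjoint φ.source marked
  cover : ∀ x, x ∉ marked → ∃ φ ∈ atlas, x ∈ φ.source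
  compatible : ∀ φ ∈ atlas, ∀ ψ ∈ atlas, ∀ x ∈ φ.source ∩ ψ.source,
    ∃ g : E2 ≃ᵃⁱ[ℝ] E2, IsDirect g ∧ ∀ᶠ y in 𝓝 x, ψ y = g (φ y)
  conical : ∀ s ∈ marked, ∃ θ > 0, IsConePoint atlas marked s θ

/-- `c`, restricted to the interval `I`, is a geodesic of the surface minus its marked points:
it is locally affine in the Euclidean charts. -/
def EuclideanConeSurface.IsGeodesicOn {X : Type*} [TopologicalSpace X]
    (E : EuclideanConeSurface X) (c : ℝ → X) (I : Set ℝ) : Prop :=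
  ∀ t ∈ I, ∃ φ ∈ E.atlas, ∃ p v : E2,
    c t ∈ φ.source ∧ ∀ᶠ s in 𝓝[I] t, c s ∈ φ.source ∧ φ (c s) = p + s • v

/-! ## Q-convexity -/

/-- `f` is piecewise `C¹` on the interval `I` (with locally finitely many pieces, each of class
`C¹` up to its end points). -/
def IsPiecewiseC1On (f : ℝ → ℝ) (I : Set ℝ) : Prop :=
  ∀ t ∈ I, ∃ ε > 0, ContDiffOn ℝ 1 f (I ∩ Icc (t - ε) t) ∧ ContDiffOn ℝ 1 f (I ∩ Icc t (t + ε))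

/-- Q-convexity of a function on an interval: the one-sided limits of the derivative satisfy
`f'(t⁻) ≤ f'(t⁺)` at every interior point. -/
def QConvexOn (f : ℝ → ℝ) (I : Set ℝ) : Prop :=
  ContinuousOn f I ∧ IsPiecewiseC1On f I ∧
    ∀ t ∈ interior I, ∃ l r : ℝ,
      Tendsto (deriv f) (𝓝[<] t) (𝓝 l) ∧ Tendsto (deriv f) (𝓝[>] t) (𝓝 r) ∧ l ≤ r

/-- Q-convexity of a function on the surface: it is Q-convex along every geodesic of the
complement of the marked points. -/
def EuclideanConeSurface.IsQConvex {X : Type*} [TopologicalSpace X]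
    (E : EuclideanConeSurface X) (f : X → ℝ) : Prop :=
  ∀ (I : Set ℝ) (c : ℝ → X), I.OrdConnected → E.IsGeodesicOn c I → QConvexOn (f ∘ c) I

/-! ## Geodesic triangulations and distance-like functions -/

/-- The (solid) triangle with the given vertices. -/
def solidTriangle (v : Fin 3 → E2) : Set E2 := convexHull ℝ (range v)

/-- The `k`-th side of a triangle, parametrised by `[0, 1]` from vertex `k` to vertex `k + 1`. -/
def sidePoint (v : Fin 3 → E2) (k : Fin 3) (s : ℝ) : E2 := AffineMap.lineMap (v k) (v (k + 1)) s

/-- The elementary identifications between points of triangles whose sides are glued in pairs,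
each side being glued to its partner with reversed orientation. -/
def SideGlue {ι : Type} (vert : ι → Fin 3 → E2) (pair : ι × Fin 3 → ι × Fin 3)
    (a b : ι × E2) : Prop :=
  ∃ k l : Fin 3, ∃ s ∈ Icc (0 : ℝ) 1, pair (a.1, k) = (b.1, l) ∧
    a.2 = sidePoint (vert a.1) k s ∧ b.2 = sidePoint (vert b.1) l (1 - s)

/-- A geodesic triangulation of a Euclidean surface with conical singularities, whose vertices
contain the marked points. The triangles are given by their developments: positively oriented
nondegenerate triangles of the plane, together with maps `cell i` (inverse to developing maps) to
the surface. The sides are glued in pairs, and two points of the triangles have the same image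
in the surface exactly when they are identified by this gluing. Two triangles may share several
sides or vertices, and a triangle may be glued to itself. -/
structure GeodesicTriangulation {X : Type*} [TopologicalSpace X] (E : EuclideanConeSurface X) where
  ι : Type
  finite : Finite ι
  vert : ι → Fin 3 → E2
  vert_pos : ∀ i, 0 < det2 (vert i 1 - vert i 0) (vert i 2 - vert i 0)
  cell : ι → E2 → X
  cell_continuous : ∀ i, ContinuousOn (cell i) (solidTriangle (vert i))
  cell_isometric : ∀ i, ∀ x ∈ solidTriangle (vert i), ∀ φ ∈ E.atlas, cell i x ∈ φ.source →
    ∃ g : E2 ≃ᵃⁱ[ℝ] E2, IsDirect g ∧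
      ∀ᶠ y in 𝓝[solidTriangle (vert i)] x, φ (cell i y) = g y
  cell_surjective : ∀ x : X, ∃ i, ∃ y, y ∈ solidTriangle (vert i) ∧ cell i y = x
  pair : ι × Fin 3 → ι × Fin 3
  pair_involutive : Function.Involutive pair
  pair_ne : ∀ a, pair a ≠ a
  cell_eq_iff : ∀ i j, ∀ x ∈ solidTriangle (vert i), ∀ y ∈ solidTriangle (vert j),
    cell i x = cell j y ↔ Relation.EqvGen (SideGlue vert pair) (i, x) (j, y)
  marked_subset : ∀ s ∈ E.marked, ∃ i k, cell i (vert i k) = s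

namespace GeodesicTriangulation

variable {X : Type*} [TopologicalSpace X] {E : EuclideanConeSurface X}

/-- The solid triangle of index `i`. -/
def tri (T : GeodesicTriangulation E) (i : T.ι) : Set E2 := solidTriangle (T.vert i)

/-- The triangulation is adapted to `f`: on each triangle, `f` is of the form `τ₀ - d(·, ω)²`
in the development of the triangle. -/
def IsAdapted (T : GeodesicTriangulation E) (f : X → ℝ) : Prop :=
  ∀ i, ∃ (ω : E2) (τ₀ : ℝ), ∀ x ∈ T.tri i, f (T.cell i x) = τ₀ - dist x ω ^ 2

end GeodesicTriangulation

/-- A function on the surface is distance-like if some geodesic triangulation is adapted to it. -/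
def EuclideanConeSurface.IsDistanceLike {X : Type*} [TopologicalSpace X]
    (E : EuclideanConeSurface X) (f : X → ℝ) : Prop :=
  ∃ T : GeodesicTriangulation E, T.IsAdapted f

namespace GeodesicTriangulation

variable {X : Type*} [TopologicalSpace X] {E : EuclideanConeSurface X}

/-! ## The suspension -/

/-- `J` embeds the `i`-th triangle in `J⁺(O)`, isometrically and affinely, with `-Q ∘ J = τ` at the
vertices, and directly: the orientation of the plane corresponds to the one that a future pointing
normal induces on the image. -/
def IsSuspensionEmbedding (T : GeodesicTriangulation E) (τ : X → ℝ) (i : T.ι)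
    (J : E2 →ᵃ[ℝ] Mink) : Prop :=
  (∀ v, minkQ (J.linear v) = ‖v‖ ^ 2) ∧
  (∀ x ∈ T.tri i, IsFutureCausal (J x)) ∧
  (∀ k, -minkQ (J (T.vert i k)) = τ (T.cell i (T.vert i k))) ∧
  ∃ n, IsFutureTimelike n ∧ (∀ v, minkB n (J.linear v) = 0) ∧
    0 < det3 n (J.linear (EuclideanSpace.single 0 1)) (J.linear (EuclideanSpace.single 1 1))

/-- The cone of rays from the origin through the `i`-th embedded triangle. -/
def cone (T : GeodesicTriangulation E) (J : T.ι → E2 →ᵃ[ℝ] Mink) (i : T.ι) : Set Mink :=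
  {p | ∃ t : ℝ, 0 < t ∧ ∃ x ∈ T.tri i, p = t • J i x}

/-- The face of the cone over the `k`-th side of the `i`-th triangle. -/
def face (T : GeodesicTriangulation E) (J : T.ι → E2 →ᵃ[ℝ] Mink) (i : T.ι) (k : Fin 3) :
    Set Mink :=
  {p | ∃ t : ℝ, 0 < t ∧ ∃ s ∈ Icc (0 : ℝ) 1, p = t • J i (sidePoint (T.vert i) k s)}

/-- The gluing of the cones: the faces over two sides glued in the surface are identified by
the isometry in `SO₀(1,2)` that sends the one embedded side to the other. -/
def coneGlue (T : GeodesicTriangulation E) (J : T.ι → E2 →ᵃ[ℝ] Mink)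
    (a b : (i : T.ι) × T.cone J i) : Prop :=
  ∃ k l : Fin 3, T.pair (a.1, k) = (b.1, l) ∧ (a.2 : Mink) ∈ T.face J a.1 k ∧
    ∃ γ ∈ SO0, γ (J a.1 (T.vert a.1 k)) = J b.1 (T.vert b.1 (l + 1)) ∧
      γ (J a.1 (T.vert a.1 (k + 1))) = J b.1 (T.vert b.1 l) ∧
      (b.2 : Mink) = γ (a.2 : Mink)

/-- The spacetime obtained by gluing the cones along their faces. -/
def Suspension (T : GeodesicTriangulation E) (J : T.ι → E2 →ᵃ[ℝ] Mink) : Type :=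
  Quot (T.coneGlue J)

variable (T : GeodesicTriangulation E) (J : T.ι → E2 →ᵃ[ℝ] Mink)

/-- The suspension carries the quotient topology of the disjoint union of the cones. -/
instance : TopologicalSpace (T.Suspension J) :=
  inferInstanceAs (TopologicalSpace (Quot (T.coneGlue J)))

/-- The natural map from the `i`-th cone to the suspension. -/
def toSusp (i : T.ι) (p : T.cone J i) : T.Suspension J := Quot.mk _ ⟨i, p⟩

/-- The points of an embedded triangle belong to the cone over it. -/
theorem mem_cone (i : T.ι) {x : E2} (hx : x ∈ T.tri i) : J i x ∈ T.cone J i :=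
  ⟨1, one_pos, x, hx, (one_smul ℝ _).symm⟩

/-- The embedding of the surface associated with the suspension: it is `J i` on the `i`-th
triangle. -/
def embed (x : X) : T.Suspension J :=
  T.toSusp J (T.cell_surjective x).choose
    ⟨J _ (T.cell_surjective x).choose_spec.choose,
      T.mem_cone J _ (T.cell_surjective x).choose_spec.choose_spec.1⟩

/-- The charts of the regular part of the suspension, with values in `I⁺(O)`: homeomorphisms
between open sets that coincide with elements of `SO₀(1,2)` locally on each cone. A point is
regular if it is in the domain of such a chart. -/
def IsFlatChart (φ : OpenPartialHomeomorph (T.Suspension J) Mink) : Prop :=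
  (∀ p ∈ φ.target, IsFutureTimelike p) ∧
  ∀ (i : T.ι) (p : T.cone J i), T.toSusp J i p ∈ φ.source →
    ∃ g ∈ SO0, ∀ᶠ q in 𝓝 p, φ (T.toSusp J i q) = g (q : Mink)

/-- `c : [a, b] → M` is a spacelike geodesic: a continuous curve that, on the open interval, stays
in the regular part and is locally affine with spacelike velocity in the flat charts. (The end
points are allowed to lie on singular lines.) -/
def IsSpacelikeGeodesic (c : ℝ → T.Suspension J) (a b : ℝ) : Prop :=
  ContinuousOn c (Icc a b) ∧
  ∀ t ∈ Ioo a b, ∃ φ, T.IsFlatChart J φ ∧ ∃ p v : Mink, IsSpacelike v ∧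
    c t ∈ φ.source ∧ ∀ᶠ s in 𝓝 t, c s ∈ φ.source ∧ φ (c s) = p + s • v

/-- The causal relation `≤_U` of a subset `U` of the suspension, inherited from the causal order
of Minkowski space: `m ≤_U m'` if one goes from `m` to `m'` by finitely many future causal
segments, each contained in one (closed) cone and in `U`. On the cone around a ray over a vertex,
this is the extension of the causal order of the regular part to the singular line. -/
def LocalCausalLE (U : Set (T.Suspension J)) : T.Suspension J → T.Suspension J → Prop :=
  Relation.ReflTransGen fun m m' => ∃ (i : T.ι) (p q : T.cone J i),
    T.toSusp J i p = m ∧ T.toSusp J i q = m' ∧ CausalLE (p : Mink) q ∧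
    ∀ z : T.cone J i, (z : Mink) ∈ segment ℝ (p : Mink) q → T.toSusp J i z ∈ U

/-- A future causal curve `γ : [a, b] → M`: continuous and locally increasing for the causal
relation. -/
def IsFutureCausalCurve (γ : ℝ → T.Suspension J) (a b : ℝ) : Prop :=
  ContinuousOn γ (Icc a b) ∧
  ∀ t ∈ Icc a b, ∀ U ∈ 𝓝 (γ t), ∃ ε > 0, ∀ s ∈ Icc a b, ∀ s' ∈ Icc a b,
    |s - t| < ε → |s' - t| < ε → s ≤ s' → T.LocalCausalLE J U (γ s) (γ s')

/-- The causal future of a set. -/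
def causalFuture (A : Set (T.Suspension J)) : Set (T.Suspension J) :=
  {m | ∃ (γ : ℝ → T.Suspension J) (a b : ℝ), a ≤ b ∧ T.IsFutureCausalCurve J γ a b ∧
    γ a ∈ A ∧ γ b = m}

/-- A map from the surface to the suspension is convex if the causal future of its image is
convex along spacelike geodesics. -/
def IsConvexMap (f : X → T.Suspension J) : Prop :=
  ∀ (a b : ℝ) (c : ℝ → T.Suspension J), a ≤ b → T.IsSpacelikeGeodesic J c a b →
    c a ∈ T.causalFuture J (range f) → c b ∈ T.causalFuture J (range f) →
    ∀ t ∈ Icc a b, c t ∈ T.causalFuture J (range f)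

end GeodesicTriangulation

end

open Set Filter Topology

noncomputable section

/-! ## Linear algebra of the plane -/

/-! Both properties are equivalent to a condition on single edges, `EdgesConvex`. Bring the two
embedded planes along an edge into one frame by the gluing isometry. Let `w`, `w'` be the inward
conormals, scaled so that `Q(w) = Q(w') = L`, the squared length of the edge, and let `u = w + w'`
(`conormalSum`). Both normals are future timelike, so the reversed Cauchy-Schwarz inequality gives
`B(w, w') ≤ -L` (`conormal_inequality`), hence `Q(u) = 2L + 2B(w, w') ≤ 0`. So `u` is zero or
causal, and the only question is its time orientation: the edge is convex when `u` does not point to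
the past.

On the surface, `τ = -Q ∘ J` on each triangle (`IsAdapted.minkQ_eq`). Along a geodesic that crosses
the edge at `p` with velocity the common development of the conormal, the derivative of `τ` jumps by
`-2B(p, u)`. Since `u` is orthogonal to the edge, this number is constant along it, and it is
nonnegative exactly when `u` is not past pointing (`minkB_right_nonpos_iff`). So Q-convexity forces
convex edges. Conversely, over a convex edge the expression of `τ` on one triangle extends to a
lower bound on the other. As each expression is affine up to `-‖z‖²`, the function `τ + ‖z‖²` has
affine supports in a chart and is locally convex along lines.

In the spacetime, let the height be the function that is linear on each cone and equal to `1` on the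
surface. It increases along causal curves because the planes are spacelike, and the rays are causal,
so the causal future of the surface is `{height ≥ 1}` (`mem_causalFuture_iff`). Over convex edges
the linear expression on one cone bounds the height on the next one from above, so the height is
locally concave along affine lines, and a maximum principle gives convexity of the future. At an
edge with `u` past pointing, the segment from `a + r w` to `a + r w'` starts and ends on the
surface, but its midpoint `a + (r/2) u` has height less than `1`.

Vertices impose no condition of their own. A vertex in a Euclidean chart is isolated, and a regular
ray over a vertex is a line in a flat chart; both are avoided by parallel lines, and the
inequalities pass to the limit (`MidpointConvexAt.of_parallel`). -/

theorem E2.ext_coord {u v : E2} (h0 : u 0 = v 0) (h1 : u 1 = v 1) : u = v := by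
  ext i; fin_cases i <;> assumption

theorem inner_E2 (u v : E2) : inner ℝ u v = u 0 * v 0 + u 1 * v 1 := by
  simp [PiLp.inner_apply, Fin.sum_univ_two, mul_comm]

theorem norm_sq_E2 (u : E2) : ‖u‖ ^ 2 = u 0 ^ 2 + u 1 ^ 2 := by
  rw [EuclideanSpace.norm_sq_eq]; simp [Fin.sum_univ_two]

/-- The rotation of angle `π / 2`. -/
def rot (u : E2) : E2 := !₂[-u 1, u 0]

@[simp] theorem rot_zero_coord (u : E2) : rot u 0 = -u 1 := rfl
@[simp] theorem rot_one_coord (u : E2) : rot u 1 = u 0 := rfl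

theorem norm_rot (u : E2) : ‖rot u‖ ^ 2 = ‖u‖ ^ 2 := by
  simp [norm_sq_E2]; ring

theorem inner_rot (u v : E2) : inner ℝ (rot u) v = det2 u v := by
  simp [inner_E2, det2]; ring

theorem E2.eq_combination (u : E2) :
    u = u 0 • (EuclideanSpace.single 0 1 : E2) + u 1 • (EuclideanSpace.single 1 1 : E2) := by
  apply E2.ext_coord <;> simp

theorem det2_map (g : E2 →ₗ[ℝ] E2) (u v : E2) : det2 (g u) (g v) = LinearMap.det g * det2 u v := by
  have key : ∀ u v : E2, det2 u v = (EuclideanSpace.basisFun (Fin 2) ℝ).toBasis.det ![u, v] := by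
    intro u v
    simp [Module.Basis.det_apply, Matrix.det_fin_two, Module.Basis.toMatrix_apply, det2]
    ring
  rw [key, key, ← Module.Basis.det_comp]
  congr 1
  ext i : 1
  fin_cases i <;> rfl

/-- The square of `det2` is a Gram determinant, so an isometry has determinant `±1`; directness
selects the sign. -/
theorem IsDirect.det2_eq {g : E2 ≃ᵃⁱ[ℝ] E2} (hg : IsDirect g) (u v : E2) :
    det2 (g.linearIsometryEquiv u) (g.linearIsometryEquiv v) = det2 u v := by
  have h := det2_map (g.linearIsometryEquiv.toLinearEquiv : E2 →ₗ[ℝ] E2)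
  have h1 : ∀ u v, inner ℝ (g.linearIsometryEquiv u) (g.linearIsometryEquiv v) = inner ℝ u v :=
    g.linearIsometryEquiv.inner_map_map
  have hd : LinearMap.det (g.linearIsometryEquiv.toLinearEquiv : E2 →ₗ[ℝ] E2) = 1 := by
    have h2 : ∀ u v : E2, det2 u v ^ 2 = ‖u‖ ^ 2 * ‖v‖ ^ 2 - inner ℝ u v ^ 2 := by
      intro u v
      simp only [norm_sq_E2, inner_E2, det2]; ring
    have h3 := congrArg (· ^ 2) (h (EuclideanSpace.single 0 1) (EuclideanSpace.single 1 1))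
    have h4 : det2 (EuclideanSpace.single 0 1) (EuclideanSpace.single 1 1) = 1 := by simp [det2]
    simp only [h4, mul_one] at h3
    rw [h2] at h3
    have h5 : 0 < LinearMap.det (g.linearIsometryEquiv.toLinearEquiv : E2 →ₗ[ℝ] E2) := hg
    simp [h1, inner_E2] at h3
    nlinarith [h3, h5]
  have := h u v
  rw [hd, one_mul] at this
  exact this

theorem IsDirect.map_rot {g : E2 ≃ᵃⁱ[ℝ] E2} (hg : IsDirect g) (u : E2) :
    g.linearIsometryEquiv (rot u) = rot (g.linearIsometryEquiv u) := by
  refine ext_inner_right ℝ fun w => ?_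
  obtain ⟨w, rfl⟩ := g.linearIsometryEquiv.surjective w
  rw [LinearIsometryEquiv.inner_map_map, inner_rot, inner_rot, hg.det2_eq]

/-! ## Linear algebra of Minkowski space -/

theorem Mink.ext_coord {u v : Mink} (h : u.1 = v.1) (h0 : u.2 0 = v.2 0) (h1 : u.2 1 = v.2 1) :
    u = v := Prod.ext h (E2.ext_coord h0 h1)

theorem minkB_eq (u v : Mink) :
    minkB u v = -(u.1 * v.1) + (u.2 0 * v.2 0 + u.2 1 * v.2 1) := by
  rw [minkB, inner_E2]

theorem det3_eq (u v w : Mink) :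
    det3 u v w = u.1 * (v.2 0 * w.2 1 - v.2 1 * w.2 0) - u.2 0 * (v.1 * w.2 1 - v.2 1 * w.1)
      + u.2 1 * (v.1 * w.2 0 - v.2 0 * w.1) := by
  simp [det3, Matrix.det_fin_three]; ring

theorem minkB_comm (u v : Mink) : minkB u v = minkB v u := by simp only [minkB_eq]; ring

theorem minkB_add_left (u v w : Mink) : minkB (u + v) w = minkB u w + minkB v w := by
  simp [minkB_eq]; ring

theorem minkB_smul_left (a : ℝ) (u v : Mink) : minkB (a • u) v = a * minkB u v := by
  simp [minkB_eq]; ring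

theorem minkB_add_right (u v w : Mink) : minkB u (v + w) = minkB u v + minkB u w := by
  simp [minkB_eq]; ring

theorem minkB_smul_right (a : ℝ) (u v : Mink) : minkB u (a • v) = a * minkB u v := by
  simp [minkB_eq]; ring

theorem minkB_sub_right (u v w : Mink) : minkB u (v - w) = minkB u v - minkB u w := by
  simp [minkB_eq]; ring

theorem minkB_sub_left (u v w : Mink) : minkB (u - v) w = minkB u w - minkB v w := by
  simp [minkB_eq]; ring

theorem minkB_neg_right (u v : Mink) : minkB u (-v) = -minkB u v := by
  simp [minkB_eq]; ring

theorem minkB_neg_left (u v : Mink) : minkB (-u) v = -minkB u v := by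
  simp [minkB_eq]; ring

@[simp] theorem minkB_zero_right (u : Mink) : minkB u 0 = 0 := by simp [minkB_eq]

theorem minkQ_add (u v : Mink) : minkQ (u + v) = minkQ u + 2 * minkB u v + minkQ v := by
  simp [minkQ, minkB_eq]; ring

theorem minkQ_smul (a : ℝ) (u : Mink) : minkQ (a • u) = a ^ 2 * minkQ u := by
  simp [minkQ, minkB_eq]; ring

theorem minkB_eq_minkQ (u v : Mink) : minkB u v = (minkQ (u + v) - minkQ u - minkQ v) / 2 := by
  rw [minkQ_add]; ring

theorem continuous_minkB : Continuous fun p : Mink × Mink => minkB p.1 p.2 := by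
  simp only [minkB]; fun_prop

theorem continuous_minkB_right (u : Mink) : Continuous (minkB u) :=
  continuous_minkB.comp (Continuous.prodMk_right u)

theorem continuous_minkQ : Continuous minkQ :=
  continuous_minkB.comp (continuous_id.prodMk continuous_id)

theorem continuous_det3 (u v : Mink) : Continuous (det3 u v) := by
  have h : det3 u v = fun w => det3 u v w := rfl
  rw [h]; simp only [det3_eq]; fun_prop

/-- The Lorentzian cross product. -/
def mcross (a b : Mink) : Mink :=
  (-(a.2 0 * b.2 1 - a.2 1 * b.2 0),
    !₂[-(a.1 * b.2 1 - a.2 1 * b.1), a.1 * b.2 0 - a.2 0 * b.1])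

theorem minkB_mcross (a b c : Mink) : minkB (mcross a b) c = det3 a b c := by
  simp [minkB_eq, det3_eq, mcross]; ring

theorem minkB_mcross_mcross (a b c d : Mink) :
    minkB (mcross a b) (mcross c d) = minkB a d * minkB b c - minkB a c * minkB b d := by
  simp [minkB_eq, mcross]; ring

theorem det3_cyclic (a b c : Mink) : det3 a b c = det3 b c a := by simp only [det3_eq]; ring

theorem det3_swap (a b c : Mink) : det3 b a c = -det3 a b c := by simp only [det3_eq]; ring

theorem det3_add_right (a b c d : Mink) : det3 a b (c + d) = det3 a b c + det3 a b d := by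
  simp [det3_eq]; ring

theorem det3_smul_right (a b c : Mink) (t : ℝ) : det3 a b (t • c) = t * det3 a b c := by
  simp [det3_eq]; ring

theorem det3_cramer (a b c w : Mink) :
    det3 a b c • w = det3 b c w • a + det3 c a w • b + det3 a b w • c := by
  apply Mink.ext_coord <;> simp [det3_eq] <;> ring

theorem mink_ext_of_det3 {a b c : Mink} (h : det3 a b c ≠ 0) {f g : Mink →ₗ[ℝ] Mink}
    (ha : f a = g a) (hb : f b = g b) (hc : f c = g c) : f = g := by
  refine LinearMap.ext fun w => ?_
  have := det3_cramer a b c w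
  have hf := congrArg f this
  have hg := congrArg g this
  simp only [map_add, map_smul, ha, hb, hc] at hf hg
  have := hf.trans hg.symm
  exact smul_right_injective _ h this

theorem det3_map (g : Mink →ₗ[ℝ] Mink) (u v w : Mink) :
    det3 (g u) (g v) (g w) = LinearMap.det g * det3 u v w := by
  let e : Mink ≃ₗ[ℝ] (Fin 3 → ℝ) :=
    { toFun := fun p => ![p.1, p.2 0, p.2 1]
      invFun := fun f => (f 0, !₂[f 1, f 2])
      map_add' := fun p q => by ext i; fin_cases i <;> simp
      map_smul' := fun a p => by ext i; fin_cases i <;> simp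
      left_inv := fun p => by apply Mink.ext_coord <;> simp
      right_inv := fun f => by ext i; fin_cases i <;> simp }
  let b := Module.Basis.ofEquivFun e
  have key : ∀ u v w : Mink, det3 u v w = b.det ![u, v, w] := by
    intro u v w
    simp [Module.Basis.det_apply, Matrix.det_fin_three, Module.Basis.toMatrix_apply, det3_eq, b, e]
    ring
  rw [key, key, ← Module.Basis.det_comp]
  congr 1
  ext i : 1
  fin_cases i <;> rfl

/-! ## Causal vectors -/

theorem minkQ_nonpos_iff (v : Mink) : minkQ v ≤ 0 ↔ v.2 0 ^ 2 + v.2 1 ^ 2 ≤ v.1 ^ 2 := by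
  rw [minkQ, minkB_eq]; constructor <;> intro h <;> nlinarith

theorem minkQ_neg_iff (v : Mink) : minkQ v < 0 ↔ v.2 0 ^ 2 + v.2 1 ^ 2 < v.1 ^ 2 := by
  rw [minkQ, minkB_eq]; constructor <;> intro h <;> nlinarith

theorem IsFutureTimelike.causal {v : Mink} (h : IsFutureTimelike v) : IsFutureCausal v :=
  ⟨h.1.le, h.2⟩

theorem fst_ne_zero_of_causal {v : Mink} (h : minkQ v ≤ 0) (hv : v ≠ 0) : v.1 ≠ 0 := by
  intro h0
  rw [minkQ_nonpos_iff, h0] at h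
  apply hv
  apply Mink.ext_coord
  · simpa using h0
  · simp; nlinarith [sq_nonneg (v.2 0), sq_nonneg (v.2 1)]
  · simp; nlinarith [sq_nonneg (v.2 0), sq_nonneg (v.2 1)]

/-- A future timelike vector and a future causal vector have negative product. -/
theorem minkB_neg_of_timelike {n v : Mink} (hn : IsFutureTimelike n) (hv : IsFutureCausal v) :
    minkB n v < 0 := by
  obtain ⟨hn, hn0⟩ := hn
  obtain ⟨hv, hv0⟩ := hv
  rw [minkQ_neg_iff] at hn
  rw [minkQ_nonpos_iff] at hv
  rw [minkB_eq]
  have h1 : (n.2 0 * v.2 0 + n.2 1 * v.2 1) ^ 2 < (n.1 * v.1) ^ 2 := by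
    have h2 : (n.2 0 * v.2 0 + n.2 1 * v.2 1) ^ 2 ≤
        (n.2 0 ^ 2 + n.2 1 ^ 2) * (v.2 0 ^ 2 + v.2 1 ^ 2) := by
      nlinarith [sq_nonneg (n.2 0 * v.2 1 - n.2 1 * v.2 0)]
    have h3 : (n.2 0 ^ 2 + n.2 1 ^ 2) * (v.2 0 ^ 2 + v.2 1 ^ 2) ≤
        (n.2 0 ^ 2 + n.2 1 ^ 2) * v.1 ^ 2 := by gcongr
    have h4 : (n.2 0 ^ 2 + n.2 1 ^ 2) * v.1 ^ 2 < n.1 ^ 2 * v.1 ^ 2 := by gcongr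
    rw [mul_pow]; linarith
  have h5 : 0 < n.1 * v.1 := mul_pos hn0 hv0
  have := abs_lt_of_sq_lt_sq h1 h5.le
  linarith [(abs_lt.1 this).2]

/-- Two future causal vectors with spacelike difference have negative product. -/
theorem minkB_neg_of_spacelike_sub {p q : Mink} (hp : IsFutureCausal p) (hq : IsFutureCausal q)
    (h : 0 < minkQ (q - p)) : minkB p q < 0 := by
  have h1 : minkQ (q - p) = minkQ q - 2 * minkB p q + minkQ p := by
    simp [minkQ, minkB_eq]; ring
  linarith [hp.1, hq.1]

theorem IsFutureTimelike.of_minkB_neg {n v : Mink} (hn : IsFutureCausal n) (hv : minkQ v < 0)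
    (h : minkB n v < 0) : IsFutureTimelike v := by
  refine ⟨hv, ?_⟩
  by_contra h0
  push Not at h0
  have hv0 : v ≠ 0 := by rintro rfl; simp at h
  have h1 : v.1 < 0 := lt_of_le_of_ne h0 (fst_ne_zero_of_causal hv.le hv0)
  have : minkB (-v) n < 0 := minkB_neg_of_timelike
    ⟨by simpa [minkQ, minkB_eq] using hv, by simpa using h1⟩ hn
  rw [minkB_neg_left, minkB_comm] at this
  linarith

theorem IsFutureCausal.of_minkB_neg {n v : Mink} (hn : IsFutureTimelike n) (hv : minkQ v ≤ 0)
    (h : minkB n v < 0) : IsFutureCausal v := by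
  refine ⟨hv, ?_⟩
  by_contra h0
  push Not at h0
  have hv0 : v ≠ 0 := by rintro rfl; simp at h
  have h1 : v.1 < 0 := lt_of_le_of_ne h0 (fst_ne_zero_of_causal hv hv0)
  have : minkB n (-v) < 0 := minkB_neg_of_timelike hn
    ⟨by simpa [minkQ, minkB_eq] using hv, by simpa using h1⟩
  rw [minkB_neg_right] at this
  linarith

/-- The sign of the product of a causal vector with a future timelike one does not depend on the
latter. -/
theorem minkB_nonpos_iff_of_timelike {n u : Mink} (hn : IsFutureTimelike n) (hu : minkQ u ≤ 0) :
    minkB n u ≤ 0 ↔ 0 ≤ u.1 := by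
  rcases eq_or_ne u 0 with rfl | h0
  · simp
  have := fst_ne_zero_of_causal hu h0
  constructor
  · intro h
    by_contra h1
    push Not at h1
    have : minkB n (-u) < 0 := minkB_neg_of_timelike hn
      ⟨by simpa [minkQ, minkB_eq] using hu, by simpa using h1⟩
    rw [minkB_neg_right] at this
    linarith
  · intro h
    exact (minkB_neg_of_timelike hn ⟨hu, lt_of_le_of_ne h this.symm⟩).le

/-- The reversed Cauchy-Schwarz inequality. -/
theorem minkB_mul_self_ge {n : Mink} (m : Mink) (hn : minkQ n < 0) :
    minkQ n * minkQ m ≤ minkB n m ^ 2 := by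
  have horth : ∀ w, minkB n w = 0 → 0 ≤ minkQ w := by
    intro w hw
    by_contra h
    push Not at h
    rw [minkQ_neg_iff] at hn h
    rw [minkB_eq] at hw
    have h1 : (n.1 * w.1) ^ 2 ≤ (n.2 0 ^ 2 + n.2 1 ^ 2) * (w.2 0 ^ 2 + w.2 1 ^ 2) := by
      have : n.1 * w.1 = n.2 0 * w.2 0 + n.2 1 * w.2 1 := by linarith
      rw [this]
      nlinarith [sq_nonneg (n.2 0 * w.2 1 - n.2 1 * w.2 0)]
    have h2 : (n.2 0 ^ 2 + n.2 1 ^ 2) * (w.2 0 ^ 2 + w.2 1 ^ 2) < n.1 ^ 2 * w.1 ^ 2 := by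
      gcongr
    rw [mul_pow] at h1
    linarith
  -- The orthogonal complement of a timelike vector is nonnegative; this is applied to the component
  -- of `m` orthogonal to `n`, multiplied by `Q(n)` to avoid a division.
  have h := horth (minkQ n • m - minkB n m • n) (by
    rw [minkB_sub_right, minkB_smul_right, minkB_smul_right]; simp only [minkQ]; ring)
  have h1 : minkQ (minkQ n • m - minkB n m • n) = minkQ n * (minkQ n * minkQ m - minkB n m ^ 2) := by
    simp [minkQ, minkB_eq]; ring
  rw [h1] at h
  nlinarith

/-- The end points of an edge may both be lightlike, but the mixed term makes their sum timelike.
This sum serves as the timelike test vector along an edge. -/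
theorem isFutureTimelike_midpoint {p q : Mink} (hp : IsFutureCausal p) (hq : IsFutureCausal q)
    (h : 0 < minkQ (q - p)) : IsFutureTimelike (p + q) := by
  have := minkB_neg_of_spacelike_sub hp hq h
  refine ⟨?_, by simpa using add_pos hp.2 hq.2⟩
  rw [minkQ_add]; linarith [hp.1, hq.1]

/-! ## The group `SO₀(1,2)` -/

namespace SO0

variable {γ : Mink ≃ₗ[ℝ] Mink}

theorem minkB_map (hγ : γ ∈ SO0) (u v : Mink) : minkB (γ u) (γ v) = minkB u v := by
  rw [minkB_eq_minkQ, ← map_add, hγ.1, hγ.1, hγ.1, ← minkB_eq_minkQ]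

theorem det3_map (hγ : γ ∈ SO0) (u v w : Mink) : det3 (γ u) (γ v) (γ w) = det3 u v w := by
  have := _root_.det3_map (γ : Mink →ₗ[ℝ] Mink) u v w
  rwa [hγ.2.1, one_mul] at this

theorem timelike_map (hγ : γ ∈ SO0) {v : Mink} (hv : IsFutureTimelike v) :
    IsFutureTimelike (γ v) :=
  ⟨by rw [hγ.1]; exact hv.1, (hγ.2.2 v hv.causal).2⟩

theorem symm_mem (hγ : γ ∈ SO0) : γ.symm ∈ SO0 := by
  have hQ : ∀ v, minkQ (γ.symm v) = minkQ v := fun v => by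
    rw [← hγ.1, LinearEquiv.apply_symm_apply]
  refine ⟨hQ, ?_, ?_⟩
  · have h := LinearEquiv.det_mul_det_symm γ
    have h1 := hγ.2.1
    rw [h1, one_mul] at h
    exact h
  · intro v hv
    refine ⟨by rw [hQ]; exact hv.1, ?_⟩
    by_contra h
    push Not at h
    have h0 : γ.symm v ≠ 0 := by
      intro h0
      have : v = 0 := by simpa using h0
      rw [this] at hv
      exact lt_irrefl _ hv.2
    have h1 := fst_ne_zero_of_causal (by rw [hQ]; exact hv.1) h0
    have h2 := (hγ.2.2 (-γ.symm v) ⟨by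
      have := hQ v
      have h3 := hv.1
      simpa [minkQ, minkB_neg_left, minkB_neg_right] using this.le.trans h3,
      by simpa using lt_of_le_of_ne h h1⟩).2
    simp only [map_neg, LinearEquiv.apply_symm_apply, Prod.fst_neg] at h2
    linarith [hv.2]

theorem trans_mem {γ' : Mink ≃ₗ[ℝ] Mink} (hγ : γ ∈ SO0) (hγ' : γ' ∈ SO0) :
    γ.trans γ' ∈ SO0 := by
  refine ⟨fun v => ?_, ?_, fun v hv => hγ'.2.2 _ (hγ.2.2 _ hv)⟩
  · rw [LinearEquiv.trans_apply, hγ'.1, hγ.1]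
  · rw [LinearEquiv.coe_trans, LinearMap.det_comp, hγ.2.1, hγ'.2.1, one_mul]

/-- The cross product is characterised by its pairing with all vectors, which is `det3`; isometries
of determinant one preserve both. -/
theorem map_mcross (hγ : γ ∈ SO0) (a b : Mink) : γ (mcross a b) = mcross (γ a) (γ b) := by
  have h : ∀ w, minkB (γ (mcross a b)) w = minkB (mcross (γ a) (γ b)) w := by
    intro w
    obtain ⟨w, rfl⟩ := γ.surjective w
    rw [minkB_map hγ, minkB_mcross, minkB_mcross, det3_map hγ]
  apply Mink.ext_coord
  · simpa [minkB_eq] using h (1, 0)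
  · simpa [minkB_eq] using h (0, EuclideanSpace.single 0 1)
  · simpa [minkB_eq] using h (0, EuclideanSpace.single 1 1)

end SO0

/-! ### Isometries determined by two causal vectors. -/

theorem minkQ_mcross (a b : Mink) : minkQ (mcross a b) = minkB a b ^ 2 - minkQ a * minkQ b := by
  rw [minkQ, minkB_mcross_mcross, minkB_comm b a]; simp only [minkQ]; ring

theorem det3_mcross (a b : Mink) : det3 a b (mcross a b) = minkQ (mcross a b) := by
  rw [← minkB_mcross, minkQ]

/-- The hypothesis gives `2B(p, q) < Q(p) + Q(q) ≤ 0`. Squaring, `4B(p, q)² > (Q(p) + Q(q))² ≥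
4Q(p)Q(q)`. -/
theorem minkQ_mcross_pos {p q : Mink} (hp : IsFutureCausal p) (hq : IsFutureCausal q)
    (h : 0 < minkQ (q - p)) : 0 < minkQ (mcross p q) := by
  have h1 : minkQ (q - p) = minkQ q - 2 * minkB p q + minkQ p := by
    simp [minkQ, minkB_eq]; ring
  rw [minkQ_mcross]
  nlinarith [hp.1, hq.1, sq_nonneg (minkQ p - minkQ q)]

/-- Elements of `SO₀(1,2)` that agree on two future causal vectors with spacelike difference
are equal. -/
theorem SO0.eq_of_agree {γ γ' : Mink ≃ₗ[ℝ] Mink} (hγ : γ ∈ SO0) (hγ' : γ' ∈ SO0) {p q : Mink}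
    (hp : IsFutureCausal p) (hq : IsFutureCausal q) (h : 0 < minkQ (q - p))
    (h1 : γ p = γ' p) (h2 : γ q = γ' q) : γ = γ' := by
  have hd : det3 p q (mcross p q) ≠ 0 := by
    rw [det3_mcross]; exact (minkQ_mcross_pos hp hq h).ne'
  have := mink_ext_of_det3 hd (f := (γ : Mink →ₗ[ℝ] Mink)) (g := γ') h1 h2 (by
    simp [SO0.map_mcross hγ, SO0.map_mcross hγ', h1, h2])
  exact LinearEquiv.toLinearMap_injective this

/-- The linear map that sends the vectors `a, b, c` to `a', b', c'`. -/
def frameMap (a b c a' b' c' : Mink) : Mink →ₗ[ℝ] Mink where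
  toFun w := (det3 a b c)⁻¹ • (det3 b c w • a' + det3 c a w • b' + det3 a b w • c')
  map_add' v w := by simp only [det3_add_right, add_smul, smul_add]; abel
  map_smul' t w := by
    simp only [det3_smul_right, mul_smul, RingHom.id_apply, smul_add]
    simp only [smul_comm t]

theorem frameMap_fst {a b c : Mink} (h : det3 a b c ≠ 0) (a' b' c' : Mink) :
    frameMap a b c a' b' c' a = a' := by
  have h1 : det3 b c a = det3 a b c := (det3_cyclic a b c).symm
  have h2 : det3 c a a = 0 := by rw [det3_eq]; ring
  have h3 : det3 a b a = 0 := by rw [det3_eq]; ring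
  simp [frameMap, h1, h2, h3, smul_smul, h]

theorem frameMap_cyclic {a b c : Mink} (a' b' c' : Mink) :
    frameMap a b c a' b' c' = frameMap b c a b' c' a' := by
  ext1 <;> ext1 <;> simp [frameMap, det3_cyclic a b c] <;> abel_nf

/-- Complete each pair by its cross product `n`. It is orthogonal to the pair and `Q(n)` is a
function of the Gram matrix of the pair, so the linear map between the two frames is an isometry.
Both frames have determinant `Q(n) > 0`, which fixes the orientation; time orientation is tested on
the timelike sum `p + q`. -/
theorem exists_SO0_of_gram {p q p' q' : Mink} (hp : IsFutureCausal p) (hq : IsFutureCausal q)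
    (hp' : IsFutureCausal p') (hq' : IsFutureCausal q') (h : 0 < minkQ (q - p))
    (h1 : minkQ p = minkQ p') (h2 : minkQ q = minkQ q') (h3 : minkQ (q - p) = minkQ (q' - p')) :
    ∃ γ ∈ SO0, γ p = p' ∧ γ q = q' := by
  have hB : minkB p q = minkB p' q' := by
    have e : ∀ p q : Mink, minkQ (q - p) = minkQ q - 2 * minkB p q + minkQ p := by
      intro p q; simp [minkQ, minkB_eq]; ring
    rw [e, e] at h3; linarith
  have hn := minkQ_mcross_pos hp hq h
  have hn' := minkQ_mcross_pos hp' hq' (h3 ▸ h)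
  have hnn : minkQ (mcross p q) = minkQ (mcross p' q') := by
    rw [minkQ_mcross, minkQ_mcross, h1, h2, hB]
  have hd := det3_mcross p q
  have hd' := det3_mcross p' q'
  have orth : ∀ a b : Mink, minkB a (mcross a b) = 0 ∧ minkB b (mcross a b) = 0 := by
    intro a b
    constructor <;> rw [minkB_comm, minkB_mcross, det3_eq] <;> ring
  obtain ⟨o1, o2⟩ := orth p q
  obtain ⟨o1', o2'⟩ := orth p' q'
  generalize mcross p q = n at *
  generalize mcross p' q' = n' at *
  have hd0 : det3 p q n ≠ 0 := by rw [hd]; exact hn.ne'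
  have hd0' : det3 p' q' n' ≠ 0 := by rw [hd']; exact hn'.ne'
  have mapP : ∀ {a b c : Mink} (_ : det3 a b c ≠ 0) (a' b' c' : Mink),
      frameMap a b c a' b' c' a = a' ∧ frameMap a b c a' b' c' b = b' ∧
      frameMap a b c a' b' c' c = c' := by
    intro a b c h a' b' c'
    have h' : det3 b c a ≠ 0 := by rwa [← det3_cyclic]
    have h'' : det3 c a b ≠ 0 := by rwa [← det3_cyclic]
    refine ⟨frameMap_fst h _ _ _, ?_, ?_⟩
    · rw [frameMap_cyclic, frameMap_fst h']
    · rw [frameMap_cyclic, frameMap_cyclic, frameMap_fst h'']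
  obtain ⟨f1, f2, f3⟩ := mapP hd0 p' q' n'
  obtain ⟨g1, g2, g3⟩ := mapP hd0' p q n
  let γ : Mink ≃ₗ[ℝ] Mink := LinearEquiv.ofLinearMap (frameMap p q n p' q' n')
    (frameMap p' q' n' p q n)
    (mink_ext_of_det3 hd0' (by simp [f1, g1]) (by simp [f2, g2]) (by simp [f3, g3]))
    (mink_ext_of_det3 hd0 (by simp [f1, g1]) (by simp [f2, g2]) (by simp [f3, g3]))
  have γ1 : γ p = p' := f1
  have γ2 : γ q = q' := f2
  have γ3 : γ n = n' := f3
  have hQ : ∀ v, minkQ (γ v) = minkQ v := by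
    intro v
    obtain ⟨α, β, ζ, rfl⟩ : ∃ α β ζ : ℝ, v = α • p + β • q + ζ • n := by
      refine ⟨(det3 p q n)⁻¹ * det3 q n v, (det3 p q n)⁻¹ * det3 n p v,
        (det3 p q n)⁻¹ * det3 p q v, ?_⟩
      simp only [mul_smul, ← smul_add]
      rw [← det3_cramer, smul_smul, inv_mul_cancel₀ hd0, one_smul]
    simp only [map_add, map_smul, γ1, γ2, γ3]
    simp only [minkQ_add, minkB_add_left, minkQ_smul, minkB_smul_left, minkB_smul_right, o1, o2,
      o1', o2', h1, h2, hB, hnn]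
  refine ⟨γ, ⟨hQ, ?_, ?_⟩, γ1, γ2⟩
  · have := det3_map (γ : Mink →ₗ[ℝ] Mink) p q n
    simp only [LinearEquiv.coe_coe, γ1, γ2, γ3] at this
    rw [hd, hd', hnn] at this
    exact mul_right_cancel₀ hn'.ne' (by rw [← this, one_mul])
  · intro v hv
    have t := isFutureTimelike_midpoint hp hq h
    have t' := isFutureTimelike_midpoint hp' hq' (h3 ▸ h)
    refine IsFutureCausal.of_minkB_neg t' (by rw [hQ]; exact hv.1) ?_
    have e : minkB (p' + q') (γ v) = minkB (p + q) v := by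
      rw [← γ1, ← γ2, ← map_add, minkB_eq_minkQ, ← map_add, hQ, hQ, hQ, ← minkB_eq_minkQ]
    rw [e]
    exact minkB_neg_of_timelike t hv

/-! ## Direct isometric embeddings of the plane -/

/-- The future unit normal of a directly embedded plane. -/
def normal (J : E2 →ᵃ[ℝ] Mink) : Mink :=
  mcross (J.linear (EuclideanSpace.single 1 1)) (J.linear (EuclideanSpace.single 0 1))

structure IsDirectEmbedding (J : E2 →ᵃ[ℝ] Mink) : Prop where
  minkQ_linear : ∀ v, minkQ (J.linear v) = ‖v‖ ^ 2
  normal_future : IsFutureTimelike (normal J)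

theorem minkB_linear_of_isometric {J : E2 →ᵃ[ℝ] Mink} (h : ∀ v, minkQ (J.linear v) = ‖v‖ ^ 2)
    (u v : E2) : minkB (J.linear u) (J.linear v) = inner ℝ u v := by
  rw [minkB_eq_minkQ, ← map_add, h, h, h, @norm_add_sq_real]; ring

theorem minkQ_normal_of_isometric {J : E2 →ᵃ[ℝ] Mink} (h : ∀ v, minkQ (J.linear v) = ‖v‖ ^ 2) :
    minkQ (normal J) = -1 := by
  rw [normal, minkQ_mcross, h, h, minkB_linear_of_isometric h]
  simp [inner_E2]

/-- This replaces the unspecified normal of the definition by the explicit one. The positive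
determinant says that the two have a negative product, so they lie in the same time cone. -/
theorem GeodesicTriangulation.IsSuspensionEmbedding.isDirectEmbedding {X : Type*}
    [TopologicalSpace X] {E : EuclideanConeSurface X} {T : GeodesicTriangulation E} {τ : X → ℝ}
    {i : T.ι} {J : E2 →ᵃ[ℝ] Mink} (h : T.IsSuspensionEmbedding τ i J) : IsDirectEmbedding J := by
  obtain ⟨h1, -, -, n, hn, -, hd⟩ := h
  refine ⟨h1, IsFutureTimelike.of_minkB_neg hn.causal (by rw [minkQ_normal_of_isometric h1]; simp) ?_⟩
  rw [minkB_comm, normal, minkB_mcross, det3_swap, ← det3_cyclic]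
  linarith

namespace IsDirectEmbedding

variable {J : E2 →ᵃ[ℝ] Mink} (hJ : IsDirectEmbedding J)
include hJ

theorem minkB_linear (u v : E2) : minkB (J.linear u) (J.linear v) = inner ℝ u v :=
  minkB_linear_of_isometric hJ.minkQ_linear u v

end IsDirectEmbedding

theorem linear_eq_combination (J : E2 →ᵃ[ℝ] Mink) (u : E2) :
    J.linear u = u 0 • J.linear (EuclideanSpace.single 0 1) +
      u 1 • J.linear (EuclideanSpace.single 1 1) := by
  conv_lhs => rw [E2.eq_combination u, map_add, map_smul, map_smul]

theorem mcross_linear (J : E2 →ᵃ[ℝ] Mink) (u v : E2) :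
    mcross (J.linear u) (J.linear v) = -det2 u v • normal J := by
  rw [linear_eq_combination J u, linear_eq_combination J v, normal]
  apply Mink.ext_coord <;> simp [mcross, det2] <;> ring

theorem minkB_normal_linear (J : E2 →ᵃ[ℝ] Mink) (v : E2) : minkB (normal J) (J.linear v) = 0 := by
  rw [linear_eq_combination J v, normal, minkB_mcross, det3_eq]
  simp; ring

theorem affine_apply_eq (J : E2 →ᵃ[ℝ] Mink) (x y : E2) : J x = J y + J.linear (x - y) := by
  have := J.linearMap_vsub x y
  simp only [vsub_eq_sub] at this
  rw [this]; abel

theorem minkB_normal_apply (J : E2 →ᵃ[ℝ] Mink) (x y : E2) :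
    minkB (normal J) (J x) = minkB (normal J) (J y) := by
  rw [affine_apply_eq J x y, minkB_add_right, minkB_normal_linear, add_zero]

theorem det3_linear (J : E2 →ᵃ[ℝ] Mink) (p : Mink) (u v : E2) :
    det3 p (J.linear u) (J.linear v) = -det2 u v * minkB (normal J) p := by
  rw [det3_cyclic, ← minkB_mcross, mcross_linear, minkB_smul_left]

theorem det3_affine (J : E2 →ᵃ[ℝ] Mink) (x y z : E2) :
    det3 (J x) (J y) (J z) = -minkB (normal J) (J x) * det2 (y - x) (z - x) := by
  have : det3 (J x) (J y) (J z) = det3 (J x) (J.linear (y - x)) (J.linear (z - x)) := by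
    rw [affine_apply_eq J y x, affine_apply_eq J z x]; simp [det3_eq]; ring
  rw [this, det3_linear]; ring

/-- The point of the plane that is mapped to a given point of the image. -/
def planePos (J : E2 →ᵃ[ℝ] Mink) (p : Mink) : E2 :=
  !₂[minkB (J.linear (EuclideanSpace.single 0 1)) (p - J 0),
    minkB (J.linear (EuclideanSpace.single 1 1)) (p - J 0)]

theorem continuous_planePos (J : E2 →ᵃ[ℝ] Mink) : Continuous (planePos J) := by
  refine (PiLp.continuous_toLp 2 _).comp (continuous_pi fun i => ?_)
  fin_cases i
  · exact (continuous_minkB_right _).comp (continuous_id.sub continuous_const)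
  · exact (continuous_minkB_right _).comp (continuous_id.sub continuous_const)

namespace IsDirectEmbedding

variable {J : E2 →ᵃ[ℝ] Mink} (hJ : IsDirectEmbedding J)
include hJ

theorem planePos_apply (x : E2) : planePos J (J x) = x := by
  have h : J x - J 0 = J.linear x := by rw [affine_apply_eq J x 0]; simp
  apply E2.ext_coord <;> simp [planePos, h, hJ.minkB_linear, inner_E2]

/-- Cramer's rule in the orthonormal frame formed by `normal J` and the images of the basis vectors:
the component along the normal vanishes, and the other two are the coordinates of `planePos`. -/
theorem apply_planePos {p : Mink} (hp : minkB (normal J) p = minkB (normal J) (J 0)) :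
    J (planePos J p) = p := by
  have h0 : minkB (normal J) (p - J 0) = 0 := by rw [minkB_sub_right, hp, sub_self]
  rw [affine_apply_eq J _ 0, sub_zero, linear_eq_combination]
  have hQ := minkQ_normal_of_isometric hJ.minkQ_linear
  have h1 := hJ.minkB_linear (EuclideanSpace.single 0 1) (EuclideanSpace.single 0 1)
  have h2 := hJ.minkB_linear (EuclideanSpace.single 0 1) (EuclideanSpace.single 1 1)
  have h3 := hJ.minkB_linear (EuclideanSpace.single 1 1) (EuclideanSpace.single 1 1)
  simp [inner_E2] at h1 h2 h3
  have key := det3_cramer (normal J) (J.linear (EuclideanSpace.single 0 1))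
    (J.linear (EuclideanSpace.single 1 1)) (p - J 0)
  have hw : minkB (mcross (J.linear (EuclideanSpace.single 0 1))
      (J.linear (EuclideanSpace.single 1 1))) (p - J 0) = 0 := by
    rw [mcross_linear, minkB_smul_left, h0, mul_zero]
  rw [det3_cyclic, det3_swap, ← minkB_mcross] at key
  change -minkB (normal J) (normal J) • _ = _ at key
  rw [← minkQ, hQ, neg_neg, one_smul, ← minkB_mcross, hw] at key
  have a1 : det3 (J.linear (EuclideanSpace.single 1 1)) (normal J) (p - J 0) =
      minkB (J.linear (EuclideanSpace.single 0 1)) (p - J 0) := by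
    rw [← det3_cyclic, ← minkB_mcross, normal, minkB_mcross_mcross, h3, minkB_comm _ (J.linear _),
      minkB_comm (J.linear (EuclideanSpace.single 1 1)) (J.linear _), h2]
    ring
  have a2 : det3 (normal J) (J.linear (EuclideanSpace.single 0 1)) (p - J 0) =
      minkB (J.linear (EuclideanSpace.single 1 1)) (p - J 0) := by
    rw [det3_cyclic, ← minkB_mcross, normal, minkB_mcross_mcross, h1, h2, minkB_comm _ (p - J 0)]
    ring
  rw [a1, a2] at key
  simp only [planePos]
  simp
  rw [zero_smul, zero_add] at key
  rw [← key]; abel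

theorem minkB_normal_neg {x : E2} (hx : IsFutureCausal (J x)) (y : E2) :
    minkB (normal J) (J y) < 0 := by
  rw [minkB_normal_apply J y x]
  exact minkB_neg_of_timelike hJ.normal_future hx

end IsDirectEmbedding

/-- Two unit conormals along a common edge, one on each side: their sum is zero or causal. -/
theorem conormal_inequality {e w w' : Mink} {L : ℝ} (he : minkQ e = L) (hL : 0 < L)
    (hw : minkQ w = L) (hw' : minkQ w' = L) (hew : minkB e w = 0) (hew' : minkB e w' = 0)
    (hN : IsFutureTimelike (mcross w e)) (hN' : IsFutureTimelike (mcross e w')) :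
    minkB w w' ≤ -L := by
  have h1 : minkB (mcross w e) (mcross e w') = L * minkB w w' := by
    rw [minkB_mcross_mcross, hew', ← he]; simp only [minkQ]; ring
  -- The cross products are normals of the two planes, with `Q = -L²` and mutual product `L * B(w,
  -- w')`. Their being future timelike determines the sign of `B(w, w')`, and the reversed
  -- Cauchy-Schwarz inequality its size.
  have h2 := minkB_neg_of_timelike hN hN'.causal
  have h3 := minkB_mul_self_ge (mcross e w') hN.1
  rw [minkQ_mcross, minkQ_mcross, h1, minkB_comm w e, hew, hew', he, hw, hw'] at h3
  rw [h1] at h2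
  have h4 : minkB w w' < 0 := by
    by_contra h; push Not at h; nlinarith
  have h5 : L ^ 2 ≤ minkB w w' ^ 2 := by
    have : L ^ 2 * L ^ 2 ≤ L ^ 2 * minkB w w' ^ 2 := by nlinarith
    exact le_of_mul_le_mul_left this (by positivity)
  by_contra h
  push Not at h
  nlinarith

/-! ## Triangles -/

/-- Twice the area of a triangle. -/
def area (v : Fin 3 → E2) : ℝ := det2 (v 1 - v 0) (v 2 - v 0)

/-- The affine form that vanishes on the `k`-th side of a triangle and is positive inside. -/
def sideForm (v : Fin 3 → E2) (k : Fin 3) (x : E2) : ℝ := det2 (v (k + 1) - v k) (x - v k)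

theorem continuous_sideForm (v : Fin 3 → E2) (k : Fin 3) : Continuous (sideForm v k) := by
  unfold sideForm det2; fun_prop

theorem Fin3.cases_add (k j : Fin 3) : j = k ∨ j = k + 1 ∨ j = k + 2 := by
  revert k j; decide

section

variable (v : Fin 3 → E2) (k : Fin 3) (x : E2)

@[simp] theorem sideForm_self : sideForm v k (v k) = 0 := by simp [sideForm, det2]

@[simp] theorem sideForm_succ : sideForm v k (v (k + 1)) = 0 := by
  simp [sideForm, det2]; ring

@[simp] theorem sideForm_opposite : sideForm v k (v (k + 2)) = area v := by
  fin_cases k <;> simp [sideForm, det2, area] <;> ring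

theorem sideForm_sum : sideForm v k x + sideForm v (k + 1) x + sideForm v (k + 2) x = area v := by
  fin_cases k <;> simp [sideForm, det2, area] <;> ring

theorem area_smul_eq : area v • x = sideForm v (k + 1) x • v k + sideForm v (k + 2) x • v (k + 1)
    + sideForm v k x • v (k + 2) := by
  apply E2.ext_coord <;> fin_cases k <;> simp [sideForm, det2, area] <;> ring

theorem sideForm_combination (y : E2) (a b : ℝ) (h : a + b = 1) :
    sideForm v k (a • x + b • y) = a * sideForm v k x + b * sideForm v k y := by
  obtain rfl : b = 1 - a := by linarith
  simp [sideForm, det2]; ring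

end

theorem sidePoint_eq (v : Fin 3 → E2) (k : Fin 3) (s : ℝ) :
    sidePoint v k s = (1 - s) • v k + s • v (k + 1) := by
  rw [sidePoint, AffineMap.lineMap_apply_module]

theorem sideForm_sidePoint (v : Fin 3 → E2) (k : Fin 3) (s : ℝ) :
    sideForm v k (sidePoint v k s) = 0 := by
  rw [sidePoint_eq, sideForm_combination _ _ _ _ _ _ (by ring)]; simp

theorem sideForm_succ_sidePoint (v : Fin 3 → E2) (k : Fin 3) (s : ℝ) :
    sideForm v (k + 1) (sidePoint v k s) = (1 - s) * area v := by
  have h : sideForm v (k + 1) (v k) = area v := by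
    have := sideForm_opposite v (k + 1)
    rwa [show k + 1 + 2 = k by clear * -; revert k; decide] at this
  rw [sidePoint_eq, sideForm_combination _ _ _ _ _ _ (by ring), h]; simp

theorem sideForm_pred_sidePoint (v : Fin 3 → E2) (k : Fin 3) (s : ℝ) :
    sideForm v (k + 2) (sidePoint v k s) = s * area v := by
  have h : sideForm v (k + 2) (v (k + 1)) = area v := by
    have := sideForm_opposite v (k + 2)
    rwa [show k + 2 + 2 = k + 1 by clear * -; revert k; decide] at this
  have h' : sideForm v (k + 2) (v k) = 0 := by
    have := sideForm_succ v (k + 2)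
    rwa [show k + 2 + 1 = k by clear * -; revert k; decide] at this
  rw [sidePoint_eq, sideForm_combination _ _ _ _ _ _ (by ring), h, h']; simp

section

variable {v : Fin 3 → E2} (hv : 0 < area v)
include hv

/-- The numbers `sideForm / area` are the barycentric coordinates, each side form belonging to the
opposite vertex. -/
theorem mem_solidTriangle_iff {x : E2} : x ∈ solidTriangle v ↔ ∀ k, 0 ≤ sideForm v k x := by
  constructor
  · intro hx k
    have hc : Convex ℝ {x : E2 | 0 ≤ sideForm v k x} := by
      intro x hx y hy a b ha hb hab
      simp only [mem_ofPred_eq] at *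
      rw [sideForm_combination _ _ _ _ _ _ hab]; positivity
    refine convexHull_min ?_ hc hx
    rintro _ ⟨j, rfl⟩
    rcases Fin3.cases_add k j with rfl | rfl | rfl <;> simp [hv.le]
  · intro h
    have h1 := area_smul_eq v 0 x
    have h2 : x = ∑ k : Fin 3, (sideForm v (k + 1) x / area v) • v k := by
      refine smul_right_injective E2 hv.ne' ?_
      simp only [h1, Fin.sum_univ_three, smul_add, smul_smul, mul_div_cancel₀ _ hv.ne']
      rfl
    rw [h2]
    refine (convex_convexHull ℝ (range v)).sum_mem (fun k _ => div_nonneg (h _) hv.le) ?_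
      (fun k _ => subset_convexHull ℝ _ (mem_range_self k))
    rw [← Finset.sum_div, div_eq_one_iff_eq hv.ne', Fin.sum_univ_three]
    have := sideForm_sum v 1 x
    exact this

theorem sidePoint_mem {k : Fin 3} {s : ℝ} (hs : s ∈ Icc (0 : ℝ) 1) :
    sidePoint v k s ∈ solidTriangle v := by
  rw [mem_solidTriangle_iff hv]
  intro j
  rcases Fin3.cases_add k j with rfl | rfl | rfl
  · rw [sideForm_sidePoint]
  · rw [sideForm_succ_sidePoint]; exact mul_nonneg (by linarith [hs.2]) hv.le
  · rw [sideForm_pred_sidePoint]; exact mul_nonneg hs.1 hv.le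

theorem eq_sidePoint {k : Fin 3} {x : E2} (hx : x ∈ solidTriangle v) (h : sideForm v k x = 0) :
    ∃ s ∈ Icc (0 : ℝ) 1, x = sidePoint v k s := by
  have h' := (mem_solidTriangle_iff hv).1 hx
  have hs := sideForm_sum v k x
  have h1 := area_smul_eq v k x
  refine ⟨sideForm v (k + 2) x / area v, ⟨div_nonneg (h' _) hv.le, ?_⟩, ?_⟩
  · rw [div_le_one hv]; linarith [h' (k + 1)]
  · have h2 : 1 - sideForm v (k + 2) x / area v = sideForm v (k + 1) x / area v := by
      field_simp; linarith
    rw [sidePoint_eq, h2]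
    rw [h, zero_smul, add_zero] at h1
    refine smul_right_injective E2 hv.ne' ?_
    simp only [h1, smul_add, smul_smul, mul_div_cancel₀ _ hv.ne']

/-- A point of the relative interior of a side is on no other side. -/
theorem sidePoint_eq_sidePoint {k l : Fin 3} {s s' : ℝ} (hs : s ∈ Ioo (0 : ℝ) 1)
    (h : sidePoint v k s = sidePoint v l s') : l = k ∧ s' = s := by
  have hl : l = k := by
    have h0 := sideForm_sidePoint v l s'
    rw [← h] at h0
    rcases Fin3.cases_add k l with rfl | rfl | rfl
    · rfl
    · rw [sideForm_succ_sidePoint] at h0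
      have : 0 < (1 - s) * area v := mul_pos (by linarith [hs.2]) hv
      linarith
    · rw [sideForm_pred_sidePoint] at h0
      have : 0 < s * area v := mul_pos hs.1 hv
      linarith
  subst hl
  have := congrArg (sideForm v (l + 2)) h
  rw [sideForm_pred_sidePoint, sideForm_pred_sidePoint] at this
  exact ⟨rfl, (mul_right_cancel₀ hv.ne' this).symm⟩

theorem side_ne (k : Fin 3) : v (k + 1) ≠ v k := by
  intro h
  have := sideForm_opposite v k
  rw [sideForm, h] at this
  simp [det2] at this
  linarith

end

theorem sidePoint_zero (v : Fin 3 → E2) (k : Fin 3) : sidePoint v k 0 = v k := by simp [sidePoint]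

theorem sidePoint_one (v : Fin 3 → E2) (k : Fin 3) : sidePoint v k 1 = v (k + 1) := by
  simp [sidePoint]

theorem isCompact_solidTriangle (v : Fin 3 → E2) : IsCompact (solidTriangle v) :=
  (finite_range v).isCompact_convexHull ℝ

theorem convex_solidTriangle (v : Fin 3 → E2) : Convex ℝ (solidTriangle v) := convex_convexHull ℝ _

/-- Coordinates along a side and orthogonally to it. -/
theorem eq_frame_combination {A B : E2} (h : A ≠ B) (y : E2) :
    y = A + (inner ℝ (B - A) (y - A) / ‖B - A‖ ^ 2) • (B - A) +
      (det2 (B - A) (y - A) / ‖B - A‖ ^ 2) • rot (B - A) := by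
  have h0 : ‖B - A‖ ^ 2 ≠ 0 := by
    have : B - A ≠ 0 := sub_ne_zero.2 h.symm
    positivity
  have h1 : ‖B - A‖ ^ 2 • (y - A) = inner ℝ (B - A) (y - A) • (B - A) +
      det2 (B - A) (y - A) • rot (B - A) := by
    apply E2.ext_coord <;> simp [norm_sq_E2, inner_E2, det2] <;> ring
  have h2 : y - A = (‖B - A‖ ^ 2)⁻¹ • (‖B - A‖ ^ 2 • (y - A)) := by
    rw [smul_smul, inv_mul_cancel₀ h0, one_smul]
  rw [h1, smul_add, smul_smul, smul_smul] at h2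
  rw [div_eq_inv_mul, div_eq_inv_mul, add_assoc, ← h2]
  abel

theorem map_add_eq (f : E2 ≃ᵃⁱ[ℝ] E2) (p w : E2) : f (p + w) = f p + f.linearIsometryEquiv w := by
  have := f.map_vadd p w
  rwa [vadd_eq_add, vadd_eq_add, add_comm, add_comm _ (f p)] at this

/-! ## Embedded planes and cones -/

/-- The linear form equal to `1` on an embedded plane. -/
def heightForm (J : E2 →ᵃ[ℝ] Mink) (p : Mink) : ℝ :=
  minkB (normal J) p / minkB (normal J) (J 0)

theorem heightForm_add (J : E2 →ᵃ[ℝ] Mink) (p q : Mink) :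
    heightForm J (p + q) = heightForm J p + heightForm J q := by
  rw [heightForm, minkB_add_right, add_div]; rfl

theorem heightForm_smul (J : E2 →ᵃ[ℝ] Mink) (t : ℝ) (p : Mink) :
    heightForm J (t • p) = t * heightForm J p := by
  rw [heightForm, minkB_smul_right, mul_div_assoc]; rfl

theorem continuous_heightForm (J : E2 →ᵃ[ℝ] Mink) : Continuous (heightForm J) :=
  (continuous_minkB_right _).div_const _

namespace IsDirectEmbedding

variable {J : E2 →ᵃ[ℝ] Mink} (hJ : IsDirectEmbedding J)
include hJ

theorem heightForm_apply {z : E2} (hz : IsFutureCausal (J z)) (x : E2) : heightForm J (J x) = 1 := by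
  rw [heightForm, minkB_normal_apply J x 0, div_self (hJ.minkB_normal_neg hz 0).ne]

theorem heightForm_nonneg_iff {z : E2} (hz : IsFutureCausal (J z)) {u : Mink} :
    0 ≤ heightForm J u ↔ minkB (normal J) u ≤ 0 := by
  have := hJ.minkB_normal_neg hz 0
  rw [heightForm]
  constructor
  · intro h
    by_contra h1
    push Not at h1
    have := div_neg_of_pos_of_neg h1 this
    linarith
  · intro h
    exact div_nonneg_of_nonpos h this.le

theorem heightForm_pos {z : E2} (hz : IsFutureCausal (J z)) {p : Mink} (hp : IsFutureCausal p) :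
    0 < heightForm J p :=
  div_pos_of_neg_of_neg (minkB_neg_of_timelike hJ.normal_future hp) (hJ.minkB_normal_neg hz 0)

theorem apply_planePos_inv_heightForm {z : E2} (hz : IsFutureCausal (J z)) {p : Mink}
    (hp : heightForm J p ≠ 0) : J (planePos J ((heightForm J p)⁻¹ • p)) = (heightForm J p)⁻¹ • p := by
  apply hJ.apply_planePos
  have h0 := (hJ.minkB_normal_neg hz 0).ne
  have h1 : heightForm J ((heightForm J p)⁻¹ • p) = 1 := by
    rw [heightForm_smul, inv_mul_cancel₀ hp]
  rw [heightForm, div_eq_one_iff_eq h0] at h1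
  exact h1

theorem minkQ_apply_sub (x y : E2) : minkQ (J x - J y) = ‖x - y‖ ^ 2 := by
  rw [affine_apply_eq J x y, add_sub_cancel_left, hJ.minkQ_linear]

/-- The function `-Q` along a segment of an embedded plane. -/
theorem minkQ_apply_add (x w : E2) (s : ℝ) : minkQ (J (x + s • w)) =
    minkQ (J x) + 2 * s * minkB (J x) (J.linear w) + s ^ 2 * ‖w‖ ^ 2 := by
  rw [affine_apply_eq J (x + s • w) x, add_sub_cancel_left, map_smul, minkQ_add, minkQ_smul,
    hJ.minkQ_linear, minkB_smul_right]
  ring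

end IsDirectEmbedding

/-! ## Two embedded planes along an edge -/

/-- Two direct embeddings, one of them with the side `AB` and the other with the side `A'B'`
in `J⁺(O)`, such that `γ` glues the first side to the reversed second side. -/
structure IsEdgeGluing (J J' : E2 →ᵃ[ℝ] Mink) (A B A' B' : E2) (γ : Mink ≃ₗ[ℝ] Mink) : Prop where
  direct : IsDirectEmbedding J
  direct' : IsDirectEmbedding J'
  mem : γ ∈ SO0
  map_left : γ (J A) = J' B'
  map_right : γ (J B) = J' A'
  ne : A ≠ B
  causal_left : IsFutureCausal (J A)
  causal_right : IsFutureCausal (J B)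

/-- The sum of the inward conormals along an edge. -/
def conormalSum (J J' : E2 →ᵃ[ℝ] Mink) (A B A' B' : E2) (γ : Mink ≃ₗ[ℝ] Mink) : Mink :=
  J.linear (rot (B - A)) + γ.symm (J'.linear (rot (B' - A')))

/-- The two sides of the edge in a common development. -/
theorem edge_map_frame {A B A' B' : E2} {g g' : E2 ≃ᵃⁱ[ℝ] E2}
    (hg : IsDirect g) (hg' : IsDirect g') (hA : g A = g' B') (hB : g B = g' A') (α t : ℝ) :
    g' (A' + α • (B' - A') + t • rot (B' - A')) = g (B - α • (B - A) - t • rot (B - A)) := by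
  have h1 : g'.linearIsometryEquiv (B' - A') = -g.linearIsometryEquiv (B - A) := by
    have e1 := map_add_eq g' A' (B' - A')
    have e2 := map_add_eq g A (B - A)
    rw [add_sub_cancel] at e1 e2
    rw [hA] at e2
    rw [hB, e1] at e2
    have e3 : g' A' + g'.linearIsometryEquiv (B' - A') + g.linearIsometryEquiv (B - A) = g' A' := by
      rw [← e2]
    have e4 : g' A' + (g'.linearIsometryEquiv (B' - A') + g.linearIsometryEquiv (B - A)) = g' A' := by
      rw [← add_assoc, e3]
    exact eq_neg_of_add_eq_zero_left (by simpa using e4)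
  have h2 : g'.linearIsometryEquiv (rot (B' - A')) = -g.linearIsometryEquiv (rot (B - A)) := by
    rw [hg'.map_rot, h1, hg.map_rot]
    apply E2.ext_coord <;> simp
  have e : B - α • (B - A) - t • rot (B - A) = B + -(α • (B - A) + t • rot (B - A)) := by abel
  rw [map_add_eq g', map_add_eq g', e, map_add_eq g, ← hB]
  simp only [map_add, map_neg, map_smul, h1, h2]
  module

namespace IsEdgeGluing

variable {J J' : E2 →ᵃ[ℝ] Mink} {A B A' B' : E2} {γ : Mink ≃ₗ[ℝ] Mink}
  (h : IsEdgeGluing J J' A B A' B' γ)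
include h

theorem linear_edge : γ.symm (J'.linear (B' - A')) = -J.linear (B - A) := by
  have h1 : J.linear (B - A) = J B - J A := by rw [affine_apply_eq J B A]; abel
  have h2 : J'.linear (B' - A') = J' B' - J' A' := by rw [affine_apply_eq J' B' A']; abel
  rw [h1, h2, ← h.map_left, ← h.map_right, map_sub]
  simp

theorem norm_sub_pos : 0 < ‖B - A‖ ^ 2 := by
  have : B - A ≠ 0 := sub_ne_zero.2 h.ne.symm
  positivity

theorem norm_sub_eq : ‖B' - A'‖ ^ 2 = ‖B - A‖ ^ 2 := by
  rw [← h.direct'.minkQ_linear, ← (SO0.symm_mem h.mem).1, h.linear_edge, ← h.direct.minkQ_linear,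
    minkQ, minkB_neg_left, minkB_neg_right, neg_neg, minkQ]

theorem ne' : A' ≠ B' := by
  rintro rfl
  have := h.norm_sub_pos
  rw [← h.norm_sub_eq] at this
  simp at this

theorem minkQ_sub_pos : 0 < minkQ (J B - J A) := by
  rw [h.direct.minkQ_apply_sub]; exact h.norm_sub_pos

theorem timelike_add : IsFutureTimelike (J A + J B) :=
  isFutureTimelike_midpoint h.causal_left h.causal_right h.minkQ_sub_pos

theorem minkB_edge_right :
    minkB (J.linear (B - A)) (γ.symm (J'.linear (rot (B' - A')))) = 0 := by
  have h1 : J.linear (B - A) = -γ.symm (J'.linear (B' - A')) := by rw [h.linear_edge, neg_neg]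
  rw [h1, minkB_neg_left, SO0.minkB_map (SO0.symm_mem h.mem), h.direct'.minkB_linear,
    real_inner_comm, inner_rot]
  simp [det2]; ring

theorem minkB_edge_left : minkB (J.linear (B - A)) (J.linear (rot (B - A))) = 0 := by
  rw [h.direct.minkB_linear, real_inner_comm, inner_rot]
  simp [det2]; ring

theorem minkQ_left : minkQ (J.linear (rot (B - A))) = ‖B - A‖ ^ 2 := by
  rw [h.direct.minkQ_linear, norm_rot]

theorem minkQ_right : minkQ (γ.symm (J'.linear (rot (B' - A')))) = ‖B - A‖ ^ 2 := by
  rw [(SO0.symm_mem h.mem).1, h.direct'.minkQ_linear, norm_rot, h.norm_sub_eq]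

/-- The cross product of the first conormal with the edge, and that of the edge with the second
conormal, are positive multiples of the two future normals. The reversal of the edge by the gluing
compensates the order of the factors, so `conormal_inequality` applies. -/
theorem minkB_conormals_le :
    minkB (J.linear (rot (B - A))) (γ.symm (J'.linear (rot (B' - A')))) ≤ -‖B - A‖ ^ 2 := by
  have timelike_smul : ∀ {t : ℝ} {n : Mink}, 0 < t → IsFutureTimelike n →
      IsFutureTimelike (t • n) := fun ht hn =>
    ⟨by rw [minkQ_smul]; exact mul_neg_of_pos_of_neg (by positivity) hn.1,
      by simpa using mul_pos ht hn.2⟩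
  refine conormal_inequality (h.direct.minkQ_linear (B - A)) h.norm_sub_pos h.minkQ_left
    h.minkQ_right h.minkB_edge_left h.minkB_edge_right ?_ ?_
  · rw [mcross_linear]
    have : -det2 (rot (B - A)) (B - A) = ‖B - A‖ ^ 2 := by
      simp [det2, norm_sq_E2]; ring
    rw [this]
    exact timelike_smul h.norm_sub_pos h.direct.normal_future
  · have h1 : J.linear (B - A) = γ.symm (-J'.linear (B' - A')) := by
      rw [map_neg, h.linear_edge, neg_neg]
    rw [h1, ← SO0.map_mcross (SO0.symm_mem h.mem), ← map_neg, mcross_linear]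
    have : -det2 (-(B' - A')) (rot (B' - A')) = ‖B - A‖ ^ 2 := by
      rw [← h.norm_sub_eq]
      simp [det2, norm_sq_E2]; ring
    rw [this]
    exact SO0.timelike_map (SO0.symm_mem h.mem)
      (timelike_smul h.norm_sub_pos h.direct'.normal_future)

theorem minkQ_conormalSum : minkQ (conormalSum J J' A B A' B' γ) ≤ 0 := by
  rw [conormalSum, minkQ_add, h.minkQ_left, h.minkQ_right]
  linarith [h.minkB_conormals_le]

theorem minkB_edge_conormalSum : minkB (J.linear (B - A)) (conormalSum J J' A B A' B' γ) = 0 := by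
  rw [conormalSum, minkB_add_right, h.minkB_edge_left, h.minkB_edge_right, add_zero]

/-- The edge is convex if and only if the sum of the conormals points to the future. -/
theorem minkB_right_nonpos_iff : minkB (J B) (conormalSum J J' A B A' B' γ) ≤ 0 ↔
    0 ≤ (conormalSum J J' A B A' B' γ).1 := by
  rw [← minkB_nonpos_iff_of_timelike h.timelike_add h.minkQ_conormalSum]
  -- `u` is orthogonal to the edge, so pairing it with `J A + J B` amounts to twice pairing it with
  -- `J B`. The sum is used because `J B` alone may be lightlike.
  have h1 : J B = J A + J.linear (B - A) := affine_apply_eq J B A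
  have h2 := h.minkB_edge_conormalSum
  rw [h1, minkB_add_left, minkB_add_left, minkB_add_left, h2]
  constructor <;> intro <;> linarith

/-- The second plane, seen from the first, is the continuation of the first plane across the edge,
displaced by `u` in proportion to the distance from the edge. -/
theorem image_frame (α t : ℝ) :
    γ.symm (J' (A' + α • (B' - A') + t • rot (B' - A'))) =
      J (B - α • (B - A) - t • rot (B - A)) + t • conormalSum J J' A B A' B' γ := by
  have h1 : A' + α • (B' - A') + t • rot (B' - A') - A' =
    α • (B' - A') + t • rot (B' - A') := by abel
  have h2 : B - α • (B - A) - t • rot (B - A) - B = -(α • (B - A) + t • rot (B - A)) := by abel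
  rw [affine_apply_eq J' _ A', affine_apply_eq J _ B, h1, h2, ← h.map_right]
  simp only [map_add, map_neg, map_smul, h.linear_edge, LinearEquiv.symm_apply_apply, conormalSum]
  module

/-- Since `w` and `w'` have the same length, `Q(u) = 2B(w, u)` and the terms in `t²` cancel. The two
quadratic functions therefore differ across the edge by a linear function vanishing on it, with
slope given by `B(J B, u)`. -/
theorem minkQ_image_frame (α t : ℝ) :
    minkQ (J' (A' + α • (B' - A') + t • rot (B' - A'))) =
      minkQ (J (B - α • (B - A) - t • rot (B - A))) +
        2 * t * minkB (J B) (conormalSum J J' A B A' B' γ) := by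
  rw [← (SO0.symm_mem h.mem).1, h.image_frame, minkQ_add, minkQ_smul, minkB_smul_right]
  have h2 : B - α • (B - A) - t • rot (B - A) - B = -(α • (B - A) + t • rot (B - A)) := by abel
  have h3 : minkB (J (B - α • (B - A) - t • rot (B - A))) (conormalSum J J' A B A' B' γ) =
      minkB (J B) (conormalSum J J' A B A' B' γ) -
        t * minkB (J.linear (rot (B - A))) (conormalSum J J' A B A' B' γ) := by
    rw [affine_apply_eq J _ B, h2]
    simp only [map_add, map_neg, map_smul, minkB_add_left, minkB_neg_left, minkB_smul_left,
      h.minkB_edge_conormalSum]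
    ring
  have h4 : minkQ (conormalSum J J' A B A' B' γ) =
      2 * minkB (J.linear (rot (B - A))) (conormalSum J J' A B A' B' γ) := by
    rw [conormalSum, minkQ_add, h.minkQ_left, h.minkQ_right, minkB_add_right, ← minkQ, h.minkQ_left]
    ring
  rw [h3, h4]; ring

/-- Along a convex edge, the height of the first plane is at least `1` on the second half-plane. -/
theorem one_le_heightForm (hu : 0 ≤ (conormalSum J J' A B A' B' γ).1) {y : E2}
    (hy : 0 ≤ det2 (B' - A') (y - A')) : 1 ≤ heightForm J (γ.symm (J' y)) := by
  rw [eq_frame_combination h.ne' y, h.image_frame, heightForm_add, heightForm_smul,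
    h.direct.heightForm_apply h.causal_left]
  have : 0 ≤ heightForm J (conormalSum J J' A B A' B' γ) := by
    rw [h.direct.heightForm_nonneg_iff h.causal_left]
    exact (minkB_nonpos_iff_of_timelike h.direct.normal_future h.minkQ_conormalSum).2 hu
  have h1 : 0 ≤ det2 (B' - A') (y - A') / ‖B' - A'‖ ^ 2 := by positivity
  nlinarith [mul_nonneg h1 this]

/-- Along a convex edge, the extension of the first function is at most the second one on the second
half-plane. -/
theorem minkQ_le (hu : 0 ≤ (conormalSum J J' A B A' B' γ).1) {g g' : E2 ≃ᵃⁱ[ℝ] E2}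
    (hg : IsDirect g) (hg' : IsDirect g') (hA : g A = g' B') (hB : g B = g' A') {y : E2}
    (hy : 0 ≤ det2 (B' - A') (y - A')) : minkQ (J' y) ≤ minkQ (J (g.symm (g' y))) := by
  have h1 : 0 ≤ det2 (B' - A') (y - A') / ‖B' - A'‖ ^ 2 := by positivity
  have h2 := h.minkB_right_nonpos_iff.2 hu
  rw [eq_frame_combination h.ne' y, edge_map_frame hg hg' hA hB, AffineIsometryEquiv.symm_apply_apply,
    h.minkQ_image_frame]
  nlinarith [mul_nonneg h1 (neg_nonneg.2 h2)]

end IsEdgeGluing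

/-- Two affine parametrisations of a line that agree near a point are equal. -/
theorem lineMap_eq_of_eventually {V : Type*} [AddCommGroup V] [Module ℝ V] {P Q P' Q' : V} {s : ℝ}
    (h : ∀ᶠ t in 𝓝 s, AffineMap.lineMap P Q t = (AffineMap.lineMap P' Q' t : V)) :
    P = P' ∧ Q = Q' := by
  obtain ⟨ε, hε, h⟩ := Metric.eventually_nhds_iff.1 h
  have h1 := h (y := s) (by simpa using hε)
  have h2 := h (y := s + ε / 2) (by rw [Real.dist_eq, add_sub_cancel_left, abs_of_pos] <;> linarith)
  simp only [AffineMap.lineMap_apply_module] at h1 h2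
  have h3 : (ε / 2) • ((Q - P) - (Q' - P')) = 0 := by
    have : (ε / 2) • ((Q - P) - (Q' - P')) =
      ((1 - (s + ε / 2)) • P + (s + ε / 2) • Q - ((1 - s) • P + s • Q)) -
      ((1 - (s + ε / 2)) • P' + (s + ε / 2) • Q' - ((1 - s) • P' + s • Q')) := by module
    rw [this, h1, h2, sub_self]
  have h4 : Q - P = Q' - P' := by
    rcases smul_eq_zero.1 h3 with h3 | h3
    · linarith
    · exact sub_eq_zero.1 h3
  have h5 : P = P' := by
    have e : ∀ P Q : V, (1 - s) • P + s • Q = P + s • (Q - P) := fun P Q => by module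
    rw [e, e, h4] at h1
    exact add_right_cancel h1
  exact ⟨h5, by rw [h5] at h4; exact sub_left_injective h4⟩

/-! ### Identifications and charts of a geodesic triangulation. -/

namespace GeodesicTriangulation

variable {X : Type*} [TopologicalSpace X] {E : EuclideanConeSurface X}
  (T : GeodesicTriangulation E)

theorem area_pos (i : T.ι) : 0 < area (T.vert i) := T.vert_pos i

theorem sidePoint_mem_tri (i : T.ι) {k : Fin 3} {s : ℝ} (hs : s ∈ Icc (0 : ℝ) 1) :
    sidePoint (T.vert i) k s ∈ T.tri i := sidePoint_mem (T.area_pos i) hs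

theorem vert_mem_tri (i : T.ι) (k : Fin 3) : T.vert i k ∈ T.tri i :=
  subset_convexHull ℝ _ (mem_range_self k)

theorem cell_sidePoint {i j : T.ι} {k l : Fin 3} (h : T.pair (i, k) = (j, l)) {s : ℝ}
    (hs : s ∈ Icc (0 : ℝ) 1) :
    T.cell i (sidePoint (T.vert i) k s) = T.cell j (sidePoint (T.vert j) l (1 - s)) := by
  rw [T.cell_eq_iff i j _ (T.sidePoint_mem_tri i hs) _
    (T.sidePoint_mem_tri j ⟨by linarith [hs.2], by linarith [hs.1]⟩)]
  exact Relation.EqvGen.rel _ _ ⟨k, l, s, hs, h, rfl, rfl⟩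

theorem pair_symm {i j : T.ι} {k l : Fin 3} (h : T.pair (i, k) = (j, l)) :
    T.pair (j, l) = (i, k) := by
  rw [← h]; exact T.pair_involutive _

/-- A set of points of the triangles that is saturated for the elementary gluings is saturated for
the equality of images in the surface. -/
theorem mem_iff_of_cell_eq {S : Set (T.ι × E2)}
    (hS : ∀ a b, SideGlue T.vert T.pair a b → a ∈ S → b ∈ S) {i j : T.ι} {x y : E2}
    (hx : x ∈ T.tri i) (hy : y ∈ T.tri j) (h : T.cell i x = T.cell j y) (hi : (i, x) ∈ S) :
    (j, y) ∈ S := by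
  have hS' : ∀ a b, SideGlue T.vert T.pair a b → (a ∈ S ↔ b ∈ S) := by
    intro a b hab
    refine ⟨hS a b hab, hS b a ?_⟩
    obtain ⟨k, l, s, hs, hp, ha, hb⟩ := hab
    exact ⟨l, k, 1 - s, ⟨by linarith [hs.2], by linarith [hs.1]⟩, T.pair_symm hp, hb,
      by rw [sub_sub_cancel]; exact ha⟩
  have := (T.cell_eq_iff i j x hx y hy).1 h
  have key : ∀ a b, Relation.EqvGen (SideGlue T.vert T.pair) a b → (a ∈ S ↔ b ∈ S) := by
    intro a b hab
    induction hab with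
    | rel _ _ h => exact hS' _ _ h
    | refl => exact Iff.rfl
    | symm _ _ _ ih => exact ih.symm
    | trans _ _ _ _ _ ih1 ih2 => exact ih1.trans ih2
  exact (key _ _ this).1 hi

/-- No elementary gluing involves an interior point, so its singleton is saturated. -/
theorem eq_of_cell_eq_interior {i j : T.ι} {x y : E2} (hx : ∀ k, 0 < sideForm (T.vert i) k x)
    (hy : y ∈ T.tri j) (h : T.cell i x = T.cell j y) : j = i ∧ y = x := by
  have hx' : x ∈ T.tri i := (mem_solidTriangle_iff (T.area_pos i)).2 fun k => (hx k).le
  have := T.mem_iff_of_cell_eq (S := {(i, x)}) ?_ hx' hy h rfl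
  · exact Prod.ext_iff.1 this
  · rintro a b ⟨k, l, s, hs, -, ha, -⟩ rfl
    have h1 := hx k
    simp only at ha
    rw [ha, sideForm_sidePoint] at h1
    exact absurd h1 (lt_irrefl _)

/-- An interior point of a side lies on no other side, and the pairing is an involution; hence the
point and its partner form a saturated set. -/
theorem eq_of_cell_eq_side {i j i' : T.ι} {k l : Fin 3} (hp : T.pair (i, k) = (j, l)) {s : ℝ}
    (hs : s ∈ Ioo (0 : ℝ) 1) {y : E2} (hy : y ∈ T.tri i')
    (h : T.cell i (sidePoint (T.vert i) k s) = T.cell i' y) :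
    (i' = i ∧ y = sidePoint (T.vert i) k s) ∨ (i' = j ∧ y = sidePoint (T.vert j) l (1 - s)) := by
  have := T.mem_iff_of_cell_eq (S := {(i, sidePoint (T.vert i) k s),
    (j, sidePoint (T.vert j) l (1 - s))}) ?_ (T.sidePoint_mem_tri i (Ioo_subset_Icc_self hs)) hy h
    (Or.inl rfl)
  · rcases this with h | h
    · exact Or.inl (Prod.ext_iff.1 h)
    · exact Or.inr (Prod.ext_iff.1 h)
  · have hs' : 1 - s ∈ Ioo (0 : ℝ) 1 := ⟨by linarith [hs.2], by linarith [hs.1]⟩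
    rintro a ⟨b1, b2⟩ ⟨k', l', s', -, hp', ha, hb⟩ (rfl | rfl)
    · simp only at ha hp' hb
      obtain ⟨rfl, rfl⟩ := sidePoint_eq_sidePoint (T.area_pos i) hs ha
      rw [hp, Prod.mk.injEq] at hp'
      obtain ⟨rfl, rfl⟩ := hp'
      right
      rw [hb]; rfl
    · simp only at ha hp' hb
      obtain ⟨rfl, rfl⟩ := sidePoint_eq_sidePoint (T.area_pos j) hs' ha
      rw [T.pair_symm hp, Prod.mk.injEq] at hp'
      obtain ⟨rfl, rfl⟩ := hp'
      left
      rw [hb, sub_sub_cancel]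

theorem sidePoint_eq_vert {v : Fin 3 → E2} (hv : 0 < area v) {k m : Fin 3} {s : ℝ}
    (h : v m = sidePoint v k s) : s = 0 ∨ s = 1 := by
  by_cases h0 : s = 0
  · exact Or.inl h0
  by_cases h1 : s = 1
  · exact Or.inr h1
  exfalso
  have e1 := congrArg (sideForm v k) h
  have e2 := congrArg (sideForm v (k + 1)) h
  have e3 := congrArg (sideForm v (k + 2)) h
  rw [sideForm_sidePoint] at e1
  rw [sideForm_succ_sidePoint] at e2
  rw [sideForm_pred_sidePoint] at e3
  have n1 : (1 - s) * area v ≠ 0 := mul_ne_zero (sub_ne_zero.2 (Ne.symm h1)) hv.ne'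
  have n2 : s * area v ≠ 0 := mul_ne_zero h0 hv.ne'
  rcases Fin3.cases_add k m with rfl | rfl | rfl
  · apply n2; rw [← e3]
    have := sideForm_succ v (m + 2)
    rwa [show m + 2 + 1 = m by clear * -; revert m; decide] at this
  · apply n1; rw [← e2, sideForm_self]
  · simp at e1; exact hv.ne' e1

/-- A vertex is identified only with vertices. -/
theorem eq_vert_of_cell_eq {i j : T.ι} {k : Fin 3} {y : E2} (hy : y ∈ T.tri j)
    (h : T.cell i (T.vert i k) = T.cell j y) : ∃ l, y = T.vert j l := by
  have := T.mem_iff_of_cell_eq (S := {a | ∃ l, a.2 = T.vert a.1 l}) ?_ (T.vert_mem_tri i k) hy h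
    ⟨k, rfl⟩
  · exact this
  · rintro a b ⟨k', l', s', -, hp', ha, hb⟩ ⟨m, hm⟩
    rw [hm] at ha
    rcases sidePoint_eq_vert (T.area_pos _) ha with rfl | rfl
    · exact ⟨l' + 1, by rw [hb, sub_zero, sidePoint_one]⟩
    · exact ⟨l', by rw [hb, sub_self, sidePoint_zero]⟩

/-- The vertices of the triangulation. -/
def vertices : Set X := {x | ∃ i k, T.cell i (T.vert i k) = x}

theorem finite_vertices : T.vertices.Finite := by
  have := T.finite
  refine (finite_range fun a : T.ι × Fin 3 => T.cell a.1 (T.vert a.1 a.2)).subset ?_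
  rintro x ⟨i, k, rfl⟩
  exact ⟨(i, k), rfl⟩

theorem cell_sidePoint_notMem_vertices {i : T.ι} {k : Fin 3} {s : ℝ} (hs : s ∈ Ioo (0 : ℝ) 1) :
    T.cell i (sidePoint (T.vert i) k s) ∉ T.vertices := by
  rintro ⟨j, l, h⟩
  obtain ⟨m, hm⟩ := T.eq_vert_of_cell_eq (T.sidePoint_mem_tri i (Ioo_subset_Icc_self hs)) h
  rcases sidePoint_eq_vert (T.area_pos i) hm.symm with rfl | rfl
  · exact lt_irrefl _ hs.1
  · exact lt_irrefl _ hs.2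

theorem exists_chart_of_notMem_vertices {x : X} (hx : x ∉ T.vertices) :
    ∃ φ ∈ E.atlas, x ∈ φ.source :=
  E.cover x fun h => hx (T.marked_subset x h)

/-- A point of a triangle which is not a vertex is an interior point, or belongs to the relative
interior of a side. -/
theorem interior_or_side {i : T.ι} {x : E2} (hx : x ∈ T.tri i) (h : T.cell i x ∉ T.vertices) :
    (∀ k, 0 < sideForm (T.vert i) k x) ∨
      ∃ k, ∃ s ∈ Ioo (0 : ℝ) 1, x = sidePoint (T.vert i) k s := by
  by_cases h1 : ∀ k, 0 < sideForm (T.vert i) k x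
  · exact Or.inl h1
  push Not at h1
  obtain ⟨k, hk⟩ := h1
  obtain ⟨s, hs, rfl⟩ := eq_sidePoint (T.area_pos i) hx
    (le_antisymm hk ((mem_solidTriangle_iff (T.area_pos i)).1 hx k))
  refine Or.inr ⟨k, s, ⟨lt_of_le_of_ne hs.1 ?_, lt_of_le_of_ne hs.2 ?_⟩, rfl⟩
  · rintro rfl
    exact h ⟨i, k, by rw [sidePoint_zero]⟩
  · rintro rfl
    exact h ⟨i, k + 1, by rw [sidePoint_one]⟩

theorem continuous_domRestrict_cell (i : T.ι) : Continuous ((T.tri i).domRestrict (T.cell i)) :=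
  continuousOn_iff_continuous_domRestrict.1 (T.cell_continuous i)

instance (i : T.ι) : CompactSpace (T.tri i) :=
  isCompact_iff_compactSpace.1 (isCompact_solidTriangle _)

/-- A property of the points of the triangles that holds near the preimages of a point `x` of the
surface holds at the preimages of the points near `x`. -/
theorem eventually_nhds [T2Space X] {P : T.ι → E2 → Prop} (x : X)
    (h : ∀ i, ∀ y ∈ T.tri i, T.cell i y = x → ∀ᶠ z in 𝓝[T.tri i] y, P i z) :
    ∀ᶠ x' in 𝓝 x, ∀ i, ∀ y ∈ T.tri i, T.cell i y = x' → P i y := by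
  have := T.finite
  rw [eventually_all]
  intro i
  -- A continuous map from a compact triangle to a Hausdorff space is closed, so a neighbourhood of
  -- a fibre contains the preimage of a neighbourhood of the point.
  have hc : IsClosedMap ((T.tri i).domRestrict (T.cell i)) :=
    (T.continuous_domRestrict_cell i).isProperMap.isClosedMap
  have := hc.eventually_nhds_fiber (p := fun y => P i y) x ?_
  · filter_upwards [this] with x' hx' y hy hyx
    exact hx' ⟨y, hy⟩ hyx
  · rintro ⟨y, hy⟩ hyx
    have := h i y hy hyx
    rw [nhdsWithin_eq_map_subtype_coe hy] at this
    exact this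

theorem tendsto_sidePoint {i : T.ι} {k : Fin 3} {s : ℝ} (hs : s ∈ Ioo (0 : ℝ) 1) :
    Tendsto (sidePoint (T.vert i) k) (𝓝 s) (𝓝[T.tri i] sidePoint (T.vert i) k s) := by
  refine tendsto_nhdsWithin_iff.2 ⟨?_, ?_⟩
  · have : Continuous (sidePoint (T.vert i) k) := by
      have : sidePoint (T.vert i) k = fun s => (1 - s) • T.vert i k + s • T.vert i (k + 1) :=
        funext fun s => sidePoint_eq _ _ _
      rw [this]; fun_prop
    exact this.continuousAt
  · filter_upwards [Ioo_mem_nhds hs.1 hs.2] with t ht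
    exact T.sidePoint_mem_tri i (Ioo_subset_Icc_self ht)

/-- The developments of two adjacent triangles in a chart fit along the common edge. -/
theorem exists_developments {i j : T.ι} {k l : Fin 3} (hp : T.pair (i, k) = (j, l)) {s : ℝ}
    (hs : s ∈ Ioo (0 : ℝ) 1) {φ : OpenPartialHomeomorph X E2} (hφ : φ ∈ E.atlas)
    (hx : T.cell i (sidePoint (T.vert i) k s) ∈ φ.source) :
    ∃ g g' : E2 ≃ᵃⁱ[ℝ] E2, IsDirect g ∧ IsDirect g' ∧
      (∀ᶠ y in 𝓝[T.tri i] sidePoint (T.vert i) k s, φ (T.cell i y) = g y) ∧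
      (∀ᶠ y in 𝓝[T.tri j] sidePoint (T.vert j) l (1 - s), φ (T.cell j y) = g' y) ∧
      g (T.vert i k) = g' (T.vert j (l + 1)) ∧ g (T.vert i (k + 1)) = g' (T.vert j l) := by
  have hs' : 1 - s ∈ Ioo (0 : ℝ) 1 := ⟨by linarith [hs.2], by linarith [hs.1]⟩
  obtain ⟨g, hg, hge⟩ := T.cell_isometric i _ (T.sidePoint_mem_tri i (Ioo_subset_Icc_self hs)) φ hφ hx
  obtain ⟨g', hg', hge'⟩ := T.cell_isometric j _
    (T.sidePoint_mem_tri j (Ioo_subset_Icc_self hs')) φ hφ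
    (by rwa [← T.cell_sidePoint hp (Ioo_subset_Icc_self hs)])
  refine ⟨g, g', hg, hg', hge, hge', ?_⟩
  have t1 := (T.tendsto_sidePoint (i := i) (k := k) hs).eventually hge
  have t2 := ((T.tendsto_sidePoint (i := j) (k := l) hs').comp
    ((continuous_sub_left 1).tendsto s : Tendsto (fun t : ℝ => 1 - t) _ _)).eventually hge'
  -- Charts only control the side near the parameter `s`; two affine parametrisations that agree
  -- there agree at the end points of the side too.
  apply lineMap_eq_of_eventually (s := s)
  filter_upwards [t1, t2, Ioo_mem_nhds hs.1 hs.2] with t h1 h2 ht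
  simp only [Function.comp] at h2
  rw [← T.cell_sidePoint hp (Ioo_subset_Icc_self ht), h1] at h2
  have e1 : g (sidePoint (T.vert i) k t) =
      AffineMap.lineMap (g (T.vert i k)) (g (T.vert i (k + 1))) t :=
    AffineMap.apply_lineMap (g.toAffineEquiv : E2 →ᵃ[ℝ] E2) _ _ t
  have e2 : g' (sidePoint (T.vert j) l (1 - t)) =
      AffineMap.lineMap (g' (T.vert j (l + 1))) (g' (T.vert j l)) t := by
    rw [sidePoint, AffineMap.lineMap_apply_one_sub]
    exact AffineMap.apply_lineMap (g'.toAffineEquiv : E2 →ᵃ[ℝ] E2) _ _ t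
  rw [← e1, ← e2, h2]

theorem norm_side_eq {i j : T.ι} {k l : Fin 3} (hp : T.pair (i, k) = (j, l)) :
    ‖T.vert i (k + 1) - T.vert i k‖ = ‖T.vert j (l + 1) - T.vert j l‖ := by
  have hs : (1 / 2 : ℝ) ∈ Ioo (0 : ℝ) 1 := by norm_num
  obtain ⟨φ, hφ, hx⟩ := T.exists_chart_of_notMem_vertices
    (T.cell_sidePoint_notMem_vertices (i := i) (k := k) hs)
  obtain ⟨g, g', -, -, -, -, h1, h2⟩ := T.exists_developments hp hs hφ hx
  rw [← dist_eq_norm, ← dist_eq_norm, ← g.dist_map, h1, h2, g'.dist_map, dist_comm]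

/-! ### Embedded triangles and their gluing along edges. -/

section Embeddings

variable {T}
variable {τ : X → ℝ} {J : T.ι → E2 →ᵃ[ℝ] Mink}

/-- Both sides have quadratic part `-‖x‖²`, so their difference is affine; it vanishes at the
vertices, hence on the triangle. -/
theorem IsAdapted.minkQ_eq (hT : T.IsAdapted τ) {i : T.ι} {J : E2 →ᵃ[ℝ] Mink}
    (hJ : T.IsSuspensionEmbedding τ i J) {x : E2} (hx : x ∈ T.tri i) :
    τ (T.cell i x) = -minkQ (J x) := by
  obtain ⟨ω, τ₀, h⟩ := hT i
  let f : E2 → ℝ := fun x => -minkQ (J x) - (τ₀ - dist x ω ^ 2)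
  have hf : ∀ x y : E2, ∀ a b : ℝ, a + b = 1 → f (a • x + b • y) = a * f x + b * f y := by
    intro x y a b hab
    have e : ∀ x, f x = -minkQ (J 0) - 2 * minkB (J 0) (J.linear x) - τ₀ - 2 * inner ℝ x ω +
        ‖ω‖ ^ 2 := by
      intro x
      simp only [f]
      rw [affine_apply_eq J x 0, sub_zero, minkQ_add, hJ.1, dist_eq_norm, @norm_sub_sq_real]
      ring
    obtain rfl : b = 1 - a := by linarith
    simp only [e, map_add, map_smul, minkB_add_right, minkB_smul_right, inner_add_left,
      real_inner_smul_left]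
    ring
  have hc : Convex ℝ {x : E2 | f x = 0} := by
    intro x hx y hy a b _ _ hab
    simp only [mem_ofPred_eq] at *
    rw [hf _ _ _ _ hab, hx, hy]; ring
  have : f x = 0 := by
    refine convexHull_min ?_ hc hx
    rintro _ ⟨k, rfl⟩
    have h1 := hJ.2.2.1 k
    rw [h _ (T.vert_mem_tri i k)] at h1
    simp only [f, mem_ofPred_eq, h1]; ring
  rw [h x hx]
  simp only [f] at this
  linarith

theorem IsAdapted.continuous [T2Space X] (hT : T.IsAdapted τ) : Continuous τ := by
  rw [continuous_iff_continuousAt]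
  intro x
  rw [ContinuousAt, Metric.tendsto_nhds]
  intro ε hε
  have := T.eventually_nhds (P := fun i y => dist (τ (T.cell i y)) (τ x) < ε) x ?_
  · filter_upwards [this] with x' hx'
    obtain ⟨i, y, hy, rfl⟩ := T.cell_surjective x'
    exact hx' i y hy rfl
  · rintro i y hy rfl
    obtain ⟨ω, τ₀, h⟩ := hT i
    have hc : ContinuousWithinAt (fun y => τ (T.cell i y)) (T.tri i) y := by
      have : ContinuousWithinAt (fun y : E2 => τ₀ - dist y ω ^ 2) (T.tri i) y := by fun_prop
      exact this.congr h (h y hy)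
    exact Metric.tendsto_nhds.1 hc ε hε

theorem isEdgeGluing_of_mem (hJ : ∀ i, T.IsSuspensionEmbedding τ i (J i)) {i j : T.ι}
    {k l : Fin 3} {γ : Mink ≃ₗ[ℝ] Mink} (hγ : γ ∈ SO0)
    (h1 : γ (J i (T.vert i k)) = J j (T.vert j (l + 1)))
    (h2 : γ (J i (T.vert i (k + 1))) = J j (T.vert j l)) :
    IsEdgeGluing (J i) (J j) (T.vert i k) (T.vert i (k + 1)) (T.vert j l) (T.vert j (l + 1)) γ where
  direct := (hJ i).isDirectEmbedding
  direct' := (hJ j).isDirectEmbedding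
  mem := hγ
  map_left := h1
  map_right := h2
  ne := (side_ne (T.area_pos i) k).symm
  causal_left := (hJ i).2.1 _ (T.vert_mem_tri i _)
  causal_right := (hJ i).2.1 _ (T.vert_mem_tri i _)

/-- The Gram data of the two embedded sides agree: `Q` at the end points is prescribed by `τ`, and
the lengths of the sides agree because the developments fit together in a chart. -/
theorem exists_isEdgeGluing (hJ : ∀ i, T.IsSuspensionEmbedding τ i (J i)) {i j : T.ι}
    {k l : Fin 3} (hp : T.pair (i, k) = (j, l)) : ∃ γ,
    IsEdgeGluing (J i) (J j) (T.vert i k) (T.vert i (k + 1)) (T.vert j l) (T.vert j (l + 1)) γ := by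
  have e0 : T.cell i (T.vert i k) = T.cell j (T.vert j (l + 1)) := by
    have := T.cell_sidePoint hp (s := 0) (by norm_num)
    rwa [sidePoint_zero, sub_zero, sidePoint_one] at this
  have e1 : T.cell i (T.vert i (k + 1)) = T.cell j (T.vert j l) := by
    have := T.cell_sidePoint hp (s := 1) (by norm_num)
    rwa [sidePoint_one, sub_self, sidePoint_zero] at this
  have hd := (hJ i).isDirectEmbedding
  have hd' := (hJ j).isDirectEmbedding
  have hne : T.vert i (k + 1) - T.vert i k ≠ 0 := sub_ne_zero.2 (side_ne (T.area_pos i) k)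
  obtain ⟨γ, hγ, h1, h2⟩ := exists_SO0_of_gram (p := J i (T.vert i k))
    (q := J i (T.vert i (k + 1))) (p' := J j (T.vert j (l + 1))) (q' := J j (T.vert j l))
    ((hJ i).2.1 _ (T.vert_mem_tri i _)) ((hJ i).2.1 _ (T.vert_mem_tri i _))
    ((hJ j).2.1 _ (T.vert_mem_tri j _)) ((hJ j).2.1 _ (T.vert_mem_tri j _))
    (by rw [hd.minkQ_apply_sub]; positivity)
    (by have h1 := (hJ i).2.2.1 k; have h2 := (hJ j).2.2.1 (l + 1); rw [e0] at h1; linarith)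
    (by have h1 := (hJ i).2.2.1 (k + 1); have h2 := (hJ j).2.2.1 l; rw [e1] at h1; linarith)
    (by rw [hd.minkQ_apply_sub, hd'.minkQ_apply_sub, T.norm_side_eq hp, norm_sub_rev])
  exact ⟨γ, isEdgeGluing_of_mem hJ hγ h1 h2⟩

/-- All edges are convex: the sum of the inward conormals is zero or future pointing. -/
def EdgesConvex (T : GeodesicTriangulation E) (J : T.ι → E2 →ᵃ[ℝ] Mink) : Prop :=
  ∀ i j k l γ, T.pair (i, k) = (j, l) →
    IsEdgeGluing (J i) (J j) (T.vert i k) (T.vert i (k + 1)) (T.vert j l) (T.vert j (l + 1)) γ →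
    0 ≤ (conormalSum (J i) (J j) (T.vert i k) (T.vert i (k + 1)) (T.vert j l)
      (T.vert j (l + 1)) γ).1

end Embeddings

end GeodesicTriangulation

/-! ## Midpoint convexity along lines -/

/-- A continuous function that is locally midpoint convex satisfies the maximum principle. -/
theorem le_max_of_midpoint {f : ℝ → ℝ} {a b : ℝ} (hc : ContinuousOn f (Icc a b))
    (h : ∀ t ∈ Ioo a b, ∀ᶠ s in 𝓝[>] (0 : ℝ), 2 * f t ≤ f (t + s) + f (t - s)) {t : ℝ}
    (ht : t ∈ Icc a b) : f t ≤ max (f a) (f b) := by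
  by_contra! hlt
  obtain ⟨m, hm, hmax⟩ := isCompact_Icc.exists_isMaxOn ⟨t, ht⟩ hc
  have hM : max (f a) (f b) < f m := hlt.trans_le (hmax ht)
  have hK : IsCompact (Icc a b ∩ f ⁻¹' {f m}) :=
    isCompact_Icc.of_isClosed_subset (hc.preimage_isClosed_of_isClosed isClosed_Icc
      isClosed_singleton) inter_subset_left
  -- The rightmost maximum point is interior. There the midpoint inequality forces a further maximum
  -- point to its right.
  obtain ⟨t', ⟨ht', hft'⟩, hgr⟩ := hK.exists_isGreatest ⟨m, hm, rfl⟩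
  have hft' : f t' = f m := hft'
  have ha : t' ≠ a := by
    rintro rfl
    rw [← hft'] at hM
    exact absurd (le_max_left _ _) (not_le.2 hM)
  have hb : t' ≠ b := by
    rintro rfl
    rw [← hft'] at hM
    exact absurd (le_max_right _ _) (not_le.2 hM)
  have hI : t' ∈ Ioo a b := ⟨lt_of_le_of_ne ht'.1 ha.symm, lt_of_le_of_ne ht'.2 hb⟩
  have h1 : ∀ᶠ s in 𝓝[>] (0 : ℝ), s < min (b - t') (t' - a) :=
    nhdsWithin_le_nhds (Iio_mem_nhds (lt_min (by linarith [hI.2]) (by linarith [hI.1])))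
  obtain ⟨s, ⟨hs, hs1⟩, hs0⟩ := (((h t' hI).and h1).and self_mem_nhdsWithin).exists
  have hs0 : 0 < s := hs0
  rw [lt_min_iff] at hs1
  have m1 : t' + s ∈ Icc a b := ⟨by linarith [hI.1], by linarith⟩
  have m2 : t' - s ∈ Icc a b := ⟨by linarith, by linarith [hI.2]⟩
  have e1 : f (t' + s) ≤ f m := hmax m1
  have e2 : f (t' - s) ≤ f m := hmax m2
  have := hgr ⟨m1, (by linarith : f (t' + s) = f m)⟩
  linarith

/-- Subtracting a linear function makes the values at `±s` equal, and the maximum principle applies.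
The point is the passage from scales depending on the base point to a prescribed scale, which is
what survives a limit of parallel lines. -/
theorem midpoint_le_of_local {f : ℝ → ℝ} {s : ℝ} (hs : 0 < s) (hc : ContinuousOn f (Icc (-s) s))
    (h : ∀ t ∈ Ioo (-s) s, ∀ᶠ r in 𝓝[>] (0 : ℝ), 2 * f t ≤ f (t + r) + f (t - r)) :
    2 * f 0 ≤ f s + f (-s) := by
  have := le_max_of_midpoint (f := fun t => f t - t * ((f s - f (-s)) / (2 * s)))
    (a := -s) (b := s) (hc.sub (by fun_prop)) ?_ (t := 0) ⟨by linarith, hs.le⟩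
  · have e1 : f s - s * ((f s - f (-s)) / (2 * s)) = (f s + f (-s)) / 2 := by field_simp; ring
    have e2 : f (-s) - -s * ((f s - f (-s)) / (2 * s)) = (f s + f (-s)) / 2 := by field_simp; ring
    simp only [e1, e2, max_self, zero_mul, sub_zero] at this
    linarith
  · intro t ht
    filter_upwards [h t ht] with r hr
    linarith

section

variable {V : Type*} [NormedAddCommGroup V] [NormedSpace ℝ V]

/-- The function `G` is midpoint convex at `z` in the direction `v`, at small scale. -/
def MidpointConvexAt (G : V → ℝ) (z v : V) : Prop :=
  ∀ᶠ s in 𝓝[>] (0 : ℝ), 2 * G z ≤ G (z + s • v) + G (z - s • v)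

/-- Midpoint convexity extends to a point of an exceptional set which is avoided by parallel
lines. -/
theorem MidpointConvexAt.of_parallel {G : V → ℝ} {z v w : V} {N : Set V}
    (hc : ∀ᶠ y in 𝓝 z, ContinuousAt G y)
    (hN : ∀ᶠ y in 𝓝 z, y ∉ N → MidpointConvexAt G y v)
    (hw : ∀ ε : ℝ, ε ≠ 0 → ∀ s : ℝ, z + ε • w + s • v ∉ N) : MidpointConvexAt G z v := by
  have ht : Tendsto (fun a : ℝ × ℝ => z + a.1 • w + a.2 • v) (𝓝 (0, 0)) (𝓝 z) := by
    have : Continuous fun a : ℝ × ℝ => z + a.1 • w + a.2 • v := by fun_prop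
    simpa using this.tendsto (0, 0)
  obtain ⟨δ, hδ, h⟩ := Metric.eventually_nhds_iff.1 (ht.eventually (hc.and hN))
  have h' : ∀ ε s : ℝ, |ε| < δ → |s| < δ → ContinuousAt G (z + ε • w + s • v) ∧
      (z + ε • w + s • v ∉ N → MidpointConvexAt G (z + ε • w + s • v) v) := by
    intro ε s h1 h2
    exact h (y := (ε, s)) (by rw [Prod.dist_eq]; simp [h1, h2])
  filter_upwards [Ioo_mem_nhdsGT hδ] with s hs
  -- The line displaced by `ε • w` misses `N`, so the inequality holds on it at the fixed scale `s`,
  -- for all small `ε`; continuity then gives the limit `ε → 0`.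
  have key : ∀ᶠ ε in 𝓝[>] (0 : ℝ),
      2 * G (z + ε • w) ≤ G (z + ε • w + s • v) + G (z + ε • w + (-s) • v) := by
    filter_upwards [Ioo_mem_nhdsGT hδ] with ε hε
    have hε' : |ε| < δ := by rw [abs_of_pos hε.1]; exact hε.2
    have hs' : ∀ t ∈ Icc (-s) s, |t| < δ := fun t ht => by
      rw [abs_lt]; exact ⟨by linarith [ht.1, hs.2], by linarith [ht.2, hs.2]⟩
    have := midpoint_le_of_local (f := fun t => G (z + ε • w + t • v)) hs.1 ?_ ?_
    · simpa using this
    · intro t ht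
      have h1 : ContinuousAt (fun t : ℝ => z + ε • w + t • v) t := by fun_prop
      exact (ContinuousAt.comp (f := fun t : ℝ => z + ε • w + t • v)
        (h' ε t hε' (hs' t ht)).1 h1).continuousWithinAt
    · intro t ht
      have := (h' ε t hε' (hs' t (Ioo_subset_Icc_self ht))).2 (hw ε hε.1.ne' t)
      filter_upwards [this] with r hr
      have e1 : z + ε • w + (t + r) • v = z + ε • w + t • v + r • v := by module
      have e2 : z + ε • w + (t - r) • v = z + ε • w + t • v - r • v := by module
      rw [e1, e2]; exact hr
  have tend : ∀ t : ℝ, |t| < δ → Tendsto (fun ε : ℝ => G (z + ε • w + t • v)) (𝓝[>] 0)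
      (𝓝 (G (z + t • v))) := by
    intro t ht
    have h1 : ContinuousAt (fun ε : ℝ => z + ε • w + t • v) 0 := by fun_prop
    have h2 := (h' 0 t (by simpa using hδ) ht).1
    have h3 := ContinuousAt.comp (f := fun ε : ℝ => z + ε • w + t • v) (x := 0) h2 h1
    have h4 := h3.tendsto
    simp only [Function.comp_def, zero_smul, add_zero] at h4
    exact h4.mono_left nhdsWithin_le_nhds
  have t0 := tend 0 (by simpa using hδ)
  have t1 := tend s (by rw [abs_of_pos hs.1]; exact hs.2)
  have t2 := tend (-s) (by rw [abs_neg, abs_of_pos hs.1]; exact hs.2)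
  simp only [zero_smul, add_zero] at t0
  have := le_of_tendsto_of_tendsto (t0.const_mul 2) (t1.add t2) key
  rwa [neg_smul, ← sub_eq_add_neg] at this

end

/-! ## One-sided quadratic functions of one variable -/

/-- `A` is the right derivative at `t` and `B` the left one; the formulas on the two sides make `f`
`C¹` up to `t` and identify the limits of `deriv f`. -/
theorem QConvexOn.of_quadratic {f : ℝ → ℝ} {I : Set ℝ}
    (h : ∀ t ∈ I, ∃ ε > 0, ∃ A B L : ℝ,
      (∀ s ∈ Icc 0 ε, t + s ∈ I → f (t + s) = f t + A * s - L * s ^ 2) ∧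
      (∀ s ∈ Icc 0 ε, t - s ∈ I → f (t - s) = f t - B * s - L * s ^ 2) ∧
      (t ∈ interior I → B ≤ A)) : QConvexOn f I := by
  have h' : ∀ t ∈ I, ∃ ε > 0, ∃ A B L : ℝ,
      (∀ s ∈ I ∩ Icc t (t + ε), f s = f t + A * (s - t) - L * (s - t) ^ 2) ∧
      (∀ s ∈ I ∩ Icc (t - ε) t, f s = f t + B * (s - t) - L * (s - t) ^ 2) ∧
      (t ∈ interior I → B ≤ A) := by
    intro t ht
    obtain ⟨ε, hε, A, B, L, h1, h2, h3⟩ := h t ht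
    refine ⟨ε, hε, A, B, L, fun s hs => ?_, fun s hs => ?_, h3⟩
    · have := h1 (s - t) ⟨by linarith [hs.2.1], by linarith [hs.2.2]⟩
        (by rw [add_sub_cancel]; exact hs.1)
      rwa [add_sub_cancel] at this
    · have := h2 (t - s) ⟨by linarith [hs.2.2], by linarith [hs.2.1]⟩
        (by rw [sub_sub_cancel]; exact hs.1)
      rw [sub_sub_cancel] at this
      rw [this]; ring
  have hC1 : IsPiecewiseC1On f I := by
    intro t ht
    obtain ⟨ε, hε, A, B, L, h1, h2, -⟩ := h' t ht
    refine ⟨ε, hε, ?_, ?_⟩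
    · have : ContDiff ℝ 1 fun s : ℝ => f t + B * (s - t) - L * (s - t) ^ 2 := by fun_prop
      exact this.contDiffOn.congr h2
    · have : ContDiff ℝ 1 fun s : ℝ => f t + A * (s - t) - L * (s - t) ^ 2 := by fun_prop
      exact this.contDiffOn.congr h1
  refine ⟨fun t ht => ?_, hC1, fun t ht => ?_⟩
  · obtain ⟨ε, hε, c1, c2⟩ := hC1 t ht
    have := (c1.continuousOn t ⟨ht, by linarith, le_rfl⟩).union
      (c2.continuousOn t ⟨ht, le_rfl, by linarith⟩)
    refine this.mono_of_mem_nhdsWithin ?_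
    rw [← inter_union_distrib_left, Icc_union_Icc_eq_Icc (by linarith) (by linarith)]
    exact inter_mem self_mem_nhdsWithin
      (nhdsWithin_le_nhds (Icc_mem_nhds (by linarith) (by linarith)))
  · obtain ⟨ε, hε, A, B, L, h1, h2, h3⟩ := h' t (interior_subset ht)
    have hd : ∀ (C : ℝ) (U : Set ℝ), IsOpen U → (∀ s ∈ I ∩ U, f s = f t + C * (s - t) - L * (s - t) ^ 2) →
        ∀ s ∈ interior I ∩ U, deriv f s = C - L * (2 * (s - t)) := by
      intro C U hU hf s hs
      have e : f =ᶠ[𝓝 s] fun s => f t + C * (s - t) - L * (s - t) ^ 2 := by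
        filter_upwards [(isOpen_interior.inter hU).mem_nhds hs] with r hr
        exact hf r ⟨interior_subset hr.1, hr.2⟩
      rw [e.deriv_eq]
      have d1 : HasDerivAt (fun s : ℝ => s - t) 1 s := (hasDerivAt_id s).sub_const t
      have := ((d1.const_mul C).const_add (f t)).sub ((d1.pow 2).const_mul L)
      refine (this.congr_deriv ?_).deriv
      simp
    have ht' : ∀ C : ℝ, Tendsto (fun s => C - L * (2 * (s - t))) (𝓝 t) (𝓝 C) := by
      intro C
      have : Continuous fun s => C - L * (2 * (s - t)) := by fun_prop
      simpa using this.tendsto t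
    have hI := isOpen_interior.mem_nhds ht
    refine ⟨B, A, ?_, ?_, h3 ht⟩
    · refine ((ht' B).mono_left nhdsWithin_le_nhds).congr' ?_
      filter_upwards [Ioo_mem_nhdsLT (show t - ε < t by linarith), nhdsWithin_le_nhds hI] with s hs hs'
      exact (hd B (Ioo (t - ε) t) isOpen_Ioo
        (fun r hr => h2 r ⟨hr.1, Ioo_subset_Icc_self hr.2⟩) s ⟨hs', hs⟩).symm
    · refine ((ht' A).mono_left nhdsWithin_le_nhds).congr' ?_
      filter_upwards [Ioo_mem_nhdsGT (show t < t + ε by linarith), nhdsWithin_le_nhds hI] with s hs hs'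
      exact (hd A (Ioo t (t + ε)) isOpen_Ioo
        (fun r hr => h1 r ⟨hr.1, Ioo_subset_Icc_self hr.2⟩) s ⟨hs', hs⟩).symm

/-! ## Convex edges imply Q-convexity -/

namespace GeodesicTriangulation

variable {X : Type*} [TopologicalSpace X] [T2Space X] {E : EuclideanConeSurface X}
  {T : GeodesicTriangulation E} {τ : X → ℝ} {J : T.ι → E2 →ᵃ[ℝ] Mink}

/-- Near a point that is not a vertex, the function is bounded below by the extension of its
expression on one triangle. -/
theorem exists_lower_bound (hT : T.IsAdapted τ) (hJ : ∀ i, T.IsSuspensionEmbedding τ i (J i))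
    (hE : T.EdgesConvex J) {x : X} (hx : x ∉ T.vertices) {φ : OpenPartialHomeomorph X E2}
    (hφ : φ ∈ E.atlas) (hxφ : x ∈ φ.source) :
    ∃ (i : T.ι) (g : E2 ≃ᵃⁱ[ℝ] E2), τ x = -minkQ (J i (g.symm (φ x))) ∧
      ∀ᶠ x' in 𝓝 x, -minkQ (J i (g.symm (φ x'))) ≤ τ x' := by
  obtain ⟨i, y, hy, rfl⟩ := T.cell_surjective x
  rcases T.interior_or_side hy hx with hint | ⟨k, s, hs, rfl⟩
  · obtain ⟨g, hg, hge⟩ := T.cell_isometric i y hy φ hφ hxφ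
    have := T.eventually_nhds (P := fun i' z => i' = i ∧ φ (T.cell i' z) = g z) (T.cell i y) ?_
    · refine ⟨i, g, ?_, ?_⟩
      · rw [(this.self_of_nhds i y hy rfl).2, g.symm_apply_apply, hT.minkQ_eq (hJ i) hy]
      · filter_upwards [this] with x' hx'
        obtain ⟨i', z, hz, rfl⟩ := T.cell_surjective x'
        obtain ⟨rfl, h⟩ := hx' i' z hz rfl
        rw [h, g.symm_apply_apply, hT.minkQ_eq (hJ i') hz]
    · intro i' y' hy' h
      obtain ⟨rfl, rfl⟩ := T.eq_of_cell_eq_interior hint hy' h.symm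
      filter_upwards [hge] with z hz
      exact ⟨rfl, hz⟩
  · obtain ⟨⟨j, l⟩, hp⟩ : ∃ b, T.pair (i, k) = b := ⟨_, rfl⟩
    obtain ⟨g, g', hg, hg', hge, hge', hA, hB⟩ := T.exists_developments hp hs hφ hxφ
    obtain ⟨γ, hγ⟩ := exists_isEdgeGluing hJ hp
    have := T.eventually_nhds (P := fun i' z => (i' = i ∧ φ (T.cell i' z) = g z) ∨
      (i' = j ∧ φ (T.cell i' z) = g' z)) (T.cell i (sidePoint (T.vert i) k s)) ?_
    · refine ⟨i, g, ?_, ?_⟩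
      · rw [hge.self_of_nhdsWithin hy, g.symm_apply_apply, hT.minkQ_eq (hJ i) hy]
      · filter_upwards [this] with x' hx'
        obtain ⟨i', z, hz, rfl⟩ := T.cell_surjective x'
        rw [hT.minkQ_eq (hJ i') hz]
        rcases hx' i' z hz rfl with ⟨rfl, h⟩ | ⟨rfl, h⟩
        · rw [h, g.symm_apply_apply]
        · rw [h]
          exact neg_le_neg (hγ.minkQ_le (hE _ _ _ _ _ hp hγ) hg hg' hA hB
            ((mem_solidTriangle_iff (T.area_pos i')).1 hz l))
    · intro i' y' hy' h
      rcases T.eq_of_cell_eq_side hp hs hy' h.symm with ⟨rfl, rfl⟩ | ⟨rfl, rfl⟩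
      · filter_upwards [hge] with z hz
        exact Or.inl ⟨rfl, hz⟩
      · filter_upwards [hge'] with z hz
        exact Or.inr ⟨rfl, hz⟩

/-- Adding `‖z‖²` turns the local lower bound of `exists_lower_bound` into an affine function that
touches from below at `z`; a function with such a support is midpoint convex there. -/
theorem midpointConvexAt_of_notMem_vertices (hT : T.IsAdapted τ)
    (hJ : ∀ i, T.IsSuspensionEmbedding τ i (J i)) (hE : T.EdgesConvex J)
    {φ : OpenPartialHomeomorph X E2} (hφ : φ ∈ E.atlas) {z : E2} (hz : z ∈ φ.target)
    (hx : φ.symm z ∉ T.vertices) (v : E2) :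
    MidpointConvexAt (fun z => τ (φ.symm z) + ‖z‖ ^ 2) z v := by
  obtain ⟨i, g, h1, h2⟩ := exists_lower_bound hT hJ hE hx hφ (φ.map_target hz)
  have h3 : ∀ᶠ z' in 𝓝 z, -minkQ (J i (g.symm z')) ≤ τ (φ.symm z') := by
    filter_upwards [(φ.continuousAt_symm hz).eventually h2, φ.open_target.mem_nhds hz] with z' h hz'
    rwa [φ.right_inv hz'] at h
  rw [φ.right_inv hz] at h1
  have t : ∀ σ : ℝ, Tendsto (fun s : ℝ => z + (σ * s) • v) (𝓝[>] 0) (𝓝 z) := by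
    intro σ
    have : Continuous fun s : ℝ => z + (σ * s) • v := by fun_prop
    have := this.tendsto 0
    simp only [mul_zero, zero_smul, add_zero] at this
    exact this.mono_left nhdsWithin_le_nhds
  filter_upwards [(t 1).eventually h3, (t (-1)).eventually h3] with s a1 a2
  have e : ∀ s : ℝ, g.symm (z + s • v) = g.symm z + s • g.symm.linearIsometryEquiv v := by
    intro s; rw [map_add_eq, map_smul]
  rw [e, (hJ i).isDirectEmbedding.minkQ_apply_add] at a1 a2
  rw [LinearIsometryEquiv.norm_map] at a1 a2
  have e1 : z + (1 * s) • v = z + s • v := by rw [one_mul]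
  have e2 : z + (-1 * s) • v = z - s • v := by module
  rw [e1] at a1
  rw [e2] at a2
  have e3 := parallelogram_law_with_norm ℝ z (s • v)
  rw [norm_smul s v, mul_pow, Real.norm_eq_abs, sq_abs] at e3
  simp only [h1]
  linarith

/-- Vertices are isolated, so near `z` only `z` itself can be exceptional, and lines displaced in
the orthogonal direction `rot v` avoid it. -/
theorem midpointConvexAt (hT : T.IsAdapted τ)
    (hJ : ∀ i, T.IsSuspensionEmbedding τ i (J i)) (hE : T.EdgesConvex J)
    {φ : OpenPartialHomeomorph X E2} (hφ : φ ∈ E.atlas) {z : E2} (hz : z ∈ φ.target) (v : E2) :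
    MidpointConvexAt (fun z => τ (φ.symm z) + ‖z‖ ^ 2) z v := by
  rcases eq_or_ne v 0 with rfl | hv
  · exact Eventually.of_forall fun s => by simp only [smul_zero, add_zero, sub_zero]; linarith
  have hcl : IsClosed (T.vertices \ {φ.symm z}) := (T.finite_vertices.subset sdiff_subset).isClosed
  have hz' : φ.symm z ∈ (T.vertices \ {φ.symm z})ᶜ := fun h => h.2 rfl
  have hnear : ∀ᶠ y in 𝓝 z, y ∈ φ.target ∧ φ.symm y ∉ T.vertices \ {φ.symm z} :=
    Filter.Eventually.and (φ.open_target.mem_nhds hz) ((φ.continuousAt_symm hz).eventually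
      (hcl.isOpen_compl.mem_nhds hz'))
  refine MidpointConvexAt.of_parallel (w := rot v) (N := {z}) ?_ ?_ ?_
  · filter_upwards [φ.open_target.mem_nhds hz] with y hy
    exact (hT.continuous.continuousAt.comp (φ.continuousAt_symm hy)).add (by fun_prop)
  · filter_upwards [hnear] with y hy hyz
    refine midpointConvexAt_of_notMem_vertices hT hJ hE hφ hy.1 (fun h => hy.2 ⟨h, fun h' => hyz ?_⟩) v
    exact φ.symm.injOn hy.1 hz h'
  · intro ε hε s h
    have h0 : ε • rot v + s • v = 0 := by
      have : z + ε • rot v + s • v = z := h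
      rw [add_assoc] at this
      simpa using this
    have h1 : inner ℝ (rot v) (ε • rot v + s • v) = ε * ‖v‖ ^ 2 := by
      rw [inner_add_right, real_inner_smul_right, real_inner_smul_right, real_inner_self_eq_norm_sq,
        norm_rot, inner_rot, show det2 v v = 0 by simp [det2]; ring]
      ring
    rw [h0, inner_zero_right] at h1
    have : ‖v‖ ^ 2 ≠ 0 := by positivity
    exact mul_ne_zero hε this h1.symm

/-- Along a geodesic, the function is quadratic on each side of a point. -/
theorem exists_quadratic (hT : T.IsAdapted τ) (hJ : ∀ i, T.IsSuspensionEmbedding τ i (J i))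
    {φ : OpenPartialHomeomorph X E2} (hφ : φ ∈ E.atlas) {c : ℝ → X} {I : Set ℝ}
    (hI : I.OrdConnected) (h0 : 0 ∈ I) {z v : E2}
    (hc : ∀ᶠ s in 𝓝[I] 0, c s ∈ φ.source ∧ φ (c s) = z + s • v) :
    ∃ ε > 0, ∃ A : ℝ, ∀ s ∈ Icc 0 ε, s ∈ I → τ (c s) = τ (c 0) + A * s - ‖v‖ ^ 2 * s ^ 2 := by
  by_cases hpos : ∃ s ∈ I, 0 < s
  swap
  · push Not at hpos
    refine ⟨1, one_pos, 0, fun s hs hsI => ?_⟩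
    obtain rfl : s = 0 := le_antisymm (hpos s hsI) hs.1
    ring
  obtain ⟨r, hr, hr0⟩ := hpos
  obtain ⟨hx0, hφ0⟩ := hc.self_of_nhdsWithin h0
  rw [zero_smul, add_zero] at hφ0
  have hcont : Tendsto c (𝓝[I] 0) (𝓝 (c 0)) := by
    have h1 : Tendsto (fun s : ℝ => φ.symm (z + s • v)) (𝓝[I] 0) (𝓝 (c 0)) := by
      have h2 : ContinuousAt φ.symm (z + (0 : ℝ) • v) := by
        rw [zero_smul, add_zero, ← hφ0]
        exact φ.continuousAt_symm (φ.map_source hx0)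
      have h3 : ContinuousAt (fun s : ℝ => z + s • v) 0 := by fun_prop
      have h4 := (ContinuousAt.comp (f := fun s : ℝ => z + s • v) h2 h3).tendsto
      simp only [Function.comp_def, zero_smul, add_zero] at h4
      rw [← hφ0, φ.left_inv hx0] at h4
      rw [hφ0] at h4
      exact h4.mono_left nhdsWithin_le_nhds
    refine h1.congr' ?_
    filter_upwards [hc] with s hs
    rw [← hs.2, φ.left_inv hs.1]
  -- Near `c 0`, each preimage `y₁` in a triangle is joined to a preimage of `c 0` by a segment of
  -- that triangle on which a single isometry gives the development.
  have hP := T.eventually_nhds (P := fun i y₁ => ∃ y ∈ T.tri i, T.cell i y = c 0 ∧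
    ∃ g : E2 ≃ᵃⁱ[ℝ] E2, ∀ u ∈ segment ℝ y y₁, T.cell i u ∈ φ.source ∧ φ (T.cell i u) = g u)
    (c 0) ?_
  · obtain ⟨δ, hδ, hδ'⟩ := Metric.mem_nhdsWithin_iff.1 (hc.and (hcont.eventually hP))
    set s₁ := min r (δ / 2) with hs₁
    have hs₁0 : 0 < s₁ := lt_min hr0 (by linarith)
    have hmem : ∀ s ∈ Icc 0 s₁, s ∈ I ∧ s ∈ Metric.ball (0 : ℝ) δ := by
      intro s hs
      refine ⟨hI.out h0 hr ⟨hs.1, hs.2.trans (min_le_left _ _)⟩, ?_⟩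
      rw [Metric.mem_ball, dist_zero_right, Real.norm_eq_abs, abs_of_nonneg hs.1]
      linarith [hs.2, min_le_right r (δ / 2)]
    have hall : ∀ s ∈ Icc 0 s₁, _ := fun s hs => hδ' ⟨(hmem s hs).2, (hmem s hs).1⟩
    -- The triangle is chosen from the single point `c s₁`. The segment from `y` to `y₁` in it
    -- develops onto the same straight segment as `c` on `[0, s₁]`, so this whole piece of the
    -- geodesic lies in that triangle.
    obtain ⟨i, y₁, hy₁, hcy₁⟩ := T.cell_surjective (c s₁)
    have m1 : s₁ ∈ Icc 0 s₁ := ⟨hs₁0.le, le_rfl⟩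
    obtain ⟨y, hy, hcy, g, hg⟩ := (hall s₁ m1).2 i y₁ hy₁ hcy₁
    have gy : g y = z := by rw [← (hg y (left_mem_segment ℝ _ _)).2, hcy, hφ0]
    have gy₁ : g y₁ = z + s₁ • v := by
      rw [← (hg y₁ (right_mem_segment ℝ _ _)).2, hcy₁, (hall s₁ m1).1.2]
    have hlin : g.linearIsometryEquiv (y₁ - y) = s₁ • v := by
      have := map_add_eq g y (y₁ - y)
      rw [add_sub_cancel, gy, gy₁] at this
      exact (add_left_cancel this).symm
    have hnorm : ‖y₁ - y‖ = s₁ * ‖v‖ := by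
      rw [← g.linearIsometryEquiv.norm_map, hlin, norm_smul, Real.norm_eq_abs, abs_of_pos hs₁0]
    have main : ∀ s ∈ Icc 0 s₁, τ (c s) = -minkQ (J i (y + (s / s₁) • (y₁ - y))) := by
      intro s hs
      have hseg : y + (s / s₁) • (y₁ - y) ∈ segment ℝ y y₁ := by
        rw [segment_eq_image']
        exact ⟨s / s₁, ⟨div_nonneg hs.1 hs₁0.le, (div_le_one hs₁0).2 hs.2⟩, rfl⟩
      have e1 : φ (T.cell i (y + (s / s₁) • (y₁ - y))) = φ (c s) := by
        rw [(hg _ hseg).2, (hall s hs).1.2, map_add_eq, map_smul, hlin, gy, smul_smul,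
          div_mul_cancel₀ _ hs₁0.ne']
      have e2 := φ.injOn (hg _ hseg).1 (hall s hs).1.1 e1
      rw [← e2, hT.minkQ_eq (hJ i) ((convex_solidTriangle _).segment_subset hy hy₁ hseg)]
    refine ⟨s₁, hs₁0, -(2 / s₁ * minkB (J i y) ((J i).linear (y₁ - y))), fun s hs _ => ?_⟩
    rw [main s hs, (hJ i).isDirectEmbedding.minkQ_apply_add, ← hcy, hT.minkQ_eq (hJ i) hy, hnorm]
    field_simp
    ring
  · rintro i y hy hcy
    rw [← hcy] at hx0
    obtain ⟨g, -, hg⟩ := T.cell_isometric i y hy φ hφ hx0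
    have h1 : ∀ᶠ u in 𝓝[T.tri i] y, T.cell i u ∈ φ.source :=
      (T.cell_continuous i y hy).eventually (φ.open_source.mem_nhds hx0)
    obtain ⟨δ, hδ, hδ'⟩ := Metric.mem_nhdsWithin_iff.1 (h1.and hg)
    filter_upwards [inter_mem (mem_nhdsWithin_of_mem_nhds (Metric.ball_mem_nhds y hδ))
      self_mem_nhdsWithin] with y₁ hy₁
    refine ⟨y, hy, hcy, g, fun u hu => hδ' ⟨?_, ?_⟩⟩
    · exact (convex_ball y δ).segment_subset (Metric.mem_ball_self hδ) hy₁.1 hu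
    · exact (convex_solidTriangle _).segment_subset hy hy₁.2 hu

/-- On both sides of a point `τ ∘ c` has the quadratic coefficient `-‖v‖²`, which the added squared
norm cancels. What remains of midpoint convexity is the inequality between the one-sided slopes. -/
theorem EdgesConvex.isQConvex (hT : T.IsAdapted τ) (hJ : ∀ i, T.IsSuspensionEmbedding τ i (J i))
    (hE : T.EdgesConvex J) : E.IsQConvex τ := by
  intro I c hI hc
  refine QConvexOn.of_quadratic fun t ht => ?_
  obtain ⟨φ, hφ, p, v, hct, hev⟩ := hc t ht
  -- The left side is handled by reversing the parameter, so `-B` is the left derivative below.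
  have hone : ∀ σ : ℝ, (σ = 1 ∨ σ = -1) → ∃ ε > 0, ∃ A : ℝ, ∀ s ∈ Icc 0 ε, t + σ * s ∈ I →
      τ (c (t + σ * s)) = τ (c t) + A * s - ‖v‖ ^ 2 * s ^ 2 := by
    intro σ hσ
    have hord : ((fun s : ℝ => t + σ * s) ⁻¹' I).OrdConnected := by
      refine ⟨fun a ha b hb s hs => ?_⟩
      rcases hσ with rfl | rfl
      · exact hI.out ha hb ⟨by linarith [hs.1], by linarith [hs.2]⟩
      · exact hI.out hb ha ⟨by linarith [hs.2], by linarith [hs.1]⟩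
    have htend : Tendsto (fun s : ℝ => t + σ * s) (𝓝[(fun s : ℝ => t + σ * s) ⁻¹' I] 0) (𝓝[I] t) := by
      have h1 : Continuous fun s : ℝ => t + σ * s := by fun_prop
      have h2 := h1.continuousAt.continuousWithinAt (s := (fun s : ℝ => t + σ * s) ⁻¹' I) (x := 0)
      have h3 := h2.tendsto_nhdsWithin (t := I) (fun s hs => hs)
      simpa using h3
    obtain ⟨ε, hε, A, h⟩ := exists_quadratic hT hJ hφ (c := fun s => c (t + σ * s))
      (z := p + t • v) (v := σ • v) hord (by simpa using ht) (by
        filter_upwards [htend.eventually hev] with s hs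
        refine ⟨hs.1, ?_⟩
        rw [hs.2]; module)
    refine ⟨ε, hε, A, fun s hs hsI => ?_⟩
    have := h s hs hsI
    rw [mul_zero, add_zero, norm_smul] at this
    have hσ' : ‖σ‖ = 1 := by rcases hσ with rfl | rfl <;> simp
    rwa [hσ', one_mul] at this
  obtain ⟨ε₁, hε₁, A, hA⟩ := hone 1 (Or.inl rfl)
  obtain ⟨ε₂, hε₂, B, hB⟩ := hone (-1) (Or.inr rfl)
  have hA' : ∀ s ∈ Icc 0 (min ε₁ ε₂), t + s ∈ I →
      τ (c (t + s)) = τ (c t) + A * s - ‖v‖ ^ 2 * s ^ 2 := fun s hs hsI => by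
    have := hA s ⟨hs.1, hs.2.trans (min_le_left _ _)⟩ (by rwa [one_mul])
    rwa [one_mul] at this
  have hB' : ∀ s ∈ Icc 0 (min ε₁ ε₂), t - s ∈ I →
      τ (c (t - s)) = τ (c t) - -B * s - ‖v‖ ^ 2 * s ^ 2 := fun s hs hsI => by
    have := hB s ⟨hs.1, hs.2.trans (min_le_right _ _)⟩ (by rwa [neg_one_mul, ← sub_eq_add_neg])
    rw [neg_one_mul, ← sub_eq_add_neg] at this
    rw [this]; ring
  refine ⟨min ε₁ ε₂, lt_min hε₁ hε₂, A, -B, ‖v‖ ^ 2, hA', hB', fun hint => ?_⟩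
  have hG := midpointConvexAt hT hJ hE hφ (φ.map_source hct) v
  have hev' : ∀ᶠ s in 𝓝 t, s ∈ I ∧ c s ∈ φ.source ∧ φ (c s) = p + s • v := by
    have h1 : 𝓝[I] t = 𝓝 t := nhdsWithin_eq_nhds.2 (mem_interior_iff_mem_nhds.1 hint)
    rw [h1] at hev
    filter_upwards [hev, mem_interior_iff_mem_nhds.1 hint] with s h1 h2
    exact ⟨h2, h1⟩
  have ht1 : Tendsto (fun s : ℝ => t + s) (𝓝[>] 0) (𝓝 t) := by
    have : Continuous fun s : ℝ => t + s := by fun_prop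
    have := this.tendsto 0
    rw [add_zero] at this
    exact this.mono_left nhdsWithin_le_nhds
  have ht2 : Tendsto (fun s : ℝ => t - s) (𝓝[>] 0) (𝓝 t) := by
    have : Continuous fun s : ℝ => t - s := by fun_prop
    have := this.tendsto 0
    rw [sub_zero] at this
    exact this.mono_left nhdsWithin_le_nhds
  obtain ⟨s, ⟨⟨hs, h1⟩, h2⟩, hs0⟩ := (((hG.and (ht1.eventually hev')).and (ht2.eventually hev')).and
    (Ioo_mem_nhdsGT (lt_min hε₁ hε₂))).exists
  have hφt := (hev'.self_of_nhds).2.2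
  have e1 : φ (c t) + s • v = φ (c (t + s)) := by rw [hφt, h1.2.2]; module
  have e2 : φ (c t) - s • v = φ (c (t - s)) := by rw [hφt, h2.2.2]; module
  have e3 := parallelogram_law_with_norm ℝ (φ (c t)) (s • v)
  rw [norm_smul s v, mul_pow, Real.norm_eq_abs, sq_abs] at e3
  simp only [e1, e2, φ.left_inv hct, φ.left_inv h1.2.1, φ.left_inv h2.2.1] at hs e3
  rw [hA' s (Ioo_subset_Icc_self hs0) h1.1, hB' s (Ioo_subset_Icc_self hs0) h2.1] at hs
  have : 0 ≤ (A - -B) * s := by linarith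
  have := nonneg_of_mul_nonneg_left this hs0.1
  linarith

end GeodesicTriangulation

/-! ## Q-convexity implies that the edges are convex -/

theorem sideForm_add_smul_rot (v : Fin 3 → E2) (k : Fin 3) (x : E2) (t : ℝ) :
    sideForm v k (x + t • rot (v (k + 1) - v k)) =
      sideForm v k x + t * ‖v (k + 1) - v k‖ ^ 2 := by
  simp [sideForm, det2, norm_sq_E2]; ring

theorem IsEdgeGluing.map_lineMap {J J' : E2 →ᵃ[ℝ] Mink} {A B A' B' : E2} {γ : Mink ≃ₗ[ℝ] Mink}
    (h : IsEdgeGluing J J' A B A' B' γ) (s : ℝ) :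
    γ (J (AffineMap.lineMap A B s)) = J' (AffineMap.lineMap A' B' (1 - s)) := by
  rw [AffineMap.lineMap_apply_one_sub, AffineMap.apply_lineMap, AffineMap.apply_lineMap,
    AffineMap.lineMap_apply_module, AffineMap.lineMap_apply_module, map_add, map_smul, map_smul,
    h.map_left, h.map_right]

namespace GeodesicTriangulation

variable {X : Type*} [TopologicalSpace X] {E : EuclideanConeSurface X}
  {T : GeodesicTriangulation E} {τ : X → ℝ} {J : T.ι → E2 →ᵃ[ℝ] Mink}

theorem tendsto_inward (T : GeodesicTriangulation E) (i : T.ι) (k : Fin 3) {s : ℝ}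
    (hs : s ∈ Ioo (0 : ℝ) 1) :
    Tendsto (fun t : ℝ => sidePoint (T.vert i) k s + t • rot (T.vert i (k + 1) - T.vert i k))
      (𝓝[≥] 0) (𝓝[T.tri i] sidePoint (T.vert i) k s) := by
  have hc : Continuous fun t : ℝ =>
    sidePoint (T.vert i) k s + t • rot (T.vert i (k + 1) - T.vert i k) := by fun_prop
  have ht := hc.tendsto 0
  rw [zero_smul, add_zero] at ht
  refine tendsto_nhdsWithin_iff.2 ⟨ht.mono_left nhdsWithin_le_nhds, ?_⟩
  have pos : ∀ l, 0 < sideForm (T.vert i) l (sidePoint (T.vert i) k s) →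
      ∀ᶠ t in 𝓝[≥] (0 : ℝ), 0 < sideForm (T.vert i) l
        (sidePoint (T.vert i) k s + t • rot (T.vert i (k + 1) - T.vert i k)) := by
    intro l hl
    have h := (((continuous_sideForm (T.vert i) l).comp hc).tendsto 0).eventually
      (lt_mem_nhds (by simpa using hl))
    exact nhdsWithin_le_nhds h
  have h1 := pos (k + 1) (by
    rw [sideForm_succ_sidePoint]; exact mul_pos (by linarith [hs.2]) (T.area_pos i))
  have h2 := pos (k + 2) (by
    rw [sideForm_pred_sidePoint]; exact mul_pos hs.1 (T.area_pos i))
  filter_upwards [h1, h2, self_mem_nhdsWithin] with t h1 h2 ht0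
  refine (mem_solidTriangle_iff (T.area_pos i)).2 fun l => ?_
  rcases Fin3.cases_add k l with rfl | rfl | rfl
  · rw [sideForm_add_smul_rot, sideForm_sidePoint, zero_add]
    exact mul_nonneg ht0 (sq_nonneg _)
  · exact h1.le
  · exact h2.le

/-- The limit of the derivative of a function that is quadratic on an open interval. -/
theorem eq_of_tendsto_deriv {f : ℝ → ℝ} {U : Set ℝ} {F : Filter ℝ} [F.NeBot] (hU : IsOpen U)
    (hF : F ≤ 𝓝 0) (hUF : U ∈ F) {a b d l : ℝ} (hf : ∀ s ∈ U, f s = a + b * s + d * s ^ 2)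
    (hl : Tendsto (deriv f) F (𝓝 l)) : l = b := by
  have hd : ∀ s ∈ U, deriv f s = b + d * (2 * s) := by
    intro s hs
    have e : f =ᶠ[𝓝 s] fun s => a + b * s + d * s ^ 2 := by
      filter_upwards [hU.mem_nhds hs] with r hr using hf r hr
    rw [e.deriv_eq]
    have := (((hasDerivAt_id s).const_mul b).const_add a).add (((hasDerivAt_id s).pow 2).const_mul d)
    refine (this.congr_deriv ?_).deriv
    simp
  have h1 : Tendsto (fun s : ℝ => b + d * (2 * s)) F (𝓝 b) := by
    have : Continuous fun s : ℝ => b + d * (2 * s) := by fun_prop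
    have := this.tendsto 0
    simp only [mul_zero, add_zero] at this
    exact this.mono_left hF
  refine tendsto_nhds_unique hl (h1.congr' ?_)
  filter_upwards [hUF] with s hs using (hd s hs).symm

/-- Test Q-convexity on the geodesic that crosses the edge orthogonally at its midpoint, from the
first triangle to the second. Its one-sided slopes are `2B(p, w)` and `-2B(p, w')`, so their order
says `B(p, u) ≤ 0`. -/
theorem edgesConvex_of_isQConvex (hT : T.IsAdapted τ)
    (hJ : ∀ i, T.IsSuspensionEmbedding τ i (J i)) (hq : E.IsQConvex τ) : T.EdgesConvex J := by
  intro i j k l γ hp hγ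
  have hs : (1 / 2 : ℝ) ∈ Ioo (0 : ℝ) 1 := by norm_num
  have hs' : (1 - 1 / 2 : ℝ) ∈ Ioo (0 : ℝ) 1 := by norm_num
  obtain ⟨φ, hφ, hx⟩ := T.exists_chart_of_notMem_vertices
    (T.cell_sidePoint_notMem_vertices (i := i) (k := k) hs)
  obtain ⟨g, g', hg, hg', hge, hge', hA, hB⟩ := T.exists_developments hp hs hφ hx
  have hx' : T.cell j (sidePoint (T.vert j) l (1 - 1 / 2)) ∈ φ.source := by
    rwa [← T.cell_sidePoint hp (Ioo_subset_Icc_self hs)]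
  set m := sidePoint (T.vert i) k (1 / 2) with hm
  set m' := sidePoint (T.vert j) l (1 - 1 / 2) with hm'
  set A := T.vert i k
  set B := T.vert i (k + 1)
  set A' := T.vert j l
  set B' := T.vert j (l + 1)
  have hmem : m ∈ T.tri i := T.sidePoint_mem_tri i (Ioo_subset_Icc_self hs)
  have hmem' : m' ∈ T.tri j := T.sidePoint_mem_tri j (Ioo_subset_Icc_self hs')
  have good : ∀ᶠ t in 𝓝[≥] (0 : ℝ), m + t • rot (B - A) ∈ T.tri i ∧
      T.cell i (m + t • rot (B - A)) ∈ φ.source ∧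
      φ (T.cell i (m + t • rot (B - A))) = g (m + t • rot (B - A)) :=
    (T.tendsto_inward i k hs).eventually (Filter.Eventually.and self_mem_nhdsWithin
      (((T.cell_continuous i m hmem).eventually (φ.open_source.mem_nhds hx)).and hge))
  have good' : ∀ᶠ t in 𝓝[≥] (0 : ℝ), m' + t • rot (B' - A') ∈ T.tri j ∧
      T.cell j (m' + t • rot (B' - A')) ∈ φ.source ∧
      φ (T.cell j (m' + t • rot (B' - A'))) = g' (m' + t • rot (B' - A')) :=
    (T.tendsto_inward j l hs').eventually (Filter.Eventually.and self_mem_nhdsWithin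
      (((T.cell_continuous j m' hmem').eventually (φ.open_source.mem_nhds hx')).and hge'))
  obtain ⟨δ, hδ, hδ'⟩ := Metric.mem_nhdsWithin_iff.1 (good.and good')
  have hall : ∀ t ∈ Ico 0 δ, _ := fun t (ht : t ∈ Ico 0 δ) => hδ' ⟨by
    rw [Metric.mem_ball, dist_zero_right, Real.norm_eq_abs, abs_of_nonneg ht.1]; exact ht.2, ht.1⟩
  set w := g.linearIsometryEquiv (rot (B - A)) with hw
  have em' : m' = A' + (1 / 2 : ℝ) • (B' - A') := by
    rw [hm', sidePoint_eq]; module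
  have em : m = B - (1 / 2 : ℝ) • (B - A) := by
    rw [hm, sidePoint_eq]; module
  have left : ∀ t ∈ Ico 0 δ, φ.symm (g m - (-t) • w) = T.cell i (m + t • rot (B - A)) ∧
      g m - (-t) • w ∈ φ.target := by
    intro t ht
    obtain ⟨⟨-, h2, h3⟩, -⟩ := hall t ht
    have e : g m - (-t) • w = φ (T.cell i (m + t • rot (B - A))) := by
      rw [h3, map_add_eq, map_smul, ← hw]; module
    rw [e]
    exact ⟨φ.left_inv h2, φ.map_source h2⟩
  have right : ∀ t ∈ Ico 0 δ, φ.symm (g m - t • w) = T.cell j (m' + t • rot (B' - A')) ∧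
      g m - t • w ∈ φ.target := by
    intro t ht
    obtain ⟨-, ⟨-, h2, h3⟩⟩ := hall t ht
    have e : g m - t • w = φ (T.cell j (m' + t • rot (B' - A'))) := by
      rw [h3, em', edge_map_frame hg hg' hA hB, ← em]
      have : m - t • rot (B - A) = m + (-t) • rot (B - A) := by module
      rw [this, map_add_eq, map_smul, ← hw]; module
    rw [e]
    exact ⟨φ.left_inv h2, φ.map_source h2⟩
  have htarget : ∀ s ∈ Ioo (-δ) δ, g m - s • w ∈ φ.target := by
    intro s hs
    rcases le_total 0 s with h | h
    · exact (right s ⟨h, hs.2⟩).2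
    · have := (left (-s) ⟨by linarith, by linarith [hs.1]⟩).2
      rwa [neg_neg] at this
  have hgeo : E.IsGeodesicOn (fun s => φ.symm (g m - s • w)) (Ioo (-δ) δ) := by
    intro t ht
    refine ⟨φ, hφ, g m, -w, φ.map_target (htarget t ht), ?_⟩
    filter_upwards [self_mem_nhdsWithin] with s hs
    refine ⟨φ.map_target (htarget s hs), ?_⟩
    rw [φ.right_inv (htarget s hs)]; module
  obtain ⟨-, -, hlim⟩ := hq _ _ ordConnected_Ioo hgeo
  obtain ⟨a, b, ha, hb, hab⟩ := hlim 0 (by rw [interior_Ioo]; exact ⟨by linarith, hδ⟩)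
  have ea := eq_of_tendsto_deriv (U := Ioo (-δ) 0) isOpen_Ioo nhdsWithin_le_nhds
    (Ioo_mem_nhdsLT (by linarith)) (a := -minkQ (J i m))
    (b := 2 * minkB (J i m) ((J i).linear (rot (B - A)))) (d := -‖rot (B - A)‖ ^ 2) (fun s hs => by
      have hs' : -s ∈ Ico 0 δ := ⟨by linarith [hs.2], by linarith [hs.1]⟩
      have h1 := (left (-s) hs').1
      rw [neg_neg] at h1
      rw [Function.comp_apply, h1, hT.minkQ_eq (hJ i) (hall (-s) hs').1.1,
        (hJ i).isDirectEmbedding.minkQ_apply_add]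
      ring) ha
  have eb := eq_of_tendsto_deriv (U := Ioo 0 δ) isOpen_Ioo nhdsWithin_le_nhds
    (Ioo_mem_nhdsGT hδ) (a := -minkQ (J j m'))
    (b := -(2 * minkB (J j m') ((J j).linear (rot (B' - A'))))) (d := -‖rot (B' - A')‖ ^ 2)
    (fun s hs => by
      have hs' : s ∈ Ico 0 δ := ⟨hs.1.le, hs.2⟩
      rw [Function.comp_apply, (right s hs').1, hT.minkQ_eq (hJ j) (hall s hs').2.1,
        (hJ j).isDirectEmbedding.minkQ_apply_add]
      ring) hb
  rw [ea, eb] at hab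
  have h1 : J j m' = γ (J i m) := (hγ.map_lineMap (1 / 2)).symm
  have h2 : minkB (J j m') ((J j).linear (rot (B' - A'))) =
      minkB (J i m) (γ.symm ((J j).linear (rot (B' - A')))) := by
    rw [h1, ← SO0.minkB_map (SO0.symm_mem hγ.mem), LinearEquiv.symm_apply_apply]
  rw [← hγ.minkB_right_nonpos_iff]
  have h3 : minkB (J i m) (conormalSum (J i) (J j) A B A' B' γ) =
      minkB (J i B) (conormalSum (J i) (J j) A B A' B' γ) := by
    have : m - B = -(1 / 2 : ℝ) • (B - A) := by rw [em]; module
    rw [affine_apply_eq (J i) m B, this, map_smul, minkB_add_left, minkB_smul_left,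
      hγ.minkB_edge_conormalSum, mul_zero, add_zero]
  rw [← h3, conormalSum, minkB_add_right, ← h2]
  linarith

end GeodesicTriangulation

/-! ## The suspension -/

namespace GeodesicTriangulation

variable {X : Type*} [TopologicalSpace X] {E : EuclideanConeSurface X}
  {T : GeodesicTriangulation E} {τ : X → ℝ} {J : T.ι → E2 →ᵃ[ℝ] Mink}

/-- The point of height `t` on the ray over a point of a triangle. -/
def conePoint (T : GeodesicTriangulation E) (J : T.ι → E2 →ᵃ[ℝ] Mink) (i : T.ι) {x : E2}
    (hx : x ∈ T.tri i) {t : ℝ} (ht : 0 < t) : T.cone J i :=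
  ⟨t • J i x, t, ht, x, hx, rfl⟩

theorem exists_conePoint {i : T.ι} (p : T.cone J i) :
    ∃ x, ∃ hx : x ∈ T.tri i, ∃ t, ∃ ht : 0 < t, p = T.conePoint J i hx ht := by
  obtain ⟨p, t, ht, x, hx, rfl⟩ := p
  exact ⟨x, hx, t, ht, rfl⟩

theorem exists_toSusp (m : T.Suspension J) : ∃ i, ∃ p : T.cone J i, T.toSusp J i p = m := by
  obtain ⟨⟨i, p⟩, rfl⟩ := Quot.exists_rep m
  exact ⟨i, p, rfl⟩

theorem continuous_toSusp (i : T.ι) : Continuous (T.toSusp J i) :=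
  continuous_quot_mk.comp continuous_sigmaMk

section

variable (hJ : ∀ i, T.IsSuspensionEmbedding τ i (J i))
include hJ

theorem heightForm_conePoint {i : T.ι} {x : E2} (hx : x ∈ T.tri i) {t : ℝ} (ht : 0 < t) :
    heightForm (J i) (T.conePoint J i hx ht : T.cone J i) = t := by
  change heightForm (J i) (t • J i x) = t
  rw [heightForm_smul, (hJ i).isDirectEmbedding.heightForm_apply ((hJ i).2.1 x hx), mul_one]

theorem planePos_conePoint {i : T.ι} {x : E2} (hx : x ∈ T.tri i) {t : ℝ} (ht : 0 < t) :
    planePos (J i) ((heightForm (J i) (T.conePoint J i hx ht : T.cone J i))⁻¹ •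
      (T.conePoint J i hx ht : T.cone J i)) = x := by
  rw [heightForm_conePoint hJ]
  change planePos (J i) (t⁻¹ • t • J i x) = x
  rw [smul_smul, inv_mul_cancel₀ ht.ne', one_smul, (hJ i).isDirectEmbedding.planePos_apply]

/-- Glued points are over the same point of the surface, at the same height. -/
theorem coneGlue_spec {a b : (i : T.ι) × T.cone J i} (h : T.coneGlue J a b) :
    ∃ (k l : Fin 3) (s : ℝ) (hs : s ∈ Icc (0 : ℝ) 1) (hs' : 1 - s ∈ Icc (0 : ℝ) 1) (t : ℝ)
      (ht : 0 < t), T.pair (a.1, k) = (b.1, l) ∧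
      a.2 = T.conePoint J a.1 (T.sidePoint_mem_tri a.1 (k := k) hs) ht ∧
      b.2 = T.conePoint J b.1 (T.sidePoint_mem_tri b.1 (k := l) hs') ht := by
  obtain ⟨k, l, hp, ⟨t, ht, s, hs, ha⟩, γ, hγ, h1, h2, hb⟩ := h
  refine ⟨k, l, s, hs, ⟨by linarith [hs.2], by linarith [hs.1]⟩, t, ht, hp, Subtype.ext ha,
    Subtype.ext ?_⟩
  rw [hb, ha, map_smul]
  exact congrArg (t • ·) ((isEdgeGluing_of_mem hJ hγ h1 h2).map_lineMap s)

theorem toSusp_eq_of_side {i j : T.ι} {k l : Fin 3} (hp : T.pair (i, k) = (j, l)) {s : ℝ}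
    (hs : s ∈ Icc (0 : ℝ) 1) (hs' : 1 - s ∈ Icc (0 : ℝ) 1) {t : ℝ} (ht : 0 < t) :
    T.toSusp J i (T.conePoint J i (T.sidePoint_mem_tri i (k := k) hs) ht) =
      T.toSusp J j (T.conePoint J j (T.sidePoint_mem_tri j (k := l) hs') ht) := by
  obtain ⟨γ, hγ⟩ := exists_isEdgeGluing hJ hp
  refine Quot.sound ⟨k, l, hp, ⟨t, ht, s, hs, rfl⟩, γ, hγ.mem, hγ.map_left, hγ.map_right, ?_⟩
  change t • J j _ = γ (t • J i _)
  rw [map_smul]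
  exact congrArg (t • ·) (hγ.map_lineMap s).symm

/-- The height function of the suspension, equal to `1` on the embedded surface. -/
def height : T.Suspension J → ℝ :=
  Quot.lift (fun a => heightForm (J a.1) a.2) fun a b h => by
    obtain ⟨k, l, s, hs, hs', t, ht, -, ha, hb⟩ := coneGlue_spec hJ h
    rw [ha, hb, heightForm_conePoint hJ, heightForm_conePoint hJ]

/-- The projection of the suspension to the surface. -/
def proj : T.Suspension J → X :=
  Quot.lift (fun a => T.cell a.1 (planePos (J a.1) ((heightForm (J a.1) a.2)⁻¹ • a.2)))
    fun a b h => by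
      obtain ⟨k, l, s, hs, hs', t, ht, hp, ha, hb⟩ := coneGlue_spec hJ h
      rw [ha, hb, planePos_conePoint hJ, planePos_conePoint hJ, T.cell_sidePoint hp hs]

theorem height_toSusp (i : T.ι) (p : T.cone J i) :
    height hJ (T.toSusp J i p) = heightForm (J i) p := rfl

theorem height_conePoint {i : T.ι} {x : E2} (hx : x ∈ T.tri i) {t : ℝ} (ht : 0 < t) :
    height hJ (T.toSusp J i (T.conePoint J i hx ht)) = t := heightForm_conePoint hJ hx ht

theorem proj_conePoint {i : T.ι} {x : E2} (hx : x ∈ T.tri i) {t : ℝ} (ht : 0 < t) :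
    proj hJ (T.toSusp J i (T.conePoint J i hx ht)) = T.cell i x :=
  congrArg (T.cell i) (planePos_conePoint hJ hx ht)

theorem height_pos (m : T.Suspension J) : 0 < height hJ m := by
  obtain ⟨i, p, rfl⟩ := exists_toSusp m
  obtain ⟨x, hx, t, ht, rfl⟩ := exists_conePoint p
  rwa [height_conePoint]

theorem continuous_height : Continuous (height hJ) := by
  refine continuous_quot_lift _ (continuous_sigma fun i => ?_)
  exact (continuous_heightForm (J i)).comp continuous_subtype_val

theorem continuous_conePos (i : T.ι) : Continuous fun p : T.cone J i =>
    planePos (J i) ((heightForm (J i) p)⁻¹ • (p : Mink)) := by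
  refine (continuous_planePos (J i)).comp (Continuous.smul (Continuous.inv₀
    ((continuous_heightForm (J i)).comp continuous_subtype_val) fun p => ?_)
    continuous_subtype_val)
  obtain ⟨x, hx, t, ht, rfl⟩ := exists_conePoint p
  rw [Function.comp_apply, heightForm_conePoint hJ]
  exact ht.ne'

theorem continuous_proj : Continuous (proj hJ) := by
  refine continuous_quot_lift _ (continuous_sigma fun i => ?_)
  refine (T.cell_continuous i).comp_continuous (continuous_conePos hJ i) fun p => ?_
  obtain ⟨x, hx, t, ht, rfl⟩ := exists_conePoint p
  rw [planePos_conePoint hJ]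
  exact hx

/-- `height` and `proj` descend to the quotient, which gives necessity. For sufficiency, each step
of a chain of side gluings lifts to a gluing of faces at the same height. -/
theorem toSusp_conePoint_eq_iff {i j : T.ι} {x y : E2} (hx : x ∈ T.tri i) (hy : y ∈ T.tri j)
    {t t' : ℝ} (ht : 0 < t) (ht' : 0 < t') :
    T.toSusp J i (T.conePoint J i hx ht) = T.toSusp J j (T.conePoint J j hy ht') ↔
      t = t' ∧ T.cell i x = T.cell j y := by
  constructor
  · intro h
    refine ⟨?_, ?_⟩
    · have := congrArg (height hJ) h
      rwa [height_conePoint, height_conePoint] at this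
    · have := congrArg (proj hJ) h
      rwa [proj_conePoint, proj_conePoint] at this
  · rintro ⟨rfl, h⟩
    have := T.mem_iff_of_cell_eq (S := {a | ∃ ha : a.2 ∈ T.tri a.1,
      T.toSusp J i (T.conePoint J i hx ht) = T.toSusp J a.1 (T.conePoint J a.1 ha ht)}) ?_ hx hy h
      ⟨hx, rfl⟩
    · exact this.2
    · rintro ⟨a1, a2⟩ ⟨b1, b2⟩ ⟨k, l, s, hs, hp, ha, hb⟩ ⟨h1, h2⟩
      simp only at ha hb hp
      subst ha hb
      have hs' : 1 - s ∈ Icc (0 : ℝ) 1 := ⟨by linarith [hs.2], by linarith [hs.1]⟩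
      exact ⟨T.sidePoint_mem_tri b1 hs', h2.trans (toSusp_eq_of_side hJ hp hs hs' ht)⟩

theorem eq_of_height_eq_of_proj_eq {m m' : T.Suspension J} (h1 : height hJ m = height hJ m')
    (h2 : proj hJ m = proj hJ m') : m = m' := by
  obtain ⟨i, p, rfl⟩ := exists_toSusp m
  obtain ⟨j, q, rfl⟩ := exists_toSusp m'
  obtain ⟨x, hx, t, ht, rfl⟩ := exists_conePoint p
  obtain ⟨y, hy, t', ht', rfl⟩ := exists_conePoint q
  rw [height_conePoint, height_conePoint] at h1
  rw [proj_conePoint, proj_conePoint] at h2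
  exact (toSusp_conePoint_eq_iff hJ hx hy ht ht').2 ⟨h1, h2⟩

/-- Parametrise the cone by triangle and height. Followed by the injective continuous map (`proj`,
`height`), the parametrisation becomes `cell × id`, which is proper; so it is proper into the
suspension, hence closed, and closedness descends along the surjection `P`. -/
theorem isClosedMap_toSusp [T2Space X] (i : T.ι) : IsClosedMap (T.toSusp J i) := by
  let P : T.tri i × Ioi (0 : ℝ) → T.cone J i := fun a => T.conePoint J i a.1.2 a.2.2
  have hP : Continuous P := by
    refine Continuous.subtype_mk ?_ _
    have : Continuous (J i) := (J i).continuous_of_finiteDimensional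
    fun_prop
  have hPs : Function.Surjective P := by
    intro p
    obtain ⟨x, hx, t, ht, rfl⟩ := exists_conePoint p
    exact ⟨(⟨x, hx⟩, ⟨t, ht⟩), rfl⟩
  let Ψ : T.Suspension J → X × Ioi (0 : ℝ) := fun m => (proj hJ m, ⟨height hJ m, height_pos hJ m⟩)
  have hΨ : Continuous Ψ :=
    (continuous_proj hJ).prodMk ((continuous_height hJ).subtype_mk _)
  have hcomp : Ψ ∘ (T.toSusp J i ∘ P) = Prod.map ((T.tri i).domRestrict (T.cell i)) id := by
    ext1 ⟨⟨x, hx⟩, ⟨t, ht⟩⟩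
    exact Prod.ext (proj_conePoint hJ hx ht) (Subtype.ext (height_conePoint hJ hx ht))
  have hprop : IsProperMap (T.toSusp J i ∘ P) := by
    refine isProperMap_of_comp_of_inj ((continuous_toSusp i).comp hP) hΨ ?_ ?_
    · rw [hcomp]
      exact (T.continuous_domRestrict_cell i).isProperMap.prodMap isProperMap_id
    · intro m m' h
      rw [Prod.ext_iff] at h
      exact eq_of_height_eq_of_proj_eq hJ (congrArg Subtype.val h.2) h.1
  exact hprop.isClosedMap.of_comp_surjective hPs hP

/-- A property of the points of the cones that holds near the preimages of a point `m` of the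
suspension holds at the preimages of the points near `m`. -/
theorem eventually_nhds_susp [T2Space X] {P : (i : T.ι) → T.cone J i → Prop} (m : T.Suspension J)
    (h : ∀ i p, T.toSusp J i p = m → ∀ᶠ q in 𝓝 p, P i q) :
    ∀ᶠ m' in 𝓝 m, ∀ i p, T.toSusp J i p = m' → P i p := by
  have := T.finite
  rw [eventually_all]
  intro i
  exact (isClosedMap_toSusp hJ i).eventually_nhds_fiber (p := P i) m (h i)

/-! ## The causal future of the embedded surface -/

theorem mem_range_embed_iff (m : T.Suspension J) : m ∈ range (T.embed J) ↔ height hJ m = 1 := by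
  have key : ∀ x, height hJ (T.embed J x) = 1 ∧ proj hJ (T.embed J x) = x := by
    intro x
    have h := (T.cell_surjective x).choose_spec.choose_spec
    have e : T.embed J x = T.toSusp J _ (T.conePoint J _ h.1 one_pos) := by
      rw [embed]
      congr 1
      exact Subtype.ext (one_smul ℝ _).symm
    rw [e]
    exact ⟨height_conePoint hJ h.1 one_pos, (proj_conePoint hJ h.1 one_pos).trans h.2⟩
  constructor
  · rintro ⟨x, rfl⟩
    exact (key x).1
  · intro h
    exact ⟨proj hJ m, eq_of_height_eq_of_proj_eq hJ ((key _).1.trans h.symm) (key _).2⟩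

/-- Each elementary segment lies in one cone, where the height is a linear form positive on future
causal vectors because the normal is future timelike. -/
theorem height_le_of_localCausalLE {U : Set (T.Suspension J)} {m m' : T.Suspension J}
    (h : T.LocalCausalLE J U m m') : height hJ m ≤ height hJ m' := by
  induction h with
  | refl => exact le_rfl
  | tail _ h ih =>
    refine ih.trans ?_
    obtain ⟨i, p, q, rfl, rfl, hpq, -⟩ := h
    rw [height_toSusp, height_toSusp]
    rcases hpq with hpq | hpq
    · rw [hpq]
    · obtain ⟨x, hx, -⟩ := exists_conePoint p
      have := (hJ i).isDirectEmbedding.heightForm_pos ((hJ i).2.1 x hx) hpq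
      have e : (q : Mink) = p + (q - p) := by abel
      rw [e, heightForm_add]
      linarith

/-- Monotonicity is known only near each parameter; continuous induction along `[a, b]` makes it
global. -/
theorem height_le_of_isFutureCausalCurve {γ : ℝ → T.Suspension J} {a b : ℝ} (hab : a ≤ b)
    (h : T.IsFutureCausalCurve J γ a b) : height hJ (γ a) ≤ height hJ (γ b) := by
  have hc : ContinuousOn (fun t => height hJ (γ t)) (Icc a b) :=
    (continuous_height hJ).comp_continuousOn h.1
  have hcl : IsClosed ({t | height hJ (γ a) ≤ height hJ (γ t)} ∩ Icc a b) := by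
    have := hc.preimage_isClosed_of_isClosed isClosed_Icc (isClosed_Ici (a := height hJ (γ a)))
    rwa [inter_comm] at this
  refine hcl.Icc_subset_of_forall_exists_gt (le_refl (height hJ (γ a))) ?_ (right_mem_Icc.2 hab)
  rintro t ⟨ht, htab⟩ y hy
  obtain ⟨ε, hε, h'⟩ := h.2 t (Ico_subset_Icc_self htab) univ univ_mem
  set s := min (min y b) (t + ε / 2) with hs
  have hts : t < s := lt_min (lt_min hy htab.2) (by linarith)
  have hsb : s ≤ b := (min_le_left _ _).trans (min_le_right _ _)
  have hsy : s ≤ y := (min_le_left _ _).trans (min_le_left _ _)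
  have hse : s ≤ t + ε / 2 := min_le_right _ _
  refine ⟨s, show height hJ (γ a) ≤ height hJ (γ s) from le_trans ht ?_, hts, hsy⟩
  refine height_le_of_localCausalLE hJ (h' t (Ico_subset_Icc_self htab) s
    ⟨by linarith [htab.1], hsb⟩ (by simpa using hε) ?_ hts.le)
  rw [abs_of_pos (by linarith)]; linarith

/-- Height does not decrease along causal curves. Conversely, the ray through a point of height at
least `1` leaves the surface at height `1` and is causal, its direction being in `J⁺(O)`. -/
theorem mem_causalFuture_iff (m : T.Suspension J) :
    m ∈ T.causalFuture J (range (T.embed J)) ↔ 1 ≤ height hJ m := by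
  constructor
  · rintro ⟨γ, a, b, hab, hγ, ha, rfl⟩
    rw [mem_range_embed_iff hJ] at ha
    rw [← ha]
    exact height_le_of_isFutureCausalCurve hJ hab hγ
  · intro h
    obtain ⟨i, p, rfl⟩ := exists_toSusp m
    obtain ⟨x, hx, t, ht, rfl⟩ := exists_conePoint p
    rw [height_conePoint] at h
    -- The clamp makes the ray a curve defined on all of `ℝ`; on the parameter interval `[1, t]` it
    -- has no effect.
    have hpos : ∀ s : ℝ, 0 < max s 1 := fun s => lt_max_of_lt_right one_pos
    have hP : Continuous fun s : ℝ => T.conePoint J i hx (hpos s) := by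
      refine Continuous.subtype_mk ?_ _
      fun_prop
    have hcont : Continuous fun s : ℝ => T.toSusp J i (T.conePoint J i hx (hpos s)) :=
      (continuous_toSusp i).comp hP
    refine ⟨fun s => T.toSusp J i (T.conePoint J i hx (hpos s)), 1, t, h,
      ⟨hcont.continuousOn, ?_⟩, ?_, ?_⟩
    · intro r hr U hU
      obtain ⟨ε, hε, hU'⟩ := Metric.mem_nhds_iff.1 (hcont.continuousAt hU)
      refine ⟨ε, hε, fun s hs s' hs' h1 h2 hss => Relation.ReflTransGen.single
        ⟨i, _, _, rfl, rfl, ?_, ?_⟩⟩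
      · rcases hss.eq_or_lt with rfl | hlt
        · exact Or.inl rfl
        · right
          change IsFutureCausal (max s' 1 • J i x - max s 1 • J i x)
          rw [max_eq_left hs.1, max_eq_left hs'.1, ← sub_smul]
          have hc := (hJ i).2.1 x hx
          refine ⟨?_, ?_⟩
          · rw [minkQ_smul]
            exact mul_nonpos_of_nonneg_of_nonpos (sq_nonneg _) hc.1
          · simpa using mul_pos (by linarith : 0 < s' - s) hc.2
      · intro z hz
        change (z : Mink) ∈ segment ℝ (max s 1 • J i x) (max s' 1 • J i x) at hz
        rw [max_eq_left hs.1, max_eq_left hs'.1] at hz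
        obtain ⟨α, β, hα, hβ, hαβ, hz⟩ := hz
        have hmem : α * s + β * s' ∈ Icc s s' := by
          obtain rfl : α = 1 - β := by linarith
          constructor <;> nlinarith
        have h1' := abs_lt.1 h1
        have h2' := abs_lt.1 h2
        have hin := hU' (show α * s + β * s' ∈ Metric.ball r ε by
          rw [Metric.mem_ball, Real.dist_eq, abs_lt]
          exact ⟨by linarith [hmem.1], by linarith [hmem.2]⟩)
        have e : z = T.conePoint J i hx (hpos (α * s + β * s')) := by
          apply Subtype.ext
          change (z : Mink) = max (α * s + β * s') 1 • J i x
          rw [max_eq_left (hs.1.trans hmem.1), ← hz]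
          module
        rw [e]
        exact hin
    · rw [mem_range_embed_iff hJ, height_conePoint, max_self]
    · exact congrArg (T.toSusp J i) (Subtype.ext (congrArg (· • J i x) (max_eq_left h)))

end

end GeodesicTriangulation

/-! ## Convex edges imply that the embedding is convex -/

theorem exists_notMem_span_pair (z v : Mink) : ∃ w, w ∉ Submodule.span ℝ {z, v} := by
  by_contra! h
  have h1 : Submodule.span ℝ (range ![z, v]) = ⊤ := by
    rw [eq_top_iff]
    intro w _
    have e : range ![z, v] = {z, v} := by simp [Set.pair_comm]
    rw [e]
    exact h w
  have h2 : (range ![z, v]).finrank ℝ ≤ Fintype.card (Fin 2) := finrank_range_le_card _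
  rw [Set.finrank, h1, finrank_top] at h2
  simp at h2

namespace GeodesicTriangulation

variable {X : Type*} [TopologicalSpace X] [T2Space X] {E : EuclideanConeSurface X}
  {T : GeodesicTriangulation E} {τ : X → ℝ} {J : T.ι → E2 →ᵃ[ℝ] Mink}

omit [T2Space X] in
theorem tendsto_conePoint_side {i : T.ι} {k : Fin 3} {s : ℝ} (hs : s ∈ Ioo (0 : ℝ) 1) {t : ℝ}
    (ht : 0 < t) {P : T.cone J i → Prop}
    (h : ∀ᶠ q in 𝓝 (T.conePoint J i (T.sidePoint_mem_tri i (k := k) (Ioo_subset_Icc_self hs)) ht),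
      P q) :
    ∀ᶠ r in 𝓝 s, ∃ hr : r ∈ Icc (0 : ℝ) 1, P (T.conePoint J i (T.sidePoint_mem_tri i (k := k) hr) ht) := by
  rw [nhds_subtype_eq_comap] at h
  obtain ⟨U, hU, hUP⟩ := h
  have hc : Continuous fun r : ℝ => t • J i (sidePoint (T.vert i) k r) := by
    have h1 : Continuous (J i) := (J i).continuous_of_finiteDimensional
    have h2 : Continuous (sidePoint (T.vert i) k) := by
      have : sidePoint (T.vert i) k = fun s => (1 - s) • T.vert i k + s • T.vert i (k + 1) :=
        funext fun s => sidePoint_eq _ _ _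
      rw [this]; fun_prop
    fun_prop
  filter_upwards [hc.continuousAt hU, Ioo_mem_nhds hs.1 hs.2] with r hr hr'
  exact ⟨Ioo_subset_Icc_self hr', hUP hr⟩

section

variable (hJ : ∀ i, T.IsSuspensionEmbedding τ i (J i))
include hJ

/-- Near a regular point that is not over a vertex, the height is bounded above by the extension of
its expression on one cone. -/
theorem exists_upper_bound (hE : T.EdgesConvex J) {m : T.Suspension J}
    (hm : proj hJ m ∉ T.vertices) {φ : OpenPartialHomeomorph (T.Suspension J) Mink}
    (hφ : T.IsFlatChart J φ) (hmφ : m ∈ φ.source) :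
    ∃ (i : T.ι) (g : Mink ≃ₗ[ℝ] Mink), height hJ m = heightForm (J i) (g.symm (φ m)) ∧
      ∀ᶠ m' in 𝓝 m, height hJ m' ≤ heightForm (J i) (g.symm (φ m')) := by
  obtain ⟨i, p, rfl⟩ := exists_toSusp m
  obtain ⟨x, hx, t, ht, rfl⟩ := exists_conePoint p
  rw [proj_conePoint] at hm
  obtain ⟨g, hg, hge⟩ := hφ.2 i _ hmφ
  rcases T.interior_or_side hx hm with hint | ⟨k, s, hs, rfl⟩
  · have := eventually_nhds_susp hJ (P := fun i' q => i' = i ∧ φ (T.toSusp J i' q) = g q)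
      (T.toSusp J i (T.conePoint J i hx ht)) ?_
    · refine ⟨i, g, ?_, ?_⟩
      · rw [hge.self_of_nhds, g.symm_apply_apply]; rfl
      · filter_upwards [this] with m' hm'
        obtain ⟨i', q, rfl⟩ := exists_toSusp m'
        obtain ⟨rfl, h⟩ := hm' i' q rfl
        rw [h, g.symm_apply_apply]; rfl
    · intro i' q h
      obtain ⟨y, hy, t', ht', rfl⟩ := exists_conePoint q
      obtain ⟨rfl, h'⟩ := (toSusp_conePoint_eq_iff hJ hy hx ht' ht).1 h
      obtain ⟨rfl, rfl⟩ := T.eq_of_cell_eq_interior hint hy h'.symm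
      filter_upwards [hge] with q hq
      exact ⟨rfl, hq⟩
  · obtain ⟨⟨j, l⟩, hp⟩ : ∃ b, T.pair (i, k) = b := ⟨_, rfl⟩
    obtain ⟨γ, hγ⟩ := exists_isEdgeGluing hJ hp
    have hs' : 1 - s ∈ Ioo (0 : ℝ) 1 := ⟨by linarith [hs.2], by linarith [hs.1]⟩
    have hgl := toSusp_eq_of_side hJ hp (Ioo_subset_Icc_self hs) (Ioo_subset_Icc_self hs') ht
    obtain ⟨g', hg', hge'⟩ := hφ.2 j _ (by rwa [hgl] at hmφ)
    -- The two expressions of the chart agree on a small piece of the common edge, hence at both of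
    -- its ends, and these two vectors determine an element of `SO₀(1,2)`. So any flat chart unfolds
    -- the edge by the gluing isometry.
    have hgg : g = γ.trans g' := by
      have key : g (J i (T.vert i k)) = g' (γ (J i (T.vert i k))) ∧
          g (J i (T.vert i (k + 1))) = g' (γ (J i (T.vert i (k + 1)))) := by
        apply lineMap_eq_of_eventually (s := s)
        have e1 := tendsto_conePoint_side hs ht hge
        have e2 := ((continuous_sub_left 1).tendsto s).eventually
          (tendsto_conePoint_side hs' ht hge')
        filter_upwards [e1, e2] with r ⟨hr, h1⟩ ⟨hr', h2⟩
        rw [toSusp_eq_of_side hJ hp hr hr' ht, h2] at h1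
        change g' (t • J j (sidePoint (T.vert j) l (1 - r))) =
          g (t • J i (sidePoint (T.vert i) k r)) at h1
        rw [sidePoint, ← hγ.map_lineMap, map_smul, map_smul] at h1
        have h3 := smul_right_injective _ ht.ne' h1
        rw [sidePoint, AffineMap.apply_lineMap] at h3
        simp only [AffineMap.lineMap_apply_module, map_add, map_smul] at h3 ⊢
        exact h3.symm
      exact SO0.eq_of_agree hg (SO0.trans_mem hγ.mem hg') hγ.causal_left hγ.causal_right
        hγ.minkQ_sub_pos key.1 key.2
    have := eventually_nhds_susp hJ (P := fun i' q => (i' = i ∧ φ (T.toSusp J i' q) = g q) ∨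
      (i' = j ∧ φ (T.toSusp J i' q) = g' q)) (T.toSusp J i (T.conePoint J i hx ht)) ?_
    · refine ⟨i, g, ?_, ?_⟩
      · rw [hge.self_of_nhds, g.symm_apply_apply]; rfl
      · filter_upwards [this] with m' hm'
        obtain ⟨i', q, rfl⟩ := exists_toSusp m'
        rcases hm' i' q rfl with ⟨rfl, h⟩ | ⟨rfl, h⟩
        · rw [h, g.symm_apply_apply]; rfl
        · obtain ⟨y, hy, t', ht', rfl⟩ := exists_conePoint q
          rw [h, height_conePoint, hgg]
          have e : (γ.trans g').symm (g' (T.conePoint J i' hy ht' : T.cone J i')) =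
              t' • γ.symm (J i' y) := by
            rw [LinearEquiv.symm_apply_eq, LinearEquiv.trans_apply, map_smul,
              LinearEquiv.apply_symm_apply]
            rfl
          rw [e, heightForm_smul]
          exact le_mul_of_one_le_right ht'.le (hγ.one_le_heightForm (hE _ _ _ _ _ hp hγ)
            ((mem_solidTriangle_iff (T.area_pos i')).1 hy l))
    · intro i' q h
      obtain ⟨y, hy, t', ht', rfl⟩ := exists_conePoint q
      obtain ⟨rfl, h'⟩ := (toSusp_conePoint_eq_iff hJ hy hx ht' ht).1 h
      rcases T.eq_of_cell_eq_side hp hs hy h'.symm with ⟨rfl, rfl⟩ | ⟨rfl, rfl⟩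
      · filter_upwards [hge] with q hq
        exact Or.inl ⟨rfl, hq⟩
      · filter_upwards [hge'] with q hq
        exact Or.inr ⟨rfl, hq⟩

/-- The linear bound of `exists_upper_bound` touches the height from above at `z`, so minus the
height is midpoint convex. -/
theorem midpointConvexAt_height_of_notMem_vertices (hE : T.EdgesConvex J)
    {φ : OpenPartialHomeomorph (T.Suspension J) Mink} (hφ : T.IsFlatChart J φ) {z : Mink}
    (hz : z ∈ φ.target) (hm : proj hJ (φ.symm z) ∉ T.vertices) (v : Mink) :
    MidpointConvexAt (fun z => -height hJ (φ.symm z)) z v := by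
  obtain ⟨i, g, h1, h2⟩ := exists_upper_bound hJ hE hm hφ (φ.map_target hz)
  have h3 : ∀ᶠ z' in 𝓝 z, height hJ (φ.symm z') ≤ heightForm (J i) (g.symm z') := by
    filter_upwards [(φ.continuousAt_symm hz).eventually h2, φ.open_target.mem_nhds hz] with z' h hz'
    rwa [φ.right_inv hz'] at h
  rw [φ.right_inv hz] at h1
  have t : ∀ σ : ℝ, Tendsto (fun s : ℝ => z + (σ * s) • v) (𝓝[>] 0) (𝓝 z) := by
    intro σ
    have : Continuous fun s : ℝ => z + (σ * s) • v := by fun_prop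
    have := this.tendsto 0
    simp only [mul_zero, zero_smul, add_zero] at this
    exact this.mono_left nhdsWithin_le_nhds
  filter_upwards [(t 1).eventually h3, (t (-1)).eventually h3] with s a1 a2
  rw [map_add, map_smul, heightForm_add, heightForm_smul] at a1 a2
  have e1 : z + (1 * s) • v = z + s • v := by rw [one_mul]
  have e2 : z + (-1 * s) • v = z - s • v := by module
  rw [e1] at a1
  rw [e2] at a2
  rw [h1]
  linarith

/-- Near a point of the regular part, the points over the vertices belong to a line through the
origin. -/
theorem eventually_mem_line {φ : OpenPartialHomeomorph (T.Suspension J) Mink}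
    (hφ : T.IsFlatChart J φ) {m : T.Suspension J} (hm : m ∈ φ.source) :
    ∀ᶠ m' in 𝓝 m, proj hJ m' ∈ T.vertices → ∃ a : ℝ, φ m' = a • φ m := by
  have := eventually_nhds_susp hJ (P := fun i q => proj hJ (T.toSusp J i q) ∈ T.vertices →
    ∃ a : ℝ, φ (T.toSusp J i q) = a • φ m) m ?_
  · filter_upwards [this] with m' hm'
    obtain ⟨i, q, rfl⟩ := exists_toSusp m'
    exact hm' i q rfl
  · rintro i p rfl
    obtain ⟨x, hx, t, ht, rfl⟩ := exists_conePoint p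
    obtain ⟨g, -, hge⟩ := hφ.2 i _ hm
    -- Discarding the vertices other than `x` leaves a neighbourhood where a point over a vertex
    -- must lie over `x`, on the same ray.
    have hcl : IsClosed (range (T.vert i) \ {x}) := ((finite_range _).subset sdiff_subset).isClosed
    have hx' : x ∈ (range (T.vert i) \ {x})ᶜ := fun h => h.2 rfl
    have hc := (continuous_conePos hJ i).continuousAt (x := T.conePoint J i hx ht)
    rw [ContinuousAt, planePos_conePoint hJ hx ht] at hc
    filter_upwards [hge, hc.eventually (hcl.isOpen_compl.mem_nhds hx')] with q h1 h2 h3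
    obtain ⟨y, hy, t', ht', rfl⟩ := exists_conePoint q
    rw [planePos_conePoint hJ hy ht'] at h2
    rw [proj_conePoint] at h3
    obtain ⟨j, l, h3⟩ := h3
    obtain ⟨k, rfl⟩ := T.eq_vert_of_cell_eq hy h3
    have hxy : T.vert i k = x := by
      by_contra h
      exact h2 ⟨⟨k, rfl⟩, h⟩
    subst hxy
    refine ⟨t' * t⁻¹, ?_⟩
    rw [h1, hge.self_of_nhds, ← map_smul]
    congr 1
    change t' • J i _ = (t' * t⁻¹) • t • J i _
    rw [smul_smul, mul_assoc, inv_mul_cancel₀ ht.ne', mul_one]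

/-- The exceptional points near `z` lie on the line `ℝ z`; a displacement `w` outside the span of
`z` and `v` moves lines of direction `v` away from it. -/
theorem midpointConvexAt_height (hE : T.EdgesConvex J)
    {φ : OpenPartialHomeomorph (T.Suspension J) Mink} (hφ : T.IsFlatChart J φ) {z : Mink}
    (hz : z ∈ φ.target) (v : Mink) :
    MidpointConvexAt (fun z => -height hJ (φ.symm z)) z v := by
  obtain ⟨w, hw⟩ := exists_notMem_span_pair z v
  have hnear := (φ.continuousAt_symm hz).eventually
    (eventually_mem_line hJ hφ (φ.map_target hz))
  refine MidpointConvexAt.of_parallel (w := w) (N := {y | ∃ a : ℝ, y = a • z}) ?_ ?_ ?_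
  · filter_upwards [φ.open_target.mem_nhds hz] with y hy
    exact ((continuous_height hJ).continuousAt.comp (φ.continuousAt_symm hy)).neg
  · filter_upwards [hnear, φ.open_target.mem_nhds hz] with y hy hyt hyN
    refine midpointConvexAt_height_of_notMem_vertices hJ hE hφ hyt (fun h => hyN ?_) v
    have := hy h
    rwa [φ.right_inv hyt, φ.right_inv hz] at this
  · rintro ε hε s ⟨a, h⟩
    apply hw
    have e : w = (ε⁻¹ * (a - 1)) • z + (-ε⁻¹ * s) • v := by
      refine smul_right_injective _ hε ?_
      simp only [smul_add, smul_smul, ← mul_assoc, mul_neg, mul_inv_cancel₀ hε, one_mul, neg_mul]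
      have : ε • w = (z + ε • w + s • v) - z - s • v := by abel
      rw [this, h]; module
    rw [e]
    exact add_mem (Submodule.smul_mem _ _ (Submodule.subset_span (by simp)))
      (Submodule.smul_mem _ _ (Submodule.subset_span (by simp)))

theorem EdgesConvex.isConvexMap (hE : T.EdgesConvex J) : T.IsConvexMap J (T.embed J) := by
  intro a b c hab hc ha hb t ht
  rw [mem_causalFuture_iff hJ] at *
  have := le_max_of_midpoint (f := fun t => -height hJ (c t)) (a := a) (b := b) ?_ ?_ ht
  · have h1 : max (-height hJ (c a)) (-height hJ (c b)) ≤ -1 := max_le (by linarith) (by linarith)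
    linarith
  · exact ((continuous_height hJ).comp_continuousOn hc.1).neg
  · intro t ht
    obtain ⟨φ, hφ, p, v, -, hct, hev⟩ := hc.2 t ht
    have hG := midpointConvexAt_height hJ hE hφ (φ.map_source hct) v
    have h1 : Tendsto (fun s : ℝ => t + s) (𝓝[>] 0) (𝓝 t) := by
      have : Continuous fun s : ℝ => t + s := by fun_prop
      have := this.tendsto 0
      rw [add_zero] at this
      exact this.mono_left nhdsWithin_le_nhds
    have h2 : Tendsto (fun s : ℝ => t - s) (𝓝[>] 0) (𝓝 t) := by
      have : Continuous fun s : ℝ => t - s := by fun_prop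
      have := this.tendsto 0
      rw [sub_zero] at this
      exact this.mono_left nhdsWithin_le_nhds
    filter_upwards [hG, h1.eventually hev, h2.eventually hev] with s hs e1 e2
    have hφt := hev.self_of_nhds.2
    have e3 : φ (c t) + s • v = φ (c (t + s)) := by rw [hφt, e1.2]; module
    have e4 : φ (c t) - s • v = φ (c (t - s)) := by rw [hφt, e2.2]; module
    rwa [e3, e4, φ.left_inv hct, φ.left_inv e1.1, φ.left_inv e2.1] at hs

end

end GeodesicTriangulation

/-! ## A flat chart around an edge -/

namespace GeodesicTriangulation

variable {X : Type*} [TopologicalSpace X] {E : EuclideanConeSurface X}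
  {T : GeodesicTriangulation E} {τ : X → ℝ} {J : T.ι → E2 →ᵃ[ℝ] Mink}

/-- The linear form that vanishes on the `k`-th face of a cone and is positive inside. -/
def faceForm (T : GeodesicTriangulation E) (J : T.ι → E2 →ᵃ[ℝ] Mink) (i : T.ι) (k : Fin 3) :
    Mink → ℝ := det3 (J i (T.vert i k)) (J i (T.vert i (k + 1)))

theorem continuous_faceForm (i : T.ι) (k : Fin 3) : Continuous (T.faceForm J i k) :=
  continuous_det3 _ _

theorem toSusp_eq_of_gluing {i j : T.ι} {k l : Fin 3} (hp : T.pair (i, k) = (j, l))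
    {γ : Mink ≃ₗ[ℝ] Mink} (hγ : IsEdgeGluing (J i) (J j) (T.vert i k) (T.vert i (k + 1))
      (T.vert j l) (T.vert j (l + 1)) γ) {s : ℝ} (hs : s ∈ Icc (0 : ℝ) 1) {t : ℝ} (ht : 0 < t)
    (p : T.cone J i) (q : T.cone J j) (hpz : (p : Mink) = t • J i (sidePoint (T.vert i) k s))
    (hqz : (q : Mink) = γ p) : T.toSusp J i p = T.toSusp J j q :=
  Quot.sound ⟨k, l, hp, ⟨t, ht, s, hs, hpz⟩, γ, hγ.mem, hγ.map_left, hγ.map_right, hqz⟩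

theorem faceForm_gluing {i j : T.ι} {k l : Fin 3} {γ : Mink ≃ₗ[ℝ] Mink}
    (hγ : IsEdgeGluing (J i) (J j) (T.vert i k) (T.vert i (k + 1))
      (T.vert j l) (T.vert j (l + 1)) γ) (z : Mink) :
    T.faceForm J j l (γ z) = -T.faceForm J i k z := by
  rw [faceForm, ← hγ.map_left, ← hγ.map_right, SO0.det3_map hγ.mem, det3_swap]
  rfl

section

variable (hJ : ∀ i, T.IsSuspensionEmbedding τ i (J i))
include hJ

theorem exists_faceForm_eq (i : T.ι) : ∃ H > 0, ∀ k x t,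
    T.faceForm J i k (t • J i x) = t * (H * sideForm (T.vert i) k x) := by
  refine ⟨-minkB (normal (J i)) (J i 0), neg_pos.2 ((hJ i).isDirectEmbedding.minkB_normal_neg
    ((hJ i).2.1 _ (T.vert_mem_tri i 0)) 0), fun k x t => ?_⟩
  rw [faceForm, det3_smul_right, det3_affine, minkB_normal_apply (J i) _ 0, sideForm]

theorem faceForm_pos_iff {i : T.ι} {k : Fin 3} {x : E2} {t : ℝ} (ht : 0 < t) :
    0 < T.faceForm J i k (t • J i x) ↔ 0 < sideForm (T.vert i) k x := by
  obtain ⟨H, hH, h⟩ := exists_faceForm_eq hJ i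
  rw [h, mul_pos_iff_of_pos_left ht, mul_pos_iff_of_pos_left hH]

theorem faceForm_eq_zero_iff {i : T.ι} {k : Fin 3} {x : E2} {t : ℝ} (ht : 0 < t) :
    T.faceForm J i k (t • J i x) = 0 ↔ sideForm (T.vert i) k x = 0 := by
  obtain ⟨H, hH, h⟩ := exists_faceForm_eq hJ i
  rw [h]
  simp [ht.ne', hH.ne']

/-- A future causal vector has positive height, so it can be rescaled into the embedded plane, where
the face forms are positive multiples of the side forms of the triangle. -/
theorem mem_cone_iff {i : T.ι} {z : Mink} (hz : IsFutureCausal z) :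
    z ∈ T.cone J i ↔ ∀ k, 0 ≤ T.faceForm J i k z := by
  obtain ⟨H, hH, h⟩ := exists_faceForm_eq hJ i
  constructor
  · rintro ⟨t, ht, x, hx, rfl⟩ k
    rw [h]
    have := (mem_solidTriangle_iff (T.area_pos i)).1 hx k
    positivity
  · intro hk
    have hc := (hJ i).2.1 _ (T.vert_mem_tri i 0)
    have hpos := (hJ i).isDirectEmbedding.heightForm_pos hc hz
    have e := (hJ i).isDirectEmbedding.apply_planePos_inv_heightForm hc hpos.ne'
    set x := planePos (J i) ((heightForm (J i) z)⁻¹ • z)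
    have hz' : z = heightForm (J i) z • J i x := by
      rw [e, smul_smul, mul_inv_cancel₀ hpos.ne', one_smul]
    refine ⟨_, hpos, x, (mem_solidTriangle_iff (T.area_pos i)).2 fun k => ?_, hz'⟩
    have := hk k
    rw [hz', h] at this
    exact nonneg_of_mul_nonneg_right (nonneg_of_mul_nonneg_right this hpos) hH

theorem eq_of_toSusp_eq_interior {i j : T.ι} (p : T.cone J i) (q : T.cone J j)
    (hp : ∀ k, 0 < T.faceForm J i k p) (h : T.toSusp J j q = T.toSusp J i p) :
    j = i ∧ (q : Mink) = p := by
  obtain ⟨x, hx, t, ht, rfl⟩ := exists_conePoint p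
  obtain ⟨y, hy, t', ht', rfl⟩ := exists_conePoint q
  obtain ⟨rfl, h'⟩ := (toSusp_conePoint_eq_iff hJ hy hx ht' ht).1 h
  obtain ⟨rfl, rfl⟩ := T.eq_of_cell_eq_interior (fun k => (faceForm_pos_iff hJ ht).1 (hp k)) hy
    h'.symm
  exact ⟨rfl, rfl⟩

theorem exists_side_of_faceForm_eq_zero {i : T.ι} {k : Fin 3} (p : T.cone J i)
    (h0 : T.faceForm J i k p = 0) (h1 : 0 < T.faceForm J i (k + 1) p)
    (h2 : 0 < T.faceForm J i (k + 2) p) : ∃ s ∈ Ioo (0 : ℝ) 1, ∃ t : ℝ, 0 < t ∧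
      (p : Mink) = t • J i (sidePoint (T.vert i) k s) := by
  obtain ⟨x, hx, t, ht, rfl⟩ := exists_conePoint p
  have h0 := (faceForm_eq_zero_iff hJ ht).1 h0
  have h1 := (faceForm_pos_iff hJ ht).1 h1
  have h2 := (faceForm_pos_iff hJ ht).1 h2
  obtain ⟨s, hs, rfl⟩ := eq_sidePoint (T.area_pos i) hx h0
  rw [sideForm_succ_sidePoint] at h1
  rw [sideForm_pred_sidePoint] at h2
  have := pos_of_mul_pos_left h1 (T.area_pos i).le
  have := pos_of_mul_pos_left h2 (T.area_pos i).le
  exact ⟨s, ⟨by linarith, by linarith⟩, t, ht, rfl⟩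

theorem faceForm_midpoint_pos (i : T.ι) {k : Fin 3} {s : ℝ} (hs : s ∈ Ioo (0 : ℝ) 1) :
    0 < T.faceForm J i (k + 1) (J i (sidePoint (T.vert i) k s)) ∧
      0 < T.faceForm J i (k + 2) (J i (sidePoint (T.vert i) k s)) := by
  have h := fun l => faceForm_pos_iff hJ (i := i) (k := l) (x := sidePoint (T.vert i) k s) one_pos
  simp only [one_smul] at h
  rw [h, h, sideForm_succ_sidePoint, sideForm_pred_sidePoint]
  exact ⟨mul_pos (by linarith [hs.2]) (T.area_pos i), mul_pos hs.1 (T.area_pos i)⟩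

/-- A ball of Minkowski space around an interior point of an edge is covered by the two cones
that are adjacent to the edge, without other identifications than the gluing. -/
theorem exists_edge_ball {i j : T.ι} {k l : Fin 3} (hp : T.pair (i, k) = (j, l))
    {γ : Mink ≃ₗ[ℝ] Mink} (hγ : IsEdgeGluing (J i) (J j) (T.vert i k) (T.vert i (k + 1))
      (T.vert j l) (T.vert j (l + 1)) γ) {s : ℝ} (hs : s ∈ Ioo (0 : ℝ) 1) :
    ∃ ε > 0, ∀ z ∈ Metric.ball (J i (sidePoint (T.vert i) k s)) ε,
      IsFutureTimelike z ∧ (z ∈ T.cone J i ↔ 0 ≤ T.faceForm J i k z) ∧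
      (γ z ∈ T.cone J j ↔ T.faceForm J i k z ≤ 0) ∧
      (∀ (p : T.cone J i) (q : T.cone J j), (p : Mink) = z → (q : Mink) = γ z →
        T.toSusp J i p = T.toSusp J j q) ∧
      (∀ (p : T.cone J i) (n : T.ι) (q : T.cone J n), (p : Mink) = z →
        T.toSusp J n q = T.toSusp J i p →
        (n = i ∧ (q : Mink) = z) ∨ (n = j ∧ (q : Mink) = γ z)) ∧
      (∀ (p : T.cone J j) (n : T.ι) (q : T.cone J n), (p : Mink) = γ z →
        T.toSusp J n q = T.toSusp J j p →
        (n = i ∧ (q : Mink) = z) ∨ (n = j ∧ (q : Mink) = γ z)) ∧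
      ∀ z' ∈ Metric.ball (J i (sidePoint (T.vert i) k s)) ε, i = j → z ≠ γ z' := by
  set a := J i (sidePoint (T.vert i) k s) with ha
  have hs' : 1 - s ∈ Ioo (0 : ℝ) 1 := ⟨by linarith [hs.2], by linarith [hs.1]⟩
  have hγa : γ a = J j (sidePoint (T.vert j) l (1 - s)) := hγ.map_lineMap s
  have hγc : Continuous γ := (γ : Mink →ₗ[ℝ] Mink).continuous_of_finiteDimensional
  have ha_time : ∀ᶠ z in 𝓝 a, IsFutureTimelike z := by
    have h0 : IsFutureTimelike a := by
      have hca := (hJ i).2.1 _ (T.sidePoint_mem_tri i (k := k) (Ioo_subset_Icc_self hs))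
      refine ⟨?_, hca.2⟩
      have e : a = (1 - s) • J i (T.vert i k) + s • J i (T.vert i (k + 1)) := by
        rw [ha, sidePoint, AffineMap.apply_lineMap, AffineMap.lineMap_apply_module]
      rw [e, minkQ_add, minkQ_smul, minkQ_smul, minkB_smul_left, minkB_smul_right]
      have h1 := hγ.causal_left.1
      have h2 := hγ.causal_right.1
      have h3 := minkB_neg_of_spacelike_sub hγ.causal_left hγ.causal_right hγ.minkQ_sub_pos
      have h4 : 0 < (1 - s) * s := mul_pos hs'.1 hs.1
      nlinarith [mul_nonneg (sq_nonneg (1 - s)) (neg_nonneg.2 h1),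
        mul_nonneg (sq_nonneg s) (neg_nonneg.2 h2), mul_pos h4 (neg_pos.2 h3)]
    exact (continuous_minkQ.continuousAt.eventually (gt_mem_nhds h0.1)).and
      (continuous_fst.continuousAt.eventually (lt_mem_nhds h0.2))
  have hi := faceForm_midpoint_pos hJ i (k := k) hs
  have hj := faceForm_midpoint_pos hJ j (k := l) hs'
  rw [← hγa] at hj
  have ei : ∀ m, 0 < T.faceForm J i m a → ∀ᶠ z in 𝓝 a, 0 < T.faceForm J i m z := fun m h =>
    (continuous_faceForm i m).continuousAt.eventually (lt_mem_nhds h)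
  have ej : ∀ m, 0 < T.faceForm J j m (γ a) → ∀ᶠ z in 𝓝 a, 0 < T.faceForm J j m (γ z) := fun m h =>
    ((continuous_faceForm j m).comp hγc).continuousAt.eventually (lt_mem_nhds h)
  -- A triangle may be glued to itself. Since no side is its own partner, `a` and `γ a` lie on
  -- different sides and can be separated, which keeps the two halves of the ball from overlapping
  -- in one cone.
  have hW : ∃ W ∈ 𝓝 a, ∀ z ∈ W, ∀ z' ∈ W, i = j → z ≠ γ z' := by
    by_cases hij : i = j
    · have hne : a ≠ γ a := by
        subst hij
        rw [hγa, ha]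
        intro h
        have h1 := congrArg (planePos (J i)) h
        rw [(hJ i).isDirectEmbedding.planePos_apply, (hJ i).isDirectEmbedding.planePos_apply] at h1
        obtain ⟨rfl, -⟩ := sidePoint_eq_sidePoint (T.area_pos i) hs h1
        exact T.pair_ne _ hp
      obtain ⟨U, V, hU, hV, haU, haV, hUV⟩ := t2_separation hne
      refine ⟨U ∩ γ ⁻¹' V, inter_mem (hU.mem_nhds haU) (hγc.continuousAt (hV.mem_nhds haV)), ?_⟩
      rintro z hz z' hz' - h
      exact hUV.le_bot ⟨hz.1, by rw [h]; exact hz'.2⟩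
    · exact ⟨univ, univ_mem, fun _ _ _ _ h => absurd h hij⟩
  obtain ⟨W, hW, hW'⟩ := hW
  obtain ⟨ε, hε, hball⟩ := Metric.eventually_nhds_iff_ball.1 ((((ha_time.and (ei _ hi.1)).and
    (ei _ hi.2)).and ((ej _ hj.1).and (ej _ hj.2))).and hW)
  refine ⟨ε, hε, fun z hz => ?_⟩
  obtain ⟨⟨⟨⟨ht, hi1⟩, hi2⟩, hj1, hj2⟩, hzW⟩ := hball z hz
  have hFγ := faceForm_gluing hγ z
  have c1 : z ∈ T.cone J i ↔ 0 ≤ T.faceForm J i k z := by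
    rw [mem_cone_iff hJ ht.causal]
    refine ⟨fun h => h k, fun h m => ?_⟩
    rcases Fin3.cases_add k m with rfl | rfl | rfl
    exacts [h, hi1.le, hi2.le]
  have c2 : γ z ∈ T.cone J j ↔ T.faceForm J i k z ≤ 0 := by
    rw [mem_cone_iff hJ (SO0.timelike_map hγ.mem ht).causal]
    refine ⟨fun h => by linarith [h l], fun h m => ?_⟩
    rcases Fin3.cases_add l m with rfl | rfl | rfl
    exacts [by linarith, hj1.le, hj2.le]
  have c3 : ∀ (p : T.cone J i) (q : T.cone J j), (p : Mink) = z → (q : Mink) = γ z →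
      T.toSusp J i p = T.toSusp J j q := by
    intro p q hpz hqz
    have h0 : T.faceForm J i k z = 0 :=
      le_antisymm (c2.1 (hqz ▸ q.2)) (c1.1 (hpz ▸ p.2))
    subst hpz
    obtain ⟨r, hr, t, ht, hpr⟩ := exists_side_of_faceForm_eq_zero hJ p h0 hi1 hi2
    exact toSusp_eq_of_gluing hp hγ (Ioo_subset_Icc_self hr) ht p q hpr hqz
  have c4 : ∀ (p : T.cone J i) (n : T.ι) (q : T.cone J n), (p : Mink) = z →
      T.toSusp J n q = T.toSusp J i p →
      (n = i ∧ (q : Mink) = z) ∨ (n = j ∧ (q : Mink) = γ z) := by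
    intro p n q hpz h
    subst hpz
    rcases (c1.1 p.2).eq_or_lt with h0 | h0
    · obtain ⟨r, hr, t, ht, hpr⟩ := exists_side_of_faceForm_eq_zero hJ p h0.symm hi1 hi2
      have hpe : p = T.conePoint J i (T.sidePoint_mem_tri i (k := k) (Ioo_subset_Icc_self hr)) ht :=
        Subtype.ext hpr
      obtain ⟨y, hy, t', ht', rfl⟩ := exists_conePoint q
      rw [hpe] at h
      obtain ⟨rfl, h'⟩ := (toSusp_conePoint_eq_iff hJ hy _ ht' ht).1 h
      rcases T.eq_of_cell_eq_side hp hr hy h'.symm with ⟨rfl, rfl⟩ | ⟨rfl, rfl⟩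
      · exact Or.inl ⟨rfl, hpr.symm⟩
      · refine Or.inr ⟨rfl, ?_⟩
        rw [hpr, map_smul]
        exact congrArg (t' • ·) (hγ.map_lineMap r).symm
    · left
      refine eq_of_toSusp_eq_interior hJ p q (fun m => ?_) h
      rcases Fin3.cases_add k m with rfl | rfl | rfl
      exacts [h0, hi1, hi2]
  refine ⟨ht, c1, c2, c3, c4, ?_, fun z' hz' => hW' z hzW z' (hball z' hz').2⟩
  intro p n q hpz h
  rcases le_or_gt 0 (T.faceForm J i k z) with h0 | h0
  · exact c4 ⟨z, c1.2 h0⟩ n q rfl (h.trans (c3 ⟨z, c1.2 h0⟩ p rfl hpz).symm)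
  · right
    rw [← hpz]
    refine eq_of_toSusp_eq_interior hJ p q (fun m => ?_) h
    rw [hpz]
    rcases Fin3.cases_add l m with rfl | rfl | rfl
    exacts [by linarith, hj1, hj2]

/-- There is a flat chart around an interior point of a face of the suspension. -/
theorem exists_flatChart {i j : T.ι} {k l : Fin 3} (hp : T.pair (i, k) = (j, l))
    {γ : Mink ≃ₗ[ℝ] Mink} (hγ : IsEdgeGluing (J i) (J j) (T.vert i k) (T.vert i (k + 1))
      (T.vert j l) (T.vert j (l + 1)) γ) {s : ℝ} (hs : s ∈ Ioo (0 : ℝ) 1) :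
    ∃ φ, T.IsFlatChart J φ ∧ ∃ ε > 0,
      φ.target = Metric.ball (J i (sidePoint (T.vert i) k s)) ε ∧
      ∀ z ∈ φ.target, (z ∈ T.cone J i ∨ γ z ∈ T.cone J j) ∧
        (∀ h : z ∈ T.cone J i, φ.symm z = T.toSusp J i ⟨z, h⟩) ∧
        ∀ h : γ z ∈ T.cone J j, φ.symm z = T.toSusp J j ⟨γ z, h⟩ := by
  classical
  obtain ⟨ε, hε, hB⟩ := exists_edge_ball hJ hp hγ hs
  set B := Metric.ball (J i (sidePoint (T.vert i) k s)) ε with hBdef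
  have hBo : IsOpen B := Metric.isOpen_ball
  have hγc : Continuous γ := (γ : Mink →ₗ[ℝ] Mink).continuous_of_finiteDimensional
  have hγs : Continuous γ.symm := (γ.symm : Mink →ₗ[ℝ] Mink).continuous_of_finiteDimensional
  -- The inverse of the chart: each half of the ball goes to its cone, the second half through `γ`.
  let σ : B → T.Suspension J := fun z =>
    if h : 0 ≤ T.faceForm J i k z then T.toSusp J i ⟨z, (hB z z.2).2.1.2 h⟩
    else T.toSusp J j ⟨γ z, (hB z z.2).2.2.1.2 (not_le.1 h).le⟩
  have σ1 : ∀ (z : B) (h : (z : Mink) ∈ T.cone J i), σ z = T.toSusp J i ⟨z, h⟩ := fun z h =>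
    dif_pos ((hB z z.2).2.1.1 h)
  have σ2 : ∀ (z : B) (h : γ z ∈ T.cone J j), σ z = T.toSusp J j ⟨γ z, h⟩ := by
    intro z h
    by_cases h0 : 0 ≤ T.faceForm J i k z
    · rw [σ1 z ((hB z z.2).2.1.2 h0)]
      exact (hB z z.2).2.2.2.1 _ _ rfl rfl
    · exact dif_neg h0
  have σmem : ∀ z : B, (z : Mink) ∈ T.cone J i ∨ γ z ∈ T.cone J j := fun z =>
    (le_total 0 (T.faceForm J i k z)).imp (hB z z.2).2.1.2 (hB z z.2).2.2.1.2
  have σL : ∀ (z : B) (n : T.ι) (q : T.cone J n), T.toSusp J n q = σ z →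
      (n = i ∧ (q : Mink) = z) ∨ (n = j ∧ (q : Mink) = γ z) := by
    intro z n q h
    rcases σmem z with h1 | h1
    · rw [σ1 z h1] at h
      exact (hB z z.2).2.2.2.2.1 _ n q rfl h
    · rw [σ2 z h1] at h
      exact (hB z z.2).2.2.2.2.2.1 _ n q rfl h
  have hinj : Function.Injective σ := by
    intro z z' h
    rcases σmem z' with h1 | h1
    · rw [σ1 z' h1] at h
      rcases σL z i _ (h.symm.trans rfl) with ⟨-, h2⟩ | ⟨h2, h3⟩
      · exact Subtype.ext h2.symm
      · exact absurd h3 ((hB z' z'.2).2.2.2.2.2.2 z z.2 h2)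
    · rw [σ2 z' h1] at h
      rcases σL z j _ (h.symm.trans rfl) with ⟨h2, h3⟩ | ⟨-, h2⟩
      · exact absurd h3.symm ((hB z z.2).2.2.2.2.2.2 z' z'.2 h2.symm)
      · exact Subtype.ext (γ.injective h2).symm
  have hcont : Continuous σ := by
    have hF : Continuous fun z : B => T.faceForm J i k z :=
      (continuous_faceForm i k).comp continuous_subtype_val
    have hcl1 : IsClosed {z : B | 0 ≤ T.faceForm J i k z} := isClosed_le continuous_const hF
    have hcl2 : IsClosed {z : B | T.faceForm J i k z ≤ 0} := isClosed_le hF continuous_const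
    have h1 : ContinuousOn σ {z : B | 0 ≤ T.faceForm J i k z} := by
      rw [continuousOn_iff_continuous_domRestrict]
      have e : {z : B | 0 ≤ T.faceForm J i k z}.domRestrict σ = fun (z : {z : B | 0 ≤ T.faceForm J i k z}) =>
        T.toSusp J i ⟨z, (hB z z.1.2).2.1.2 z.2⟩ := funext fun z => σ1 z _
      rw [e]
      exact (continuous_toSusp i).comp (Continuous.subtype_mk (by fun_prop) _)
    have h2 : ContinuousOn σ {z : B | T.faceForm J i k z ≤ 0} := by
      rw [continuousOn_iff_continuous_domRestrict]
      have e : {z : B | T.faceForm J i k z ≤ 0}.domRestrict σ = fun (z : {z : B | T.faceForm J i k z ≤ 0}) =>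
        T.toSusp J j ⟨γ z, (hB z z.1.2).2.2.1.2 z.2⟩ := funext fun z => σ2 z _
      rw [e]
      exact (continuous_toSusp j).comp (Continuous.subtype_mk (by fun_prop) _)
    rw [← continuousOn_univ]
    refine (h1.union_of_isClosed h2 hcl1 hcl2).mono fun z _ => le_total 0 (T.faceForm J i k z)
  have hopen : IsOpenMap σ := by
    intro O hO
    have hO' : IsOpen (Subtype.val '' O) := hBo.isOpenMap_subtype_val O hO
    -- By the quotient topology it suffices to look in each cone, where the full list of preimages
    -- `σL` describes the set by `O` and its image under `γ`.
    have hq : IsOpen ((Quot.mk (T.coneGlue J)) ⁻¹' (σ '' O)) := by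
      rw [isOpen_sigma_iff]
      intro n
      have e : Sigma.mk n ⁻¹' (Quot.mk (T.coneGlue J) ⁻¹' (σ '' O)) =
          {q : T.cone J n | (n = i ∧ (q : Mink) ∈ Subtype.val '' O) ∨
            (n = j ∧ γ.symm q ∈ Subtype.val '' O)} := by
        ext q
        constructor
        · rintro ⟨z, hz, h⟩
          rcases σL z n q h.symm with ⟨h1, h2⟩ | ⟨h1, h2⟩
          · exact Or.inl ⟨h1, z, hz, h2.symm⟩
          · exact Or.inr ⟨h1, z, hz, by rw [h2, γ.symm_apply_apply]⟩
        · rintro (⟨rfl, z, hz, h⟩ | ⟨rfl, z, hz, h⟩)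
          · have hm : (z : Mink) ∈ T.cone J n := h ▸ q.2
            exact ⟨z, hz, (σ1 z hm).trans (congrArg (T.toSusp J n) (Subtype.ext h))⟩
          · have h' : γ z = q := by rw [h, γ.apply_symm_apply]
            have hm : γ z ∈ T.cone J n := h' ▸ q.2
            exact ⟨z, hz, (σ2 z hm).trans (congrArg (T.toSusp J n) (Subtype.ext h'))⟩
      rw [e]
      exact (isOpen_const.inter (hO'.preimage continuous_subtype_val)).union
        (isOpen_const.inter (hO'.preimage (hγs.comp continuous_subtype_val)))
    exact isOpen_coinduced.2 hq
  have hemb : IsOpenEmbedding σ := .of_continuous_injective_isOpenMap hcont hinj hopen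
  have : Nonempty B := ⟨⟨_, Metric.mem_ball_self hε⟩⟩
  let φ := (hemb.toOpenPartialHomeomorph σ).symm.trans
    (hBo.isOpenEmbedding_subtypeVal.toOpenPartialHomeomorph Subtype.val)
  have hsource : ∀ z : B, σ z ∈ φ.source := fun z => by simp [φ]
  have hsource' : ∀ m ∈ φ.source, ∃ z, σ z = m := fun m hm => by simpa [φ] using hm
  have hφ : ∀ z : B, φ (σ z) = z := fun z =>
    congrArg Subtype.val ((hemb.toOpenPartialHomeomorph σ).left_inv (mem_univ z))
  have htarget : φ.target = B := by
    ext z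
    constructor
    · intro hz
      obtain ⟨w, hw⟩ := hsource' _ (φ.map_target hz)
      have := hφ w
      rw [hw, φ.right_inv hz] at this
      rw [this]; exact w.2
    · intro hz
      have := φ.map_source (hsource ⟨z, hz⟩)
      rwa [hφ] at this
  have hsymm : ∀ z : B, φ.symm z = σ z := fun z => by
    rw [← hφ z, φ.left_inv (hsource z)]
  refine ⟨φ, ⟨fun z hz => (hB z (htarget ▸ hz)).1, ?_⟩, ε, hε, htarget, fun z hz => ?_⟩
  · intro n p hn
    obtain ⟨z, hz⟩ := hsource' _ hn
    rcases σL z n p hz.symm with ⟨rfl, h⟩ | ⟨rfl, h⟩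
    · refine ⟨LinearEquiv.refl ℝ Mink, ⟨fun _ => rfl, ?_, fun _ hv => hv⟩, ?_⟩
      · exact LinearMap.det_id
      · have h1 : (Subtype.val : T.cone J n → Mink) ⁻¹' B ∈ 𝓝 p :=
          continuous_subtype_val.continuousAt (hBo.mem_nhds (h ▸ z.2))
        filter_upwards [h1] with q hq
        have := hφ ⟨q, hq⟩
        rwa [σ1 ⟨q, hq⟩ q.2] at this
    · refine ⟨γ.symm, SO0.symm_mem hγ.mem, ?_⟩
      have h1 : (fun q : T.cone J n => γ.symm q) ⁻¹' B ∈ 𝓝 p :=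
        (hγs.comp continuous_subtype_val).continuousAt (hBo.mem_nhds (by
          rw [Function.comp_apply, h, γ.symm_apply_apply]; exact z.2))
      filter_upwards [h1] with q hq
      have h2 : γ (γ.symm q) ∈ T.cone J n := by rw [γ.apply_symm_apply]; exact q.2
      have := hφ ⟨γ.symm q, hq⟩
      rw [σ2 ⟨γ.symm q, hq⟩ h2] at this
      have h3 : q = ⟨γ (γ.symm q), h2⟩ := Subtype.ext (γ.apply_symm_apply _).symm
      exact (congrArg (fun q => φ (T.toSusp J n q)) h3).trans this
  · have hz' : z ∈ B := htarget ▸ hz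
    exact ⟨σmem ⟨z, hz'⟩, fun h => (hsymm ⟨z, hz'⟩).trans (σ1 ⟨z, hz'⟩ h),
      fun h => (hsymm ⟨z, hz'⟩).trans (σ2 ⟨z, hz'⟩ h)⟩

/-- In a flat chart around the midpoint `a` of an edge, join a point `a + r w` of the first triangle
to the point `a + r w'` of the unfolded second one. The segment is spacelike because `B(w, w')` is
negative, and both ends have height `1`. If `u` pointed to the past, the midpoint would have height
less than `1`. -/
theorem edgesConvex_of_isConvexMap (hc : T.IsConvexMap J (T.embed J)) : T.EdgesConvex J := by
  intro i j k l γ hp hγ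
  by_contra hu
  have hs : (1 / 2 : ℝ) ∈ Ioo (0 : ℝ) 1 := by norm_num
  have hs' : (1 - 1 / 2 : ℝ) ∈ Ioo (0 : ℝ) 1 := by norm_num
  obtain ⟨φ, hφ, ε, hε, htarget, hφs⟩ := exists_flatChart hJ hp hγ hs
  set w := (J i).linear (rot (T.vert i (k + 1) - T.vert i k)) with hw
  set w' := γ.symm ((J j).linear (rot (T.vert j (l + 1) - T.vert j l))) with hw'
  set u := conormalSum (J i) (J j) (T.vert i k) (T.vert i (k + 1)) (T.vert j l)
    (T.vert j (l + 1)) γ with hudef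
  have huw : u = w + w' := rfl
  set a := J i (sidePoint (T.vert i) k (1 / 2)) with ha
  have hγa : γ a = J j (sidePoint (T.vert j) l (1 - 1 / 2)) := hγ.map_lineMap (1 / 2)
  have ev1 : ∀ᶠ r in 𝓝[>] (0 : ℝ), sidePoint (T.vert i) k (1 / 2) +
      r • rot (T.vert i (k + 1) - T.vert i k) ∈ T.tri i :=
    nhdsWithin_mono _ Ioi_subset_Ici_self ((T.tendsto_inward i k hs).eventually self_mem_nhdsWithin)
  have ev2 : ∀ᶠ r in 𝓝[>] (0 : ℝ), sidePoint (T.vert j) l (1 - 1 / 2) +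
      r • rot (T.vert j (l + 1) - T.vert j l) ∈ T.tri j :=
    nhdsWithin_mono _ Ioi_subset_Ici_self ((T.tendsto_inward j l hs').eventually self_mem_nhdsWithin)
  have ev3 : ∀ b : Mink, ∀ᶠ r in 𝓝[>] (0 : ℝ), a + r • b ∈ Metric.ball a ε := fun b => by
    have : Continuous fun r : ℝ => a + r • b := by fun_prop
    have := this.tendsto 0
    rw [zero_smul, add_zero] at this
    exact nhdsWithin_le_nhds (this.eventually (Metric.ball_mem_nhds a hε))
  obtain ⟨r, ⟨⟨⟨h1, h2⟩, h3⟩, h4⟩, hr⟩ :=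
    ((((ev1.and ev2).and (ev3 w)).and (ev3 w')).and self_mem_nhdsWithin).exists
  have hr : 0 < r := hr
  have e1 : a + r • w = J i (sidePoint (T.vert i) k (1 / 2) +
      r • rot (T.vert i (k + 1) - T.vert i k)) := by
    rw [affine_apply_eq (J i) (_ + _) (sidePoint (T.vert i) k (1 / 2)), add_sub_cancel_left,
      map_smul]
  have e2 : γ (a + r • w') = J j (sidePoint (T.vert j) l (1 - 1 / 2) +
      r • rot (T.vert j (l + 1) - T.vert j l)) := by
    rw [affine_apply_eq (J j) (_ + _) (sidePoint (T.vert j) l (1 - 1 / 2)), add_sub_cancel_left,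
      map_smul, map_add, map_smul, hγa, hw', γ.apply_symm_apply]
  have hci := (hJ i).2.1 _ (T.vert_mem_tri i 0)
  have hcj := (hJ j).2.1 _ (T.vert_mem_tri j 0)
  have hline : ∀ t ∈ Icc (0 : ℝ) 1, a + r • w + t • (r • (w' - w)) ∈ φ.target := by
    intro t ht
    rw [htarget]
    have := (convex_ball a ε).add_smul_sub_mem h3 h4 ht
    have e : a + r • w' - (a + r • w) = r • (w' - w) := by module
    rwa [e] at this
  have hgeo : T.IsSpacelikeGeodesic J (fun t => φ.symm (a + r • w + t • (r • (w' - w)))) 0 1 := by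
    refine ⟨φ.continuousOn_symm.comp (by fun_prop) hline, fun t ht => ?_⟩
    refine ⟨φ, hφ, a + r • w, r • (w' - w), ?_,
      φ.map_target (hline t (Ioo_subset_Icc_self ht)), ?_⟩
    · have h5 := hγ.minkB_conormals_le
      have h6 : minkQ (w' - w) = 2 * ‖T.vert i (k + 1) - T.vert i k‖ ^ 2 - 2 * minkB w w' := by
        have : minkQ (w' - w) = minkQ w' - 2 * minkB w w' + minkQ w := by
          simp only [minkQ, minkB_sub_left, minkB_sub_right, minkB_comm w' w]; ring
        rw [this, hγ.minkQ_left, hγ.minkQ_right]; ring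
      have h7 := hγ.norm_sub_pos
      rw [IsSpacelike, minkQ_smul, h6]
      have : 0 < r ^ 2 := by positivity
      refine mul_pos this ?_
      linarith
    · filter_upwards [Ioo_mem_nhds ht.1 ht.2] with s hs
      exact ⟨φ.map_target (hline s (Ioo_subset_Icc_self hs)),
        φ.right_inv (hline s (Ioo_subset_Icc_self hs))⟩
  have hmid := hc 0 1 _ zero_le_one hgeo
    (by
      rw [mem_causalFuture_iff hJ]
      simp only [zero_smul, add_zero]
      have hm : a + r • w ∈ T.cone J i := by rw [e1]; exact T.mem_cone J i h1
      rw [(hφs _ (htarget ▸ h3)).2.1 hm, height_toSusp]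
      change 1 ≤ heightForm (J i) (a + r • w)
      rw [e1, (hJ i).isDirectEmbedding.heightForm_apply hci])
    (by
      rw [mem_causalFuture_iff hJ]
      have e : a + r • w + (1 : ℝ) • (r • (w' - w)) = a + r • w' := by module
      simp only [e]
      have hm : γ (a + r • w') ∈ T.cone J j := by rw [e2]; exact T.mem_cone J j h2
      rw [(hφs _ (htarget ▸ h4)).2.2 hm, height_toSusp]
      change 1 ≤ heightForm (J j) (γ (a + r • w'))
      rw [e2, (hJ j).isDirectEmbedding.heightForm_apply hcj])
    (1 / 2) (by norm_num)
  rw [mem_causalFuture_iff hJ] at hmid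
  have hz := hline (1 / 2) (by norm_num)
  have e : a + r • w + (1 / 2 : ℝ) • (r • (w' - w)) = a + (r / 2) • u := by rw [huw]; module
  rw [e] at hz
  simp only [e] at hmid
  -- The midpoint may lie in either cone. In both cases its height is `1` plus `r / 2` times the
  -- height of `u`, and nonnegativity of the latter would make `u` zero or future pointing.
  rcases (hφs _ hz).1 with hm | hm
  · rw [(hφs _ hz).2.1 hm, height_toSusp] at hmid
    change 1 ≤ heightForm (J i) (a + (r / 2) • u) at hmid
    rw [heightForm_add, heightForm_smul, ha, (hJ i).isDirectEmbedding.heightForm_apply hci] at hmid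
    have h5 : 0 ≤ heightForm (J i) u := by
      by_contra h; push Not at h
      nlinarith
    rw [(hJ i).isDirectEmbedding.heightForm_nonneg_iff hci, minkB_nonpos_iff_of_timelike
      (hJ i).isDirectEmbedding.normal_future hγ.minkQ_conormalSum] at h5
    exact hu h5
  · rw [(hφs _ hz).2.2 hm, height_toSusp] at hmid
    change 1 ≤ heightForm (J j) (γ (a + (r / 2) • u)) at hmid
    rw [map_add, map_smul, heightForm_add, heightForm_smul, hγa,
      (hJ j).isDirectEmbedding.heightForm_apply hcj] at hmid
    have h5 : 0 ≤ heightForm (J j) (γ u) := by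
      by_contra h; push Not at h
      nlinarith
    have h6 : minkB (normal (J j)) (γ u) = minkB (γ.symm (normal (J j))) u := by
      rw [← SO0.minkB_map (SO0.symm_mem hγ.mem), γ.symm_apply_apply]
    rw [(hJ j).isDirectEmbedding.heightForm_nonneg_iff hcj, h6, minkB_nonpos_iff_of_timelike
      (SO0.timelike_map (SO0.symm_mem hγ.mem) (hJ j).isDirectEmbedding.normal_future)
      hγ.minkQ_conormalSum] at h5
    exact hu h5

end

end GeodesicTriangulation

end

theorem mainTheorem10 {X : Type*} [TopologicalSpace X] [T2Space X] [CompactSpace X]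
    (E : EuclideanConeSurface X) (τ : X → ℝ) (hτ : ∀ x, 0 ≤ τ x)
    (T : GeodesicTriangulation E) (hT : T.IsAdapted τ)
    (J : T.ι → E2 →ᵃ[ℝ] Mink) (hJ : ∀ i, T.IsSuspensionEmbedding τ i (J i)) :
    T.IsConvexMap J (T.embed J) ↔ E.IsQConvex τ := by
  exact ⟨fun h => (GeodesicTriangulation.edgesConvex_of_isConvexMap hJ h).isQConvex hT hJ, fun h =>
    (GeodesicTriangulation.edgesConvex_of_isQConvex hT hJ h).isConvexMap hJ⟩
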